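/- **Parameters.** Let $q,q',\ell$ be nonzero complex numbers with chosen square roots $q^{1/2},q'^{1/2},\ell^{1/2}$ such that $\overline{q^{1/2}}=1/q'^{1/2}$ and $\overline{\ell^{1/2}}=\ell^{1/2}$ (so $\bar q=1/q'$ and $\bar\ell=\ell>0$). Assume that $q$ is not a root of unity. Let $\Gamma,\Gamma'\subset\mathbb C^\times$ be the multiplicative groups generated by $q^{1/2},\ell^{1/2}$ and by $q'^{1/2},\ell^{1/2}$ respectively. **QUEA.** $\mathcal U=\mathcal U_{q,q'}(\mathrm{sl}_2\stackrel{\ell}{\oplus}\mathrm{sl}_2)$ is the complex algebra generated by $e_\pm$, $k_u$ ($u\in\Gamma$), $e'_\pm$, $k'_v$ ($v\in\Gamma'$), where $k_u$ stands for $(u^2)^{\mathbf h}$ and $k'_v$ for $(v^2)^{\mathbf h'}$; thus $q^{\mathbf h}=k_{q^{1/2}}$, $\ell^{\mathbf h}=k_{\ell^{1/2}}$, $q'^{\mathbf h'}=k'_{q'^{1/2}}$, $\ell^{\mathbf h'}=k'_{\ell^{1/2}}$. The relations are $k_1=1$, $k_{uv}=k_uk_v$, $k_ue_\pm=u^{\pm2}e_\pm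 k_u$, $[e_+,e_-]=\frac{q^{2\mathbf h}-q^{-2\mathbf h}}{q-q^{-1}}$, the same relations for the primed generators with $q'$ in place of $q$, and every unprimed generator commutes with every primed one. It is a Hopf algebra with $k_u,k'_v$ group-like, $\epsilon(e_\pm)=\epsilon(e'_\pm)=0$, $$\Delta(e_\pm)=e_\pm\otimes q^{\mathbf h}\ell^{\pm\mathbf h'}+q^{-\mathbf h}\ell^{\mp\mathbf h'}\otimes e_\pm,\qquad \Delta(e'_\pm)=e'_\pm\otimes q'^{\mathbf h'}\ell^{\mp\mathbf h}+q'^{-\mathbf h'}\ell^{\pm\mathbf h}\otimes e'_\pm,$$ $S(e_\pm)=-q^{\pm1}e_\pm$, $S(e'_\pm)=-q'^{\pm1}e'_\pm$, $S(k_u)=k_{u^{-1}}$, $S(k'_v)=k'_{v^{-1}}$. **QFA.** $\mathcal F=\mathrm{SL}_q(2)\stackrel{\ell}{\oplus}\mathrm{SL}_{1/q'}(2)$ is the complex algebra generated by $a,b,c,d,a',b',c',d'$ with the Manin relations $ab=q^{-1}ba$, $ac=q^{-1}ca$, $bd=q^{-1}db$, $cd=q^{-1}dc$, $ad-da=(q^{-1}-q)bc$,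 $bc=cb$ and $ad-q^{-1}bc=1$, the same relations for $a',b',c',d'$ with $1/q'$ in place of $q$, and the link relations $$b'a=\ell ab',\ ac'=\ell c'a,\ a'b=\ell ba',\ bd'=\ell d'b,\ ca'=\ell a'c,\ d'c=\ell cd',\ db'=\ell b'd,\ c'd=\ell dc',$$ while $a,d$ commute with $a',d'$, and $b,c$ commute with $b',c'$. It is a Hopf algebra with the matrix comultiplication and counit in each sector and with $S\begin{pmatrix}a&b\\c&d\end{pmatrix}=\begin{pmatrix}d&-qb\\-q^{-1}c&a\end{pmatrix}$, $S\begin{pmatrix}a'&b'\\c'&d'\end{pmatrix}=\begin{pmatrix}d'&-q'^{-1}b'\\-q'c'&a'\end{pmatrix}$. **Star structures.** Fix a sign $\sigma\in\{1,-1\}$. Let $*$ be the antilinear antimultiplicative map of $\mathcal U$ with $e_\pm^*=\sigma e'_\pm$, $e'^{\,*}_\pm=\sigma e_\pm$, $k_u^*=k'_{1/\bar u}$, $k'^{\,*}_v=k_{1/\bar v}$ (so $(q^{\mathbf h})^*=q'^{\mathbf h'}$, $(q'^{\mathbf h'})^*=q^{\mathbf h}$, $(\ell^{\mathbf h})^*=\ell^{-\mathbf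 h'}$). Let $\star$ be the antilinear antimultiplicative map of $\mathcal F$ with $$\begin{pmatrix}a&b\\c&d\end{pmatrix}^\star=S\begin{pmatrix}a'&c'\\b'&d'\end{pmatrix},\qquad \begin{pmatrix}a'&b'\\c'&d'\end{pmatrix}^\star=S\begin{pmatrix}a&c\\b&d\end{pmatrix}.$$ **Proposition.** For each sign $\sigma$, $(\mathcal U,*)$ and $(\mathcal F,\star)$ are Hopf star algebras: $*$ and $\star$ are unital involutions with $\Delta(x^*)=\Delta(x)^{*\otimes *}$, $\epsilon(x^*)=\overline{\epsilon(x)}$, $S(S(x^*)^*)=x$, and likewise for $\star$. There is exactly one dual pairing of Hopf algebras $\langle\cdot,\cdot\rangle:\mathcal U\times\mathcal F\to\mathbb C$, that is, a bilinear map with $\langle xy,f\rangle=\langle x,f_{(1)}\rangle\langle y,f_{(2)}\rangle$, $\langle x,fg\rangle=\langle x_{(1)},f\rangle\langle x_{(2)},g\rangle$, $\langle1,f\rangle=\epsilon(f)$, $\langle x,1\rangle=\epsilon(x)$, $\langle S(x),f\rangle=\langle x,S(f)\rangle$, such that $$\langle q^{\mathbf h},a\rangle=q^{1/2},\ \langle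 q^{\mathbf h},d\rangle=q^{-1/2},\ \langle\ell^{\mathbf h},a\rangle=\ell^{1/2},\ \langle\ell^{\mathbf h},d\rangle=\ell^{-1/2},\ \langle e_+,b\rangle=\langle e_-,c\rangle=1,$$ $$\langle q'^{\mathbf h'},a'\rangle=q'^{-1/2},\ \langle q'^{\mathbf h'},d'\rangle=q'^{1/2},\ \langle\ell^{\mathbf h'},a'\rangle=\ell^{-1/2},\ \langle\ell^{\mathbf h'},d'\rangle=\ell^{1/2},\ \langle e'_+,c'\rangle=\langle e'_-,b'\rangle=\sigma,$$ $q^{\mathbf h},\ell^{\mathbf h}$ take the value $1$ on $a',d'$, $q'^{\mathbf h'},\ell^{\mathbf h'}$ take the value $1$ on $a,d$, and all other pairings of $q^{\mathbf h},\ell^{\mathbf h},e_\pm,q'^{\mathbf h'},\ell^{\mathbf h'},e'_\pm$ with $a,b,c,d,a',b',c',d'$ vanish. This pairing is nondegenerate in both arguments and satisfies $$\langle x^*,f\rangle=\overline{\langle x,S(f)^\star\rangle}\qquad\text{for all }x\in\mathcal U,\ f\in\mathcal F,$$ so it is a perfect duality between the Hopf star algebras $(\mathcal U,*)$ and $(\mathcal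 F,\star)$. -/

import Mathlib

open scoped TensorProduct

noncomputable section

/-! ### Algebras given by generators and relations -/

namespace Presented

variable {X : Type} (r : FreeAlgebra ℂ X → FreeAlgebra ℂ X → Prop)

/-- The class of a generator in the algebra presented by the relations `r`. -/
def gen (x : X) : RingQuot r := RingQuot.mkAlgHom ℂ r (FreeAlgebra.ι ℂ x)

variable {r} {A : Type} [Semiring A] [Algebra ℂ A]

/-- The universal property of an algebra given by generators and relations. -/
def lift (f : X → A)
    (h : ∀ ⦃x y⦄, r x y → FreeAlgebra.lift ℂ f x = FreeAlgebra.lift ℂ f y) :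
    RingQuot r →ₐ[ℂ] A :=
  RingQuot.liftAlgHom ℂ ⟨FreeAlgebra.lift ℂ f, h⟩

theorem lift_gen (f : X → A)
    (h : ∀ ⦃x y⦄, r x y → FreeAlgebra.lift ℂ f x = FreeAlgebra.lift ℂ f y) (x : X) :
    lift f h (gen r x) = f x := by
  rw [lift, gen, RingQuot.liftAlgHom_mkAlgHom_apply, FreeAlgebra.lift_ι_apply]

theorem hom_ext {f g : RingQuot r →ₐ[ℂ] A} (h : ∀ x, f (gen r x) = g (gen r x)) : f = g := by
  apply RingQuot.ringQuot_ext'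
  apply FreeAlgebra.hom_ext
  funext x
  exact h x

theorem induction {C : RingQuot r → Prop} (h0 : ∀ z : ℂ, C (algebraMap ℂ _ z))
    (h1 : ∀ x, C (gen r x)) (hm : ∀ a b, C a → C b → C (a * b))
    (ha : ∀ a b, C a → C b → C (a + b)) (x : RingQuot r) : C x := by
  obtain ⟨y, rfl⟩ := RingQuot.mkAlgHom_surjective ℂ r x
  induction y using FreeAlgebra.induction with
  | grade0 z => simpa using h0 z
  | grade1 x => exact h1 x
  | mul a b ha hb => rw [map_mul]; exact hm _ _ ha hb
  | add a b hx hb => rw [map_add]; exact ha _ _ hx hb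

theorem mk_lift (w : FreeAlgebra ℂ X) :
    RingQuot.mkAlgHom ℂ r w = FreeAlgebra.lift ℂ (gen r) w := by
  have : RingQuot.mkAlgHom ℂ r = FreeAlgebra.lift ℂ (gen r) := by
    apply FreeAlgebra.hom_ext
    funext x
    simp [gen]
  rw [this]

theorem rel {x y : FreeAlgebra ℂ X} (h : r x y) :
    FreeAlgebra.lift ℂ (gen r) x = FreeAlgebra.lift ℂ (gen r) y := by
  rw [← mk_lift, ← mk_lift, RingQuot.mkAlgHom_rel ℂ h]

/-- The linear map underlying an algebra map to the opposite algebra. -/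
def unopLin {A : Type} [Semiring A] [Algebra ℂ A] (S : A →ₐ[ℂ] Aᵐᵒᵖ) : A →ₗ[ℂ] A :=
  (MulOpposite.opLinearEquiv ℂ).symm.toLinearMap ∘ₗ S.toLinearMap

@[simp] theorem unopLin_apply {A : Type} [Semiring A] [Algebra ℂ A] (S : A →ₐ[ℂ] Aᵐᵒᵖ) (x : A) :
    unopLin S x = (S x).unop := rfl

section Antipode

variable {A : Type} [Semiring A] [Bialgebra ℂ A] (S : A →ₐ[ℂ] Aᵐᵒᵖ)

theorem left_mul {x y : A}
    (hx : LinearMap.mul' ℂ A ((unopLin S).rTensor A (Coalgebra.comul x)) =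
      algebraMap ℂ A (Coalgebra.counit x))
    (hy : LinearMap.mul' ℂ A ((unopLin S).rTensor A (Coalgebra.comul y)) =
      algebraMap ℂ A (Coalgebra.counit y)) :
    LinearMap.mul' ℂ A ((unopLin S).rTensor A (Coalgebra.comul (x * y))) =
      algebraMap ℂ A (Coalgebra.counit (x * y)) := by
  have key : ∀ (c d : A) (t : A ⊗[ℂ] A),
      LinearMap.mul' ℂ A ((unopLin S).rTensor A (t * c ⊗ₜ[ℂ] d)) =
        unopLin S c * LinearMap.mul' ℂ A ((unopLin S).rTensor A t) * d := by
    intro c d t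
    induction t using TensorProduct.induction_on with
    | zero => simp
    | tmul a b => simp [mul_assoc]
    | add a b ha hb => simp only [add_mul, map_add, ha, hb, mul_add]
  have key2 : ∀ u : A ⊗[ℂ] A,
      LinearMap.mul' ℂ A ((unopLin S).rTensor A (Coalgebra.comul x * u)) =
        algebraMap ℂ A (Coalgebra.counit x) *
          LinearMap.mul' ℂ A ((unopLin S).rTensor A u) := by
    intro u
    induction u using TensorProduct.induction_on with
    | zero => simp
    | tmul a b =>
      rw [key, hx, ← Algebra.commutes]
      simp [mul_assoc]
    | add a b ha hb => simp only [map_add, ha, hb, mul_add]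
  rw [Bialgebra.comul_mul, key2, hy, Bialgebra.counit_mul, map_mul]

theorem right_mul {x y : A}
    (hx : LinearMap.mul' ℂ A ((unopLin S).lTensor A (Coalgebra.comul x)) =
      algebraMap ℂ A (Coalgebra.counit x))
    (hy : LinearMap.mul' ℂ A ((unopLin S).lTensor A (Coalgebra.comul y)) =
      algebraMap ℂ A (Coalgebra.counit y)) :
    LinearMap.mul' ℂ A ((unopLin S).lTensor A (Coalgebra.comul (x * y))) =
      algebraMap ℂ A (Coalgebra.counit (x * y)) := by
  have key : ∀ (c d : A) (t : A ⊗[ℂ] A),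
      LinearMap.mul' ℂ A ((unopLin S).lTensor A (c ⊗ₜ[ℂ] d * t)) =
        c * LinearMap.mul' ℂ A ((unopLin S).lTensor A t) * unopLin S d := by
    intro c d t
    induction t using TensorProduct.induction_on with
    | zero => simp
    | tmul a b => simp [mul_assoc]
    | add a b ha hb => simp only [add_mul, map_add, ha, hb, mul_add]
  have key2 : ∀ u : A ⊗[ℂ] A,
      LinearMap.mul' ℂ A ((unopLin S).lTensor A (u * Coalgebra.comul y)) =
        LinearMap.mul' ℂ A ((unopLin S).lTensor A u) *
          algebraMap ℂ A (Coalgebra.counit y) := by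
    intro u
    induction u using TensorProduct.induction_on with
    | zero => simp
    | tmul a b =>
      rw [key, hy, mul_assoc, Algebra.commutes]
      simp [mul_assoc]
    | add a b ha hb => simp only [map_add, ha, hb, add_mul]
  rw [Bialgebra.comul_mul, key2, hx, Bialgebra.counit_mul, map_mul]

theorem left_algebraMap (z : ℂ) :
    LinearMap.mul' ℂ A ((unopLin S).rTensor A (Coalgebra.comul (algebraMap ℂ A z))) =
      algebraMap ℂ A (Coalgebra.counit (algebraMap ℂ A z)) := by
  rw [Bialgebra.comul_algebraMap, Bialgebra.counit_algebraMap,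
    Algebra.TensorProduct.algebraMap_apply]
  simp

theorem right_algebraMap (z : ℂ) :
    LinearMap.mul' ℂ A ((unopLin S).lTensor A (Coalgebra.comul (algebraMap ℂ A z))) =
      algebraMap ℂ A (Coalgebra.counit (algebraMap ℂ A z)) := by
  rw [Bialgebra.comul_algebraMap, Bialgebra.counit_algebraMap,
    Algebra.TensorProduct.algebraMap_apply]
  simp

end Antipode

/-- The opposite algebra of `A` with the complex conjugate scalar action: an algebra map
`A →ₐ[ℂ] ConjOp A` is a conjugate-linear, unital, anti-multiplicative map `A → A`. -/
def ConjOp (A : Type) : Type := Aᵐᵒᵖ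

instance (A : Type) [Ring A] : Ring (ConjOp A) := inferInstanceAs (Ring Aᵐᵒᵖ)

instance (A : Type) [Ring A] [Algebra ℂ A] : Algebra ℂ (ConjOp A) :=
  RingHom.toAlgebra' ((algebraMap ℂ Aᵐᵒᵖ).comp (starRingEnd ℂ)) fun z x =>
    Algebra.commutes (A := Aᵐᵒᵖ) (starRingEnd ℂ z) x

/-- The element of `A` underlying an element of `ConjOp A`, and conversely. -/
def toConjOp {A : Type} (x : A) : ConjOp A := MulOpposite.op x

/-- See `toConjOp`. -/
def ofConjOp {A : Type} (x : ConjOp A) : A := MulOpposite.unop x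

section

variable {A : Type} [Ring A]

theorem toConjOp_mul (x y : A) : toConjOp x * toConjOp y = toConjOp (y * x) := rfl
theorem toConjOp_add (x y : A) : toConjOp x + toConjOp y = toConjOp (x + y) := rfl
theorem toConjOp_sub (x y : A) : toConjOp x - toConjOp y = toConjOp (x - y) := rfl
theorem toConjOp_one : (1 : ConjOp A) = toConjOp 1 := rfl
variable [Algebra ℂ A]

theorem toConjOp_smul (z : ℂ) (x : A) :
    z • toConjOp x = toConjOp (starRingEnd ℂ z • x) := by
  rw [Algebra.smul_def, Algebra.smul_def, Algebra.commutes]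
  rfl

/-- The conjugate-linear map underlying an algebra map to `ConjOp A`. -/
def conjLin (f : A →ₐ[ℂ] ConjOp A) : A →ₛₗ[starRingEnd ℂ] A where
  toFun x := ofConjOp (f x)
  map_add' x y := by rw [map_add]; rfl
  map_smul' z x := by
    rw [map_smul]
    exact congrArg ofConjOp (toConjOp_smul z (ofConjOp (f x)))

end

end Presented

/-! ### Hopf star algebras and their dualities -/

/-- A star structure on a complex Hopf algebra: an antilinear unital antimultiplicative involution
compatible with the comultiplication, the counit and the antipode. -/
structure IsHopfStar {H : Type} [Ring H] [HopfAlgebra ℂ H] (σ : H →ₛₗ[starRingEnd ℂ] H) :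
    Prop where
  map_one : σ 1 = 1
  map_mul : ∀ x y, σ (x * y) = σ y * σ x
  involutive : ∀ x, σ (σ x) = x
  comul : ∀ x, Coalgebra.comul (R := ℂ) (σ x) = TensorProduct.map σ σ (Coalgebra.comul (R := ℂ) x)
  counit : ∀ x, Coalgebra.counit (R := ℂ) (σ x) = starRingEnd ℂ (Coalgebra.counit (R := ℂ) x)
  antipode : ∀ x, HopfAlgebra.antipode ℂ (σ (HopfAlgebra.antipode ℂ (σ x))) = x

section Pairing

variable {H F : Type} [Ring H] [HopfAlgebra ℂ H] [Ring F] [HopfAlgebra ℂ F]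

/-- The pairing `⟨x ⊗ y, f ⊗ g⟩ = ⟨x, f⟩ ⟨y, g⟩` induced on tensor squares. -/
def tensorPairing (B : H →ₗ[ℂ] F →ₗ[ℂ] ℂ) : H ⊗[ℂ] H →ₗ[ℂ] F ⊗[ℂ] F →ₗ[ℂ] ℂ :=
  (TensorProduct.map₂ B B).compr₂ (TensorProduct.lid ℂ ℂ).toLinearMap

/-- A dual pairing of Hopf algebras. -/
structure IsHopfPairing (B : H →ₗ[ℂ] F →ₗ[ℂ] ℂ) : Prop where
  mul_left : ∀ x y f, B (x * y) f = tensorPairing B (x ⊗ₜ y) (Coalgebra.comul (R := ℂ) f)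
  mul_right : ∀ x f g, B x (f * g) = tensorPairing B (Coalgebra.comul (R := ℂ) x) (f ⊗ₜ g)
  one_left : ∀ f, B 1 f = Coalgebra.counit (R := ℂ) f
  one_right : ∀ x, B x 1 = Coalgebra.counit (R := ℂ) x
  antipode : ∀ x f, B (HopfAlgebra.antipode ℂ x) f = B x (HopfAlgebra.antipode ℂ f)

/-- `B` is a perfect duality between the Hopf star algebras `(H, σ)` and `(F, τ)`: it is a dual
pairing of Hopf algebras, nondegenerate in both arguments, and
`⟨x^σ, f⟩ = conj ⟨x, S(f)^τ⟩`. -/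
structure IsPerfectStarDuality (σ : H →ₛₗ[starRingEnd ℂ] H) (τ : F →ₛₗ[starRingEnd ℂ] F)
    (B : H →ₗ[ℂ] F →ₗ[ℂ] ℂ) : Prop where
  star_left : IsHopfStar σ
  star_right : IsHopfStar τ
  pairing : IsHopfPairing B
  nondegenerate_left : ∀ x, (∀ f, B x f = 0) → x = 0
  nondegenerate_right : ∀ f, (∀ x, B x f = 0) → f = 0
  star : ∀ x f, B (σ x) f = starRingEnd ℂ (B x (τ (HopfAlgebra.antipode ℂ f)))

end Pairing

/-! ### The parameters -/

/-- The deformation parameters `q`, `q'`, `ℓ`, nonzero complex numbers given together with square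
roots `rq = q^(1/2)`, `rq' = q'^(1/2)`, `rl = ℓ^(1/2)`. -/
structure LinkParams where
  rq : ℂˣ
  rq' : ℂˣ
  rl : ℂˣ

namespace LinkParams

variable (P : LinkParams)

/-- The parameter `q`. -/
def q : ℂ := (P.rq : ℂ) ^ 2

/-- The antichiral parameter. -/
def q' : ℂ := (P.rq' : ℂ) ^ 2

/-- The link parameter `ℓ`. -/
def l : ℂ := (P.rl : ℂ) ^ 2

theorem q_ne : P.q ≠ 0 := pow_ne_zero _ P.rq.ne_zero
theorem q'_ne : P.q' ≠ 0 := pow_ne_zero _ P.rq'.ne_zero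
theorem l_ne : P.l ≠ 0 := pow_ne_zero _ P.rl.ne_zero

/-- The multiplicative group generated by `q^(1/2)` and `ℓ^(1/2)`. -/
def Γ : Subgroup ℂˣ := Subgroup.closure {P.rq, P.rl}

/-- The multiplicative group generated by the square roots of the antichiral parameter and of
the link parameter. -/
def Γ' : Subgroup ℂˣ := Subgroup.closure {P.rq', P.rl}

/-- `q^(1/2)` as an element of `Γ`. -/
def gq : P.Γ := ⟨P.rq, Subgroup.subset_closure (by simp)⟩

/-- `ℓ^(1/2)` as an element of `Γ`. -/
def gl : P.Γ := ⟨P.rl, Subgroup.subset_closure (by simp)⟩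

/-- The antichiral analogue of `gq`. -/
def gq' : P.Γ' := ⟨P.rq', Subgroup.subset_closure (by simp)⟩

/-- `ℓ^(1/2)` as an element of the antichiral group. -/
def gl' : P.Γ' := ⟨P.rl, Subgroup.subset_closure (by simp)⟩

/-- The reality conditions `conj q = 1 / q'` and `conj ℓ = ℓ`, for the chosen square roots. -/
structure IsLorentz : Prop where
  conj_q : starRingEnd ℂ (P.rq : ℂ) = (P.rq' : ℂ)⁻¹
  conj_l : starRingEnd ℂ (P.rl : ℂ) = (P.rl : ℂ)

end LinkParams

namespace LinkParams

variable {P : LinkParams}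

/-- The map `u ↦ 1 / conj u`. -/
def conjInv : ℂˣ →* ℂˣ := (Units.map (starRingEnd ℂ : ℂ →* ℂ))⁻¹

theorem coe_conjInv (u : ℂˣ) : ((conjInv u : ℂˣ) : ℂ) = (starRingEnd ℂ (u : ℂ))⁻¹ := by
  simp [conjInv]

theorem conjInv_conjInv (u : ℂˣ) : conjInv (conjInv u) = u := by
  ext
  simp [coe_conjInv]

theorem IsLorentz.conjInv_rq (hP : P.IsLorentz) : conjInv P.rq = P.rq' := by
  ext
  rw [coe_conjInv, hP.conj_q, inv_inv]

theorem IsLorentz.conjInv_rq' (hP : P.IsLorentz) : conjInv P.rq' = P.rq := by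
  rw [← hP.conjInv_rq, conjInv_conjInv]

theorem IsLorentz.conjInv_rl (hP : P.IsLorentz) : conjInv P.rl = P.rl⁻¹ := by
  ext
  rw [coe_conjInv, hP.conj_l, Units.val_inv_eq_inv_val]

theorem IsLorentz.conj_q_eq (hP : P.IsLorentz) : starRingEnd ℂ P.q = P.q'⁻¹ := by
  rw [q, q', map_pow, hP.conj_q, inv_pow]

theorem IsLorentz.conj_q'_eq (hP : P.IsLorentz) : starRingEnd ℂ P.q' = P.q⁻¹ := by
  have h := congrArg (starRingEnd ℂ) hP.conj_q_eq
  rw [Complex.conj_conj, map_inv₀] at h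
  rw [h, inv_inv]

theorem IsLorentz.conj_l_eq (hP : P.IsLorentz) : starRingEnd ℂ P.l = P.l := by
  rw [l, map_pow, hP.conj_l]

theorem IsLorentz.mem (hP : P.IsLorentz) (u : P.Γ) : conjInv u ∈ P.Γ' := by
  have h : P.Γ ≤ P.Γ'.comap conjInv := by
    rw [Γ, Subgroup.closure_le]
    rintro x (rfl | rfl)
    · rw [SetLike.mem_coe, Subgroup.mem_comap, hP.conjInv_rq]
      exact P.gq'.2
    · rw [SetLike.mem_coe, Subgroup.mem_comap, hP.conjInv_rl]
      exact (P.gl'⁻¹).2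
  exact h u.2

theorem IsLorentz.mem' (hP : P.IsLorentz) (u : P.Γ') : conjInv u ∈ P.Γ := by
  have h : P.Γ' ≤ P.Γ.comap conjInv := by
    rw [Γ', Subgroup.closure_le]
    rintro x (rfl | rfl)
    · rw [SetLike.mem_coe, Subgroup.mem_comap, hP.conjInv_rq']
      exact P.gq.2
    · rw [SetLike.mem_coe, Subgroup.mem_comap, hP.conjInv_rl]
      exact (P.gl⁻¹).2
  exact h u.2

/-- The map `u ↦ 1 / conj u` from `Γ` to the antichiral group. -/
def IsLorentz.conjΓ (hP : P.IsLorentz) : P.Γ →* P.Γ' :=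
  (conjInv.comp P.Γ.subtype).codRestrict P.Γ' hP.mem

/-- The inverse of `conjΓ`. -/
def IsLorentz.conjΓ' (hP : P.IsLorentz) : P.Γ' →* P.Γ :=
  (conjInv.comp P.Γ'.subtype).codRestrict P.Γ hP.mem'

theorem IsLorentz.coe_conjΓ (hP : P.IsLorentz) (u : P.Γ) :
    ((hP.conjΓ u : ℂˣ) : ℂ) = (starRingEnd ℂ ((u : ℂˣ) : ℂ))⁻¹ := coe_conjInv _

theorem IsLorentz.coe_conjΓ' (hP : P.IsLorentz) (u : P.Γ') :
    ((hP.conjΓ' u : ℂˣ) : ℂ) = (starRingEnd ℂ ((u : ℂˣ) : ℂ))⁻¹ := coe_conjInv _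

theorem IsLorentz.conjΓ_gq (hP : P.IsLorentz) : hP.conjΓ P.gq = P.gq' :=
  Subtype.ext hP.conjInv_rq

theorem IsLorentz.conjΓ'_gq' (hP : P.IsLorentz) : hP.conjΓ' P.gq' = P.gq :=
  Subtype.ext hP.conjInv_rq'

end LinkParams

/-! ### The q-linked quantum universal enveloping algebra -/

/-- Generators: `ep`, `em` are `e_+`, `e_-`; for `u ∈ Γ`, `k u` is the Cartan element `(u²)^h`,
so that `k gq = q^h` and `k gl = ℓ^h`. The primed ones are those of the antichiral sector. -/
inductive QUEAGen (P : LinkParams) : Type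
  | ep | em | k (u : P.Γ)
  | ep' | em' | k' (v : P.Γ')

namespace QUEAGen

variable {P : LinkParams}

/-- The generators of the chiral sector. -/
inductive Chiral : QUEAGen P → Prop
  | ep : Chiral ep
  | em : Chiral em
  | k (u : P.Γ) : Chiral (k u)

/-- The generators of the antichiral sector. -/
inductive Antichiral : QUEAGen P → Prop
  | ep' : Antichiral ep'
  | em' : Antichiral em'
  | k' (v : P.Γ') : Antichiral (k' v)

/-- A generator as an element of the free algebra. -/
abbrev fr (x : QUEAGen P) : FreeAlgebra ℂ (QUEAGen P) := FreeAlgebra.ι ℂ x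

end QUEAGen

open QUEAGen in
/-- The defining relations: in each sector `q^h e_± = q^{±1} e_± q^h`, also
`ℓ^h e_± = ℓ^{±1} e_± ℓ^h`, and `[e_+, e_-] = (q^{2h} - q^{-2h}) / (q - q^{-1})`; the two sectors
commute. -/
inductive QUEARel (P : LinkParams) :
    FreeAlgebra ℂ (QUEAGen P) → FreeAlgebra ℂ (QUEAGen P) → Prop
  | k_one : QUEARel P (fr (k 1)) 1
  | k_mul (u v : P.Γ) : QUEARel P (fr (k (u * v))) (fr (k u) * fr (k v))
  | k_ep (u : P.Γ) : QUEARel P (fr (k u) * fr ep) (((u : ℂˣ) : ℂ) ^ 2 • (fr ep * fr (k u)))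
  | k_em (u : P.Γ) : QUEARel P (fr (k u) * fr em) ((((u : ℂˣ) : ℂ) ^ 2)⁻¹ • (fr em * fr (k u)))
  | ep_em : QUEARel P (fr ep * fr em - fr em * fr ep)
      ((P.q - P.q⁻¹)⁻¹ • (fr (k P.gq) ^ 2 - fr (k P.gq⁻¹) ^ 2))
  | k_one' : QUEARel P (fr (k' 1)) 1
  | k_mul' (u v : P.Γ') : QUEARel P (fr (k' (u * v))) (fr (k' u) * fr (k' v))
  | k_ep' (u : P.Γ') : QUEARel P (fr (k' u) * fr ep') (((u : ℂˣ) : ℂ) ^ 2 • (fr ep' * fr (k' u)))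
  | k_em' (u : P.Γ') :
      QUEARel P (fr (k' u) * fr em') ((((u : ℂˣ) : ℂ) ^ 2)⁻¹ • (fr em' * fr (k' u)))
  | ep_em' : QUEARel P (fr ep' * fr em' - fr em' * fr ep')
      ((P.q' - P.q'⁻¹)⁻¹ • (fr (k' P.gq') ^ 2 - fr (k' P.gq'⁻¹) ^ 2))
  | link (x y : QUEAGen P) (hx : Chiral x) (hy : Antichiral y) :
      QUEARel P (fr x * fr y) (fr y * fr x)

/-- The q-linked enveloping algebra `U_{q,q'}(sl₂ ⊕^ℓ sl₂)`. -/
def QUEA (P : LinkParams) : Type := RingQuot (QUEARel P)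

namespace QUEA

variable (P : LinkParams)

instance : Ring (QUEA P) := inferInstanceAs (Ring (RingQuot (QUEARel P)))

instance : Algebra ℂ (QUEA P) := inferInstanceAs (Algebra ℂ (RingQuot (QUEARel P)))

variable {P}

/-- The classes of the generators. -/
def gen (x : QUEAGen P) : QUEA P := Presented.gen (QUEARel P) x

/-! The generators `e_±`, the Cartan elements `k u = (u²)^h`, and `q^h`, `ℓ^h`; the primed ones
are those of the antichiral sector. -/

def ep : QUEA P := gen .ep
def em : QUEA P := gen .em
def k (u : P.Γ) : QUEA P := gen (.k u)
def ep' : QUEA P := gen .ep'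
def em' : QUEA P := gen .em'
def k' (v : P.Γ') : QUEA P := gen (.k' v)

def qh : QUEA P := k P.gq
def lh : QUEA P := k P.gl
def qh' : QUEA P := k' P.gq'
def lh' : QUEA P := k' P.gl'

theorem rel {x y : FreeAlgebra ℂ (QUEAGen P)} (h : QUEARel P x y) :
    FreeAlgebra.lift ℂ (gen (P := P)) x = FreeAlgebra.lift ℂ gen y :=
  Presented.rel h

theorem k_one : (k 1 : QUEA P) = 1 := by simpa [k, k', ep, em, ep', em'] using rel .k_one
theorem k_mul (u v : P.Γ) : k (u * v) = k u * k v := by simpa [k, k', ep, em, ep', em'] using rel (.k_mul u v)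
theorem k_ep (u : P.Γ) : k u * ep = ((u : ℂˣ) : ℂ) ^ 2 • (ep * k u) := by
  simpa [k, k', ep, em, ep', em'] using rel (.k_ep u)
theorem k_em (u : P.Γ) : k u * em = (((u : ℂˣ) : ℂ) ^ 2)⁻¹ • (em * k u) := by
  simpa [k, k', ep, em, ep', em'] using rel (.k_em u)
theorem ep_em : (ep * em - em * ep : QUEA P) =
    (P.q - P.q⁻¹)⁻¹ • (k P.gq ^ 2 - k P.gq⁻¹ ^ 2) := by
  simpa [k, k', ep, em, ep', em'] using rel .ep_em
theorem k_one' : (k' 1 : QUEA P) = 1 := by simpa [k, k', ep, em, ep', em'] using rel .k_one'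
theorem k_mul' (u v : P.Γ') : k' (u * v) = k' u * k' v := by simpa [k, k', ep, em, ep', em'] using rel (.k_mul' u v)
theorem k_ep' (u : P.Γ') : k' u * ep' = ((u : ℂˣ) : ℂ) ^ 2 • (ep' * k' u) := by
  simpa [k, k', ep, em, ep', em'] using rel (.k_ep' u)
theorem k_em' (u : P.Γ') : k' u * em' = (((u : ℂˣ) : ℂ) ^ 2)⁻¹ • (em' * k' u) := by
  simpa [k, k', ep, em, ep', em'] using rel (.k_em' u)
theorem ep_em' : (ep' * em' - em' * ep' : QUEA P) =
    (P.q' - P.q'⁻¹)⁻¹ • (k' P.gq' ^ 2 - k' P.gq'⁻¹ ^ 2) := by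
  simpa [k, k', ep, em, ep', em'] using rel .ep_em'
theorem link {x y : QUEAGen P} (hx : x.Chiral) (hy : y.Antichiral) :
    gen x * gen y = gen y * gen x := by
  simpa using rel (.link x y hx hy)

/-- Construction of algebra maps out of the enveloping algebra. -/
def lift {A : Type} [Semiring A] [Algebra ℂ A] (f : QUEAGen P → A)
    (h : ∀ ⦃x y⦄, QUEARel P x y → FreeAlgebra.lift ℂ f x = FreeAlgebra.lift ℂ f y) :
    QUEA P →ₐ[ℂ] A :=
  Presented.lift f h

theorem lift_gen {A : Type} [Semiring A] [Algebra ℂ A] (f : QUEAGen P → A)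
    (h : ∀ ⦃x y⦄, QUEARel P x y → FreeAlgebra.lift ℂ f x = FreeAlgebra.lift ℂ f y)
    (x : QUEAGen P) : lift f h (gen x) = f x :=
  Presented.lift_gen f h x

theorem hom_ext {A : Type} [Semiring A] [Algebra ℂ A] {f g : QUEA P →ₐ[ℂ] A}
    (h : ∀ x, f (gen x) = g (gen x)) : f = g :=
  Presented.hom_ext h

theorem induction {C : QUEA P → Prop} (h0 : ∀ z : ℂ, C (algebraMap ℂ _ z))
    (h1 : ∀ x, C (gen x)) (hm : ∀ a b, C a → C b → C (a * b))
    (ha : ∀ a b, C a → C b → C (a + b)) (x : QUEA P) : C x :=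
  Presented.induction (r := QUEARel P) h0 h1 hm ha x

/-- The Cartan elements `k u * k' v` commute up to scalars with everything. -/
def kk (u : P.Γ) (v : P.Γ') : QUEA P := k u * k' v

theorem k_k' (u : P.Γ) (v : P.Γ') : k u * k' v = k' v * k u := link (.k u) (.k' v)
theorem k_ep'_comm (u : P.Γ) : k u * ep' = ep' * k u := link (.k u) .ep'
theorem k_em'_comm (u : P.Γ) : k u * em' = em' * k u := link (.k u) .em'
theorem ep_k'_comm (u : P.Γ') : ep * k' u = k' u * ep := link .ep (.k' u)
theorem em_k'_comm (u : P.Γ') : em * k' u = k' u * em := link .em (.k' u)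

theorem k_eq_kk (u : P.Γ) : k u = kk u 1 := by rw [kk, k_one', mul_one]
theorem k'_eq_kk (v : P.Γ') : k' v = kk 1 v := by rw [kk, k_one, one_mul]

theorem kk_one : (kk 1 1 : QUEA P) = 1 := by rw [kk, k_one, k_one', mul_one]

theorem kk_mul (u u₁ : P.Γ) (v v₁ : P.Γ') :
    kk u v * kk u₁ v₁ = kk (u * u₁) (v * v₁) := by
  rw [kk, kk, kk, k_mul, k_mul', mul_assoc, ← mul_assoc (k' v), ← k_k', mul_assoc, mul_assoc]

theorem kk_ep (u : P.Γ) (v : P.Γ') :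
    kk u v * ep = ((u : ℂˣ) : ℂ) ^ 2 • (ep * kk u v) := by
  rw [kk, mul_assoc, ← ep_k'_comm, ← mul_assoc, k_ep, smul_mul_assoc, mul_assoc]

theorem kk_em (u : P.Γ) (v : P.Γ') :
    kk u v * em = (((u : ℂˣ) : ℂ) ^ 2)⁻¹ • (em * kk u v) := by
  rw [kk, mul_assoc, ← em_k'_comm, ← mul_assoc, k_em, smul_mul_assoc, mul_assoc]

theorem kk_ep' (u : P.Γ) (v : P.Γ') :
    kk u v * ep' = ((v : ℂˣ) : ℂ) ^ 2 • (ep' * kk u v) := by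
  rw [kk, mul_assoc, k_ep', mul_smul_comm, ← mul_assoc, k_ep'_comm, mul_assoc]

theorem kk_em' (u : P.Γ) (v : P.Γ') :
    kk u v * em' = (((v : ℂˣ) : ℂ) ^ 2)⁻¹ • (em' * kk u v) := by
  rw [kk, mul_assoc, k_em', mul_smul_comm, ← mul_assoc, k_em'_comm, mul_assoc]

/-- The comultiplication on generators. -/
def comulGen : QUEAGen P → QUEA P ⊗[ℂ] QUEA P
  | .ep => ep ⊗ₜ (k P.gq * k' P.gl') + (k P.gq⁻¹ * k' P.gl'⁻¹) ⊗ₜ ep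
  | .em => em ⊗ₜ (k P.gq * k' P.gl'⁻¹) + (k P.gq⁻¹ * k' P.gl') ⊗ₜ em
  | .k u => k u ⊗ₜ k u
  | .ep' => ep' ⊗ₜ (k P.gl⁻¹ * k' P.gq') + (k P.gl * k' P.gq'⁻¹) ⊗ₜ ep'
  | .em' => em' ⊗ₜ (k P.gl * k' P.gq') + (k P.gl⁻¹ * k' P.gq'⁻¹) ⊗ₜ em'
  | .k' v => k' v ⊗ₜ k' v

theorem skew_comm {A : Type} [Ring A] [Algebra ℂ A] {E F G H G₁ H₁ : A} {α β : ℂ}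
    (h1 : H₁ * E = α • (E * H₁)) (h2 : G * F = α • (F * G))
    (h3 : H * F = β • (F * H)) (h4 : G₁ * E = β • (E * G₁))
    (hG : G₁ * G = G * G₁) (hH : H₁ * H = H * H₁) :
    (E ⊗ₜ[ℂ] G + H ⊗ₜ[ℂ] E) * (F ⊗ₜ[ℂ] G₁ + H₁ ⊗ₜ[ℂ] F) -
      (F ⊗ₜ[ℂ] G₁ + H₁ ⊗ₜ[ℂ] F) * (E ⊗ₜ[ℂ] G + H ⊗ₜ[ℂ] E) =
    (E * F - F * E) ⊗ₜ[ℂ] (G * G₁) + (H * H₁) ⊗ₜ[ℂ] (E * F - F * E) := by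
  simp only [mul_add, add_mul, Algebra.TensorProduct.tmul_mul_tmul, h1, h2, h3, h4, hG, hH,
    TensorProduct.tmul_smul, TensorProduct.smul_tmul', TensorProduct.sub_tmul,
    TensorProduct.tmul_sub]
  abel

theorem kk_skew {A : Type} [Ring A] [Algebra ℂ A] {E G H K : A} {α : ℂ}
    (h : K * E = α • (E * K)) (hG : K * G = G * K) (hH : K * H = H * K) :
    (K ⊗ₜ[ℂ] K) * (E ⊗ₜ[ℂ] G + H ⊗ₜ[ℂ] E) =
      α • ((E ⊗ₜ[ℂ] G + H ⊗ₜ[ℂ] E) * (K ⊗ₜ[ℂ] K)) := by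
  simp only [mul_add, add_mul, Algebra.TensorProduct.tmul_mul_tmul, h, hG, hH,
    TensorProduct.tmul_smul, TensorProduct.smul_tmul', smul_add]

theorem kk_comm (u u₁ : P.Γ) (v v₁ : P.Γ') : kk u v * kk u₁ v₁ = kk u₁ v₁ * kk u v := by
  rw [kk_mul, kk_mul, mul_comm u, mul_comm v]

theorem comulGen_ep : comulGen (P := P) .ep =
    ep ⊗ₜ kk P.gq P.gl' + kk P.gq⁻¹ P.gl'⁻¹ ⊗ₜ ep := rfl
theorem comulGen_em : comulGen (P := P) .em =
    em ⊗ₜ kk P.gq P.gl'⁻¹ + kk P.gq⁻¹ P.gl' ⊗ₜ em := rfl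
theorem comulGen_ep' : comulGen (P := P) .ep' =
    ep' ⊗ₜ kk P.gl⁻¹ P.gq' + kk P.gl P.gq'⁻¹ ⊗ₜ ep' := rfl
theorem comulGen_em' : comulGen (P := P) .em' =
    em' ⊗ₜ kk P.gl P.gq' + kk P.gl⁻¹ P.gq'⁻¹ ⊗ₜ em' := rfl
theorem comulGen_k (u : P.Γ) : comulGen (.k u) = kk u 1 ⊗ₜ kk u 1 := by
  rw [← k_eq_kk]; rfl
theorem comulGen_k' (u : P.Γ') : comulGen (.k' u) = kk 1 u ⊗ₜ kk 1 u := by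
  rw [← k'_eq_kk]; rfl

theorem comulGen_rel ⦃x y : FreeAlgebra ℂ (QUEAGen P)⦄ (h : QUEARel P x y) :
    FreeAlgebra.lift ℂ (comulGen (P := P)) x = FreeAlgebra.lift ℂ comulGen y := by
  have hq : ((P.gq : ℂˣ) : ℂ) = P.rq := rfl
  have hl : ((P.gl : ℂˣ) : ℂ) = P.rl := rfl
  have hq' : ((P.gq' : ℂˣ) : ℂ) = P.rq' := rfl
  have hl' : ((P.gl' : ℂˣ) : ℂ) = P.rl := rfl
  cases h with
  | k_one => simp [comulGen_k, kk_one, Algebra.TensorProduct.one_def]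
  | k_mul u v => simp [comulGen_k, kk_mul]
  | k_ep u =>
    simp only [map_mul, map_smul, FreeAlgebra.lift_ι_apply, comulGen_k, comulGen_ep]
    exact kk_skew (kk_ep _ _) (kk_comm _ _ _ _) (kk_comm _ _ _ _)
  | k_em u =>
    simp only [map_mul, map_smul, FreeAlgebra.lift_ι_apply, comulGen_k, comulGen_em]
    exact kk_skew (kk_em _ _) (kk_comm _ _ _ _) (kk_comm _ _ _ _)
  | ep_em =>
    simp only [map_mul, map_smul, map_sub, map_pow, FreeAlgebra.lift_ι_apply, comulGen_k,
      comulGen_ep, comulGen_em]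
    rw [skew_comm (α := ((P.rq : ℂ) ^ 2)⁻¹) (β := ((P.rq : ℂ) ^ 2)), ep_em]
    · simp only [k_eq_kk, sq, kk_mul, mul_one, mul_inv_cancel, inv_mul_cancel,
        TensorProduct.tmul_smul, ← TensorProduct.smul_tmul', TensorProduct.sub_tmul,
        TensorProduct.tmul_sub, Algebra.TensorProduct.tmul_mul_tmul]
      module
    all_goals first | exact kk_comm _ _ _ _ | simp [kk_ep, kk_em, hq]
  | k_one' => simp [comulGen_k', kk_one, Algebra.TensorProduct.one_def]
  | k_mul' u v => simp [comulGen_k', kk_mul]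
  | k_ep' u =>
    simp only [map_mul, map_smul, FreeAlgebra.lift_ι_apply, comulGen_k', comulGen_ep']
    exact kk_skew (kk_ep' _ _) (kk_comm _ _ _ _) (kk_comm _ _ _ _)
  | k_em' u =>
    simp only [map_mul, map_smul, FreeAlgebra.lift_ι_apply, comulGen_k', comulGen_em']
    exact kk_skew (kk_em' _ _) (kk_comm _ _ _ _) (kk_comm _ _ _ _)
  | ep_em' =>
    simp only [map_mul, map_smul, map_sub, map_pow, FreeAlgebra.lift_ι_apply, comulGen_k',
      comulGen_ep', comulGen_em']
    rw [skew_comm (α := ((P.rq' : ℂ) ^ 2)⁻¹) (β := ((P.rq' : ℂ) ^ 2)), ep_em']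
    · simp only [k'_eq_kk, sq, kk_mul, mul_one, mul_inv_cancel, inv_mul_cancel,
        TensorProduct.tmul_smul, ← TensorProduct.smul_tmul', TensorProduct.sub_tmul,
        TensorProduct.tmul_sub, Algebra.TensorProduct.tmul_mul_tmul]
      module
    all_goals first | exact kk_comm _ _ _ _ | simp [kk_ep', kk_em', hq']
  | link x y hx hy =>
    simp only [map_mul, FreeAlgebra.lift_ι_apply]
    cases hx <;> cases hy
    · rw [comulGen_ep, comulGen_ep', ← sub_eq_zero, skew_comm (α := (P.rl : ℂ) ^ 2)
        (β := ((P.rl : ℂ) ^ 2)⁻¹)]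
      · rw [sub_eq_zero.mpr (show ep * ep' = ep' * ep from link .ep .ep')]
        simp
      all_goals first | exact kk_comm _ _ _ _ | simp [kk_ep, kk_ep', hl, hl']
    · rw [comulGen_ep, comulGen_em', ← sub_eq_zero, skew_comm (α := ((P.rl : ℂ) ^ 2)⁻¹)
        (β := (P.rl : ℂ) ^ 2)]
      · rw [sub_eq_zero.mpr (show ep * em' = em' * ep from link .ep .em')]
        simp
      all_goals first | exact kk_comm _ _ _ _ | simp [kk_ep, kk_em', hl, hl']
    · rw [comulGen_ep, comulGen_k', kk_skew (α := 1), one_smul]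
      all_goals first | exact kk_comm _ _ _ _ | simp [kk_ep]
    · rw [comulGen_em, comulGen_ep', ← sub_eq_zero, skew_comm (α := ((P.rl : ℂ) ^ 2)⁻¹)
        (β := (P.rl : ℂ) ^ 2)]
      · rw [sub_eq_zero.mpr (show em * ep' = ep' * em from link .em .ep')]
        simp
      all_goals first | exact kk_comm _ _ _ _ | simp [kk_em, kk_ep', hl, hl']
    · rw [comulGen_em, comulGen_em', ← sub_eq_zero, skew_comm (α := (P.rl : ℂ) ^ 2)
        (β := ((P.rl : ℂ) ^ 2)⁻¹)]
      · rw [sub_eq_zero.mpr (show em * em' = em' * em from link .em .em')]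
        simp
      all_goals first | exact kk_comm _ _ _ _ | simp [kk_em, kk_em', hl, hl']
    · rw [comulGen_em, comulGen_k', kk_skew (α := 1), one_smul]
      all_goals first | exact kk_comm _ _ _ _ | simp [kk_em]
    · rw [comulGen_k, comulGen_ep', kk_skew (α := 1), one_smul]
      all_goals first | exact kk_comm _ _ _ _ | simp [kk_ep']
    · rw [comulGen_k, comulGen_em', kk_skew (α := 1), one_smul]
      all_goals first | exact kk_comm _ _ _ _ | simp [kk_em']
    · rw [comulGen_k, comulGen_k']
      simp [kk_mul]

/-- The counit on generators. -/
def counitGen : QUEAGen P → ℂ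
  | .ep => 0
  | .em => 0
  | .k _ => 1
  | .ep' => 0
  | .em' => 0
  | .k' _ => 1

theorem counitGen_rel ⦃x y : FreeAlgebra ℂ (QUEAGen P)⦄ (h : QUEARel P x y) :
    FreeAlgebra.lift ℂ (counitGen (P := P)) x = FreeAlgebra.lift ℂ counitGen y := by
  cases h with
  | link x y hx hy => simp [mul_comm]
  | _ => simp [counitGen]

/-- The antipode on generators. -/
def antipodeGen : QUEAGen P → (QUEA P)ᵐᵒᵖ
  | .ep => .op (-P.q • ep)
  | .em => .op (-P.q⁻¹ • em)
  | .k u => .op (k u⁻¹)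
  | .ep' => .op (-P.q' • ep')
  | .em' => .op (-P.q'⁻¹ • em')
  | .k' v => .op (k' v⁻¹)

theorem antipodeGen_rel ⦃x y : FreeAlgebra ℂ (QUEAGen P)⦄ (h : QUEARel P x y) :
    FreeAlgebra.lift ℂ (antipodeGen (P := P)) x = FreeAlgebra.lift ℂ antipodeGen y := by
  have hq := P.q_ne
  have hq' := P.q'_ne
  apply MulOpposite.unop_injective
  cases h with
  | k_one => simp [antipodeGen, k_one]
  | k_mul u v => simp [antipodeGen, k_eq_kk, kk_mul, mul_comm]
  | k_ep u => simp [antipodeGen, k_ep, smul_smul, mul_comm]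
  | k_em u => simp [antipodeGen, k_em, smul_smul, mul_comm]
  | ep_em =>
    have h := ep_em (P := P)
    simp [antipodeGen, smul_smul, hq]
    rw [← neg_sub (ep * em), h]
    module
  | k_one' => simp [antipodeGen, k_one']
  | k_mul' u v => simp [antipodeGen, k'_eq_kk, kk_mul, mul_comm]
  | k_ep' u => simp [antipodeGen, k_ep', smul_smul, mul_comm]
  | k_em' u => simp [antipodeGen, k_em', smul_smul, mul_comm]
  | ep_em' =>
    have h := ep_em' (P := P)
    simp [antipodeGen, smul_smul, hq']
    rw [← neg_sub (ep' * em'), h]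
    module
  | link x y hx hy =>
    simp only [map_mul, FreeAlgebra.lift_ι_apply]
    have h1 : (ep * ep' : QUEA P) = ep' * ep := link .ep .ep'
    have h2 : (ep * em' : QUEA P) = em' * ep := link .ep .em'
    have h3 : (em * ep' : QUEA P) = ep' * em := link .em .ep'
    have h4 : (em * em' : QUEA P) = em' * em := link .em .em'
    cases hx <;> cases hy <;>
      simp [antipodeGen, smul_smul, mul_comm, h1, h2, h3, h4, k_k', k_ep'_comm, k_em'_comm,
        ep_k'_comm, em_k'_comm]

/-- The comultiplication. -/
def comulHom : QUEA P →ₐ[ℂ] QUEA P ⊗[ℂ] QUEA P := lift comulGen comulGen_rel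

/-- The counit. -/
def counitHom : QUEA P →ₐ[ℂ] ℂ := lift counitGen counitGen_rel

/-- The antipode, as an algebra map to the opposite algebra. -/
def antipodeHom : QUEA P →ₐ[ℂ] (QUEA P)ᵐᵒᵖ := lift antipodeGen antipodeGen_rel

theorem comulHom_gen (x : QUEAGen P) : comulHom (gen x) = comulGen x := lift_gen _ _ x
theorem counitHom_gen (x : QUEAGen P) : counitHom (gen x) = counitGen x := lift_gen _ _ x
theorem antipodeHom_gen (x : QUEAGen P) : antipodeHom (gen x) = antipodeGen x := lift_gen _ _ x

theorem comulHom_k (u : P.Γ) : comulHom (k u) = k u ⊗ₜ k u := comulHom_gen _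
theorem comulHom_k' (u : P.Γ') : comulHom (k' u) = k' u ⊗ₜ k' u := comulHom_gen _
theorem counitHom_k (u : P.Γ) : counitHom (k u) = 1 := counitHom_gen _
theorem counitHom_k' (u : P.Γ') : counitHom (k' u) = 1 := counitHom_gen _
theorem counitHom_ep : counitHom (ep : QUEA P) = 0 := counitHom_gen _
theorem counitHom_em : counitHom (em : QUEA P) = 0 := counitHom_gen _
theorem counitHom_ep' : counitHom (ep' : QUEA P) = 0 := counitHom_gen _
theorem counitHom_em' : counitHom (em' : QUEA P) = 0 := counitHom_gen _
theorem comulHom_ep : comulHom (ep : QUEA P) = comulGen .ep := comulHom_gen _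
theorem comulHom_em : comulHom (em : QUEA P) = comulGen .em := comulHom_gen _
theorem comulHom_ep' : comulHom (ep' : QUEA P) = comulGen .ep' := comulHom_gen _
theorem comulHom_em' : comulHom (em' : QUEA P) = comulGen .em' := comulHom_gen _

instance : Bialgebra ℂ (QUEA P) := Bialgebra.ofAlgHom comulHom counitHom
  (by
    apply hom_ext
    intro x
    cases x <;>
      simp [comulHom_gen, comulGen, comulHom_ep, comulHom_em, comulHom_ep', comulHom_em',
        comulHom_k, comulHom_k', TensorProduct.add_tmul, TensorProduct.tmul_add, add_assoc])
  (by
    apply hom_ext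
    intro x
    cases x <;>
      simp [comulHom_gen, comulGen, counitHom_ep, counitHom_em, counitHom_ep', counitHom_em',
        counitHom_k, counitHom_k'] <;> rfl)
  (by
    apply hom_ext
    intro x
    cases x <;>
      simp [comulHom_gen, comulGen, counitHom_ep, counitHom_em, counitHom_ep', counitHom_em',
        counitHom_k, counitHom_k'] <;> rfl)

theorem comul_gen (x : QUEAGen P) : Coalgebra.comul (R := ℂ) (gen x) = comulGen x :=
  comulHom_gen x

theorem counit_gen (x : QUEAGen P) : Coalgebra.counit (R := ℂ) (gen x) = counitGen x :=
  counitHom_gen x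

theorem antipode_kk (u : P.Γ) (v : P.Γ') :
    Presented.unopLin antipodeHom (kk u v) = kk u⁻¹ v⁻¹ := by
  have h1 : antipodeHom (k u) = .op (k u⁻¹) := antipodeHom_gen _
  have h2 : antipodeHom (k' v) = .op (k' v⁻¹) := antipodeHom_gen _
  rw [kk, Presented.unopLin_apply, map_mul, h1, h2, kk, k_k']
  rfl

theorem antipode_ep : Presented.unopLin antipodeHom (ep : QUEA P) = -P.q • ep :=
  congrArg MulOpposite.unop (antipodeHom_gen _)
theorem antipode_em : Presented.unopLin antipodeHom (em : QUEA P) = -P.q⁻¹ • em :=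
  congrArg MulOpposite.unop (antipodeHom_gen _)
theorem antipode_ep' : Presented.unopLin antipodeHom (ep' : QUEA P) = -P.q' • ep' :=
  congrArg MulOpposite.unop (antipodeHom_gen _)
theorem antipode_em' : Presented.unopLin antipodeHom (em' : QUEA P) = -P.q'⁻¹ • em' :=
  congrArg MulOpposite.unop (antipodeHom_gen _)

theorem coe_gq : ((P.gq : ℂˣ) : ℂ) ^ 2 = P.q := rfl
theorem coe_gq' : ((P.gq' : ℂˣ) : ℂ) ^ 2 = P.q' := rfl

instance : HopfAlgebra ℂ (QUEA P) where
  antipode := Presented.unopLin antipodeHom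
  mul_antipode_rTensor_comul := by
    ext x
    induction x using induction with
    | h0 z => exact Presented.left_algebraMap _ z
    | hm a b ha hb => exact Presented.left_mul _ ha hb
    | ha a b ha hb => rw [map_add, ha, hb, map_add]
    | h1 x =>
      simp only [LinearMap.comp_apply, comul_gen, counit_gen]
      have hq := P.q_ne
      have hq' := P.q'_ne
      cases x <;>
        simp [comulGen_ep, comulGen_em, comulGen_ep', comulGen_em', comulGen_k, comulGen_k',
          counitGen, antipode_kk, antipode_ep, antipode_em, antipode_ep', antipode_em',
          -Presented.unopLin_apply, kk_ep, kk_em, kk_ep', kk_em', kk_mul, kk_one, coe_gq, coe_gq']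
  mul_antipode_lTensor_comul := by
    ext x
    induction x using induction with
    | h0 z => exact Presented.right_algebraMap _ z
    | hm a b ha hb => exact Presented.right_mul _ ha hb
    | ha a b ha hb => rw [map_add, ha, hb, map_add]
    | h1 x =>
      simp only [LinearMap.comp_apply, comul_gen, counit_gen]
      have hq := P.q_ne
      have hq' := P.q'_ne
      cases x <;>
        simp [comulGen_ep, comulGen_em, comulGen_ep', comulGen_em', comulGen_k, comulGen_k',
          counitGen, antipode_kk, antipode_ep, antipode_em, antipode_ep', antipode_em',
          -Presented.unopLin_apply, kk_ep, kk_em, kk_ep', kk_em', kk_mul, kk_one, coe_gq, coe_gq',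
          smul_smul, hq, hq']

/-- The Lorentzian star structure on generators: `e_±` and the antichiral `e_±` are exchanged up
to the sign `σ`, and `k u` is exchanged with `k' (1 / conj u)`; the latter says that `q^h` and its
antichiral analogue are exchanged, and that `ℓ^h` is exchanged with the inverse of its
antichiral analogue. -/
def starGen (hP : P.IsLorentz) (σ : ℤˣ) : QUEAGen P → Presented.ConjOp (QUEA P)
  | .ep => Presented.toConjOp (((σ : ℤ) : ℂ) • ep')
  | .em => Presented.toConjOp (((σ : ℤ) : ℂ) • em')
  | .k u => Presented.toConjOp (k' (hP.conjΓ u))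
  | .ep' => Presented.toConjOp (((σ : ℤ) : ℂ) • ep)
  | .em' => Presented.toConjOp (((σ : ℤ) : ℂ) • em)
  | .k' v => Presented.toConjOp (k (hP.conjΓ' v))

theorem sign_sq (σ : ℤˣ) : ((σ : ℤ) : ℂ) * ((σ : ℤ) : ℂ) = 1 := by
  rcases Int.units_eq_one_or σ with rfl | rfl <;> simp

theorem starGen_rel (hP : P.IsLorentz) (σ : ℤˣ) ⦃x y : FreeAlgebra ℂ (QUEAGen P)⦄
    (h : QUEARel P x y) :
    FreeAlgebra.lift ℂ (starGen hP σ) x = FreeAlgebra.lift ℂ (starGen hP σ) y := by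
  have hne : ∀ u : ℂˣ, starRingEnd ℂ (u : ℂ) ≠ 0 := fun u => by simp
  cases h with
  | k_one => simp [starGen, k_one', Presented.toConjOp_one]
  | k_mul u v =>
    simp [starGen, Presented.toConjOp_mul, k'_eq_kk, kk_mul, mul_comm]
  | k_ep u =>
    simp only [map_mul, map_smul, FreeAlgebra.lift_ι_apply, starGen, Presented.toConjOp_mul,
      Presented.toConjOp_smul, smul_mul_assoc, mul_smul_comm, k_ep', smul_smul, hP.coe_conjΓ]
    congr 2
    have := hne u
    simp only [map_pow]
    field_simp
  | k_em u =>
    simp only [map_mul, map_smul, FreeAlgebra.lift_ι_apply, starGen, Presented.toConjOp_mul,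
      Presented.toConjOp_smul, smul_mul_assoc, mul_smul_comm, k_em', smul_smul, hP.coe_conjΓ]
    congr 2
    have := hne u
    simp only [map_inv₀, map_pow]
    field_simp
  | ep_em =>
    simp only [map_mul, map_smul, map_sub, FreeAlgebra.lift_ι_apply, starGen,
      Presented.toConjOp_mul, Presented.toConjOp_smul, Presented.toConjOp_sub, sq,
      hP.conjΓ_gq, map_inv, map_inv₀, hP.conj_q_eq]
    congr 1
    have h := ep_em' (P := P)
    simp only [smul_mul_smul_comm, sign_sq, one_smul]
    rw [← neg_sub (ep' * em'), h, inv_inv, sq, sq, ← neg_sub P.q', inv_neg, neg_smul]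
  | k_one' => simp [starGen, k_one, Presented.toConjOp_one]
  | k_mul' u v =>
    simp [starGen, Presented.toConjOp_mul, k_eq_kk, kk_mul, mul_comm]
  | k_ep' u =>
    simp only [map_mul, map_smul, FreeAlgebra.lift_ι_apply, starGen, Presented.toConjOp_mul,
      Presented.toConjOp_smul, smul_mul_assoc, mul_smul_comm, k_ep, smul_smul, hP.coe_conjΓ']
    congr 2
    have := hne u
    simp only [map_pow]
    field_simp
  | k_em' u =>
    simp only [map_mul, map_smul, FreeAlgebra.lift_ι_apply, starGen, Presented.toConjOp_mul,
      Presented.toConjOp_smul, smul_mul_assoc, mul_smul_comm, k_em, smul_smul, hP.coe_conjΓ']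
    congr 2
    have := hne u
    simp only [map_inv₀, map_pow]
    field_simp
  | ep_em' =>
    simp only [map_mul, map_smul, map_sub, FreeAlgebra.lift_ι_apply, starGen,
      Presented.toConjOp_mul, Presented.toConjOp_smul, Presented.toConjOp_sub, sq,
      hP.conjΓ'_gq', map_inv, map_inv₀, hP.conj_q'_eq]
    congr 1
    have h := ep_em (P := P)
    simp only [smul_mul_smul_comm, sign_sq, one_smul]
    rw [← neg_sub (ep * em), h, inv_inv, sq, sq, ← neg_sub P.q, inv_neg, neg_smul]
  | link x y hx hy =>
    simp only [map_mul, FreeAlgebra.lift_ι_apply]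
    have h1 : (ep * ep' : QUEA P) = ep' * ep := link .ep .ep'
    have h2 : (ep * em' : QUEA P) = em' * ep := link .ep .em'
    have h3 : (em * ep' : QUEA P) = ep' * em := link .em .ep'
    have h4 : (em * em' : QUEA P) = em' * em := link .em .em'
    cases hx <;> cases hy <;>
      simp [starGen, Presented.toConjOp_mul, smul_smul, h1, h2, h3, h4, k_k', k_ep'_comm,
        k_em'_comm, ep_k'_comm, em_k'_comm]

/-- The Lorentzian star structure on the enveloping algebra. -/
def lorentzStar (hP : P.IsLorentz) (σ : ℤˣ) : QUEA P →ₛₗ[starRingEnd ℂ] QUEA P :=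
  Presented.conjLin (lift (starGen hP σ) (starGen_rel hP σ))

theorem lorentzStar_gen (hP : P.IsLorentz) (σ : ℤˣ) (x : QUEAGen P) :
    lorentzStar hP σ (gen x) = Presented.ofConjOp (starGen hP σ x) :=
  congrArg Presented.ofConjOp (lift_gen _ _ x)

end QUEA

/-! ### The q-linked quantum function algebra -/

/-- Generators of the quantum function algebra; the primed ones are antichiral. -/
inductive QFAGen : Type
  | a | b | c | d
  | a' | b' | c' | d'

namespace QFAGen

/-- A generator as an element of the free algebra. -/
abbrev fr (x : QFAGen) : FreeAlgebra ℂ QFAGen := FreeAlgebra.ι ℂ x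

end QFAGen

open QFAGen in
/-- The defining relations: the Manin relations with parameter `q` for `a, b, c, d`, those with
parameter `1 / q'` for the primed generators, the link relations between the two sectors, and the
condition that both quantum determinants equal `1`. -/
inductive QFARel (P : LinkParams) : FreeAlgebra ℂ QFAGen → FreeAlgebra ℂ QFAGen → Prop
  | ab : QFARel P (fr a * fr b) (P.q⁻¹ • (fr b * fr a))
  | ac : QFARel P (fr a * fr c) (P.q⁻¹ • (fr c * fr a))
  | bd : QFARel P (fr b * fr d) (P.q⁻¹ • (fr d * fr b))
  | cd : QFARel P (fr c * fr d) (P.q⁻¹ • (fr d * fr c))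
  | ad : QFARel P (fr a * fr d - fr d * fr a) ((P.q⁻¹ - P.q) • (fr b * fr c))
  | bc : QFARel P (fr b * fr c) (fr c * fr b)
  | det : QFARel P (fr a * fr d - P.q⁻¹ • (fr b * fr c)) 1
  | ab' : QFARel P (fr a' * fr b') (P.q' • (fr b' * fr a'))
  | ac' : QFARel P (fr a' * fr c') (P.q' • (fr c' * fr a'))
  | bd' : QFARel P (fr b' * fr d') (P.q' • (fr d' * fr b'))
  | cd' : QFARel P (fr c' * fr d') (P.q' • (fr d' * fr c'))
  | ad' : QFARel P (fr a' * fr d' - fr d' * fr a') ((P.q' - P.q'⁻¹) • (fr b' * fr c'))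
  | bc' : QFARel P (fr b' * fr c') (fr c' * fr b')
  | det' : QFARel P (fr a' * fr d' - P.q' • (fr b' * fr c')) 1
  | link_ba : QFARel P (fr b' * fr a) (P.l • (fr a * fr b'))
  | link_ac : QFARel P (fr a * fr c') (P.l • (fr c' * fr a))
  | link_ab : QFARel P (fr a' * fr b) (P.l • (fr b * fr a'))
  | link_bd : QFARel P (fr b * fr d') (P.l • (fr d' * fr b))
  | link_ca : QFARel P (fr c * fr a') (P.l • (fr a' * fr c))
  | link_dc : QFARel P (fr d' * fr c) (P.l • (fr c * fr d'))
  | link_db : QFARel P (fr d * fr b') (P.l • (fr b' * fr d))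
  | link_cd : QFARel P (fr c' * fr d) (P.l • (fr d * fr c'))
  | link_aa : QFARel P (fr a * fr a') (fr a' * fr a)
  | link_ad : QFARel P (fr a * fr d') (fr d' * fr a)
  | link_bb : QFARel P (fr b * fr b') (fr b' * fr b)
  | link_bc : QFARel P (fr b * fr c') (fr c' * fr b)
  | link_cb : QFARel P (fr c * fr b') (fr b' * fr c)
  | link_cc : QFARel P (fr c * fr c') (fr c' * fr c)
  | link_da : QFARel P (fr d * fr a') (fr a' * fr d)
  | link_dd : QFARel P (fr d * fr d') (fr d' * fr d)

/-- The q-linked quantum function algebra `SL_q(2) ⊕^ℓ SL_{1/q'}(2)`. -/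
def QFA (P : LinkParams) : Type := RingQuot (QFARel P)

namespace QFA

variable (P : LinkParams)

instance : Ring (QFA P) := inferInstanceAs (Ring (RingQuot (QFARel P)))

instance : Algebra ℂ (QFA P) := inferInstanceAs (Algebra ℂ (RingQuot (QFARel P)))

variable {P}

/-- The classes of the generators. -/
def gen (x : QFAGen) : QFA P := Presented.gen (QFARel P) x

/-! The generators; the primed ones are those of the antichiral sector. -/

def a : QFA P := gen .a
def b : QFA P := gen .b
def c : QFA P := gen .c
def d : QFA P := gen .d
def a' : QFA P := gen .a'
def b' : QFA P := gen .b'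
def c' : QFA P := gen .c'
def d' : QFA P := gen .d'

theorem rel {x y : FreeAlgebra ℂ QFAGen} (h : QFARel P x y) :
    FreeAlgebra.lift ℂ (gen (P := P)) x = FreeAlgebra.lift ℂ gen y :=
  Presented.rel h

/-! The relations, written as rules that put the generators in alphabetical order. -/

theorem ba : b * a = P.q • (a * b : QFA P) := by
  have h : a * b = P.q⁻¹ • (b * a : QFA P) := by
    simpa [a, b, c, d, a', b', c', d'] using rel (P := P) .ab
  rw [h, smul_smul, mul_inv_cancel₀ P.q_ne, one_smul]
theorem ca : c * a = P.q • (a * c : QFA P) := by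
  have h : a * c = P.q⁻¹ • (c * a : QFA P) := by
    simpa [a, b, c, d, a', b', c', d'] using rel (P := P) .ac
  rw [h, smul_smul, mul_inv_cancel₀ P.q_ne, one_smul]
theorem db : d * b = P.q • (b * d : QFA P) := by
  have h : b * d = P.q⁻¹ • (d * b : QFA P) := by
    simpa [a, b, c, d, a', b', c', d'] using rel (P := P) .bd
  rw [h, smul_smul, mul_inv_cancel₀ P.q_ne, one_smul]
theorem dc : d * c = P.q • (c * d : QFA P) := by
  have h : c * d = P.q⁻¹ • (d * c : QFA P) := by
    simpa [a, b, c, d, a', b', c', d'] using rel (P := P) .cd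
  rw [h, smul_smul, mul_inv_cancel₀ P.q_ne, one_smul]
theorem cb : c * b = (b * c : QFA P) := by
    simpa [a, b, c, d, a', b', c', d'] using (rel (P := P) .bc).symm
theorem ad : a * d = (1 + P.q⁻¹ • (b * c) : QFA P) := by
  have h : a * d - P.q⁻¹ • (b * c) = (1 : QFA P) := by
    simpa [a, b, c, d, a', b', c', d'] using rel (P := P) .det
  rw [← h, sub_add_cancel]
theorem da : d * a = (1 + P.q • (b * c) : QFA P) := by
  have h : a * d - d * a = ((P.q⁻¹ - P.q) • (b * c) : QFA P) := by
    simpa [a, b, c, d, a', b', c', d'] using rel (P := P) .ad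
  have h2 : d * a = (a * d - (P.q⁻¹ - P.q) • (b * c) : QFA P) := by rw [← h, sub_sub_cancel]
  rw [h2, ad]
  module
theorem ba' : b' * a' = P.q'⁻¹ • (a' * b' : QFA P) := by
  have h : a' * b' = P.q' • (b' * a' : QFA P) := by
    simpa [a, b, c, d, a', b', c', d'] using rel (P := P) .ab'
  rw [h, smul_smul, inv_mul_cancel₀ P.q'_ne, one_smul]
theorem ca' : c' * a' = P.q'⁻¹ • (a' * c' : QFA P) := by
  have h : a' * c' = P.q' • (c' * a' : QFA P) := by
    simpa [a, b, c, d, a', b', c', d'] using rel (P := P) .ac'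
  rw [h, smul_smul, inv_mul_cancel₀ P.q'_ne, one_smul]
theorem db' : d' * b' = P.q'⁻¹ • (b' * d' : QFA P) := by
  have h : b' * d' = P.q' • (d' * b' : QFA P) := by
    simpa [a, b, c, d, a', b', c', d'] using rel (P := P) .bd'
  rw [h, smul_smul, inv_mul_cancel₀ P.q'_ne, one_smul]
theorem dc' : d' * c' = P.q'⁻¹ • (c' * d' : QFA P) := by
  have h : c' * d' = P.q' • (d' * c' : QFA P) := by
    simpa [a, b, c, d, a', b', c', d'] using rel (P := P) .cd'
  rw [h, smul_smul, inv_mul_cancel₀ P.q'_ne, one_smul]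
theorem cb' : c' * b' = (b' * c' : QFA P) := by
    simpa [a, b, c, d, a', b', c', d'] using (rel (P := P) .bc').symm
theorem ad' : a' * d' = (1 + P.q' • (b' * c') : QFA P) := by
  have h : a' * d' - P.q' • (b' * c') = (1 : QFA P) := by
    simpa [a, b, c, d, a', b', c', d'] using rel (P := P) .det'
  rw [← h, sub_add_cancel]
theorem da' : d' * a' = (1 + P.q'⁻¹ • (b' * c') : QFA P) := by
  have h : a' * d' - d' * a' = ((P.q' - P.q'⁻¹) • (b' * c') : QFA P) := by
    simpa [a, b, c, d, a', b', c', d'] using rel (P := P) .ad'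
  have h2 : d' * a' = (a' * d' - (P.q' - P.q'⁻¹) • (b' * c') : QFA P) := by
    rw [← h, sub_sub_cancel]
  rw [h2, ad']
  module
theorem link_ba : b' * a = (P.l • (a * b') : QFA P) := by
    simpa [a, b, c, d, a', b', c', d'] using rel (P := P) .link_ba
theorem link_ab : a' * b = (P.l • (b * a') : QFA P) := by
    simpa [a, b, c, d, a', b', c', d'] using rel (P := P) .link_ab
theorem link_dc : d' * c = (P.l • (c * d') : QFA P) := by
    simpa [a, b, c, d, a', b', c', d'] using rel (P := P) .link_dc
theorem link_cd : c' * d = (P.l • (d * c') : QFA P) := by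
    simpa [a, b, c, d, a', b', c', d'] using rel (P := P) .link_cd
theorem link_ac : c' * a = P.l⁻¹ • (a * c' : QFA P) := by
  have h : a * c' = P.l • (c' * a : QFA P) := by
    simpa [a, b, c, d, a', b', c', d'] using rel (P := P) .link_ac
  rw [h, smul_smul, inv_mul_cancel₀ P.l_ne, one_smul]
theorem link_bd : d' * b = P.l⁻¹ • (b * d' : QFA P) := by
  have h : b * d' = P.l • (d' * b : QFA P) := by
    simpa [a, b, c, d, a', b', c', d'] using rel (P := P) .link_bd
  rw [h, smul_smul, inv_mul_cancel₀ P.l_ne, one_smul]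
theorem link_ca : a' * c = P.l⁻¹ • (c * a' : QFA P) := by
  have h : c * a' = P.l • (a' * c : QFA P) := by
    simpa [a, b, c, d, a', b', c', d'] using rel (P := P) .link_ca
  rw [h, smul_smul, inv_mul_cancel₀ P.l_ne, one_smul]
theorem link_db : b' * d = P.l⁻¹ • (d * b' : QFA P) := by
  have h : d * b' = P.l • (b' * d : QFA P) := by
    simpa [a, b, c, d, a', b', c', d'] using rel (P := P) .link_db
  rw [h, smul_smul, inv_mul_cancel₀ P.l_ne, one_smul]
theorem link_aa : a' * a = (a * a' : QFA P) := by
  simpa [a, b, c, d, a', b', c', d'] using (rel (P := P) .link_aa).symm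
theorem link_ad : d' * a = (a * d' : QFA P) := by
  simpa [a, b, c, d, a', b', c', d'] using (rel (P := P) .link_ad).symm
theorem link_bb : b' * b = (b * b' : QFA P) := by
  simpa [a, b, c, d, a', b', c', d'] using (rel (P := P) .link_bb).symm
theorem link_bc : c' * b = (b * c' : QFA P) := by
  simpa [a, b, c, d, a', b', c', d'] using (rel (P := P) .link_bc).symm
theorem link_cb : b' * c = (c * b' : QFA P) := by
  simpa [a, b, c, d, a', b', c', d'] using (rel (P := P) .link_cb).symm
theorem link_cc : c' * c = (c * c' : QFA P) := by
  simpa [a, b, c, d, a', b', c', d'] using (rel (P := P) .link_cc).symm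
theorem link_da : a' * d = (d * a' : QFA P) := by
  simpa [a, b, c, d, a', b', c', d'] using (rel (P := P) .link_da).symm
theorem link_dd : d' * d = (d * d' : QFA P) := by
  simpa [a, b, c, d, a', b', c', d'] using (rel (P := P) .link_dd).symm

/-- Construction of algebra maps out of the function algebra. -/
def lift {A : Type} [Semiring A] [Algebra ℂ A] (f : QFAGen → A)
    (h : ∀ ⦃x y⦄, QFARel P x y → FreeAlgebra.lift ℂ f x = FreeAlgebra.lift ℂ f y) :
    QFA P →ₐ[ℂ] A :=
  Presented.lift f h

theorem lift_gen {A : Type} [Semiring A] [Algebra ℂ A] (f : QFAGen → A)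
    (h : ∀ ⦃x y⦄, QFARel P x y → FreeAlgebra.lift ℂ f x = FreeAlgebra.lift ℂ f y)
    (x : QFAGen) : lift f h (gen x) = f x :=
  Presented.lift_gen f h x

theorem hom_ext {A : Type} [Semiring A] [Algebra ℂ A] {f g : QFA P →ₐ[ℂ] A}
    (h : ∀ x, f (gen x) = g (gen x)) : f = g :=
  Presented.hom_ext h

theorem induction {C : QFA P → Prop} (h0 : ∀ z : ℂ, C (algebraMap ℂ _ z))
    (h1 : ∀ x, C (gen x)) (hm : ∀ a b, C a → C b → C (a * b))
    (ha : ∀ a b, C a → C b → C (a + b)) (x : QFA P) : C x :=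
  Presented.induction (r := QFARel P) h0 h1 hm ha x

/-- The comultiplication on generators (matrix comultiplication in each sector). -/
def comulGen : QFAGen → QFA P ⊗[ℂ] QFA P
  | .a => a ⊗ₜ a + b ⊗ₜ c
  | .b => a ⊗ₜ b + b ⊗ₜ d
  | .c => c ⊗ₜ a + d ⊗ₜ c
  | .d => c ⊗ₜ b + d ⊗ₜ d
  | .a' => a' ⊗ₜ a' + b' ⊗ₜ c'
  | .b' => a' ⊗ₜ b' + b' ⊗ₜ d'
  | .c' => c' ⊗ₜ a' + d' ⊗ₜ c'
  | .d' => c' ⊗ₜ b' + d' ⊗ₜ d'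

theorem comulGen_rel ⦃x y : FreeAlgebra ℂ QFAGen⦄ (h : QFARel P x y) :
    FreeAlgebra.lift ℂ (comulGen (P := P)) x = FreeAlgebra.lift ℂ comulGen y := by
  have hq := P.q_ne
  have hq' := P.q'_ne
  have hl := P.l_ne
  cases h <;>
    simp only [map_mul, map_smul, map_sub, map_one, FreeAlgebra.lift_ι_apply, comulGen, mul_add,
      add_mul, Algebra.TensorProduct.tmul_mul_tmul, Algebra.TensorProduct.one_def,
      ba, ca, db, dc, cb, ad, da, ba', ca', db', dc', cb', ad', da', link_ba, link_ab, link_dc, link_cd, link_ac, link_bd, link_ca, link_db, link_aa, link_ad, link_bb, link_bc, link_cb, link_cc, link_da, link_dd,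
      TensorProduct.tmul_smul, ← TensorProduct.smul_tmul', TensorProduct.add_tmul,
      TensorProduct.tmul_add] <;>
    match_scalars <;> field_simp <;> ring

/-- The counit on generators. -/
def counitGen : QFAGen → ℂ
  | .a => 1
  | .b => 0
  | .c => 0
  | .d => 1
  | .a' => 1
  | .b' => 0
  | .c' => 0
  | .d' => 1

theorem counitGen_rel ⦃x y : FreeAlgebra ℂ QFAGen⦄ (h : QFARel P x y) :
    FreeAlgebra.lift ℂ counitGen x = FreeAlgebra.lift ℂ counitGen y := by
  cases h <;> simp [counitGen]

/-- The antipode on generators. -/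
def antipodeGen : QFAGen → (QFA P)ᵐᵒᵖ
  | .a => .op d
  | .b => .op (-P.q • b)
  | .c => .op (-P.q⁻¹ • c)
  | .d => .op a
  | .a' => .op d'
  | .b' => .op (-P.q'⁻¹ • b')
  | .c' => .op (-P.q' • c')
  | .d' => .op a'

theorem antipodeGen_rel ⦃x y : FreeAlgebra ℂ QFAGen⦄ (h : QFARel P x y) :
    FreeAlgebra.lift ℂ (antipodeGen (P := P)) x = FreeAlgebra.lift ℂ antipodeGen y := by
  have hq := P.q_ne
  have hq' := P.q'_ne
  have hl := P.l_ne
  apply MulOpposite.unop_injective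
  cases h <;>
    simp only [map_mul, map_smul, map_sub, map_one, FreeAlgebra.lift_ι_apply, antipodeGen,
      MulOpposite.unop_mul, MulOpposite.unop_smul, MulOpposite.unop_sub, MulOpposite.unop_one,
      MulOpposite.unop_op, smul_mul_assoc, mul_smul_comm,
      ba, ca, db, dc, cb, ad, da, ba', ca', db', dc', cb', ad', da', link_ba, link_ab, link_dc, link_cd, link_ac, link_bd, link_ca, link_db, link_aa, link_ad, link_bb, link_bc, link_cb, link_cc, link_da, link_dd] <;>
    match_scalars <;> field_simp <;> ring

/-- The Lorentzian star structure on generators: `(a b; c d)^⋆ = S(a' c'; b' d')` and, for the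
primed matrix, `(a' b'; c' d')^⋆ = S(a c; b d)`, as involutivity requires. -/
def starGen : QFAGen → Presented.ConjOp (QFA P)
  | .a => Presented.toConjOp d'
  | .b => Presented.toConjOp (-P.q' • c')
  | .c => Presented.toConjOp (-P.q'⁻¹ • b')
  | .d => Presented.toConjOp a'
  | .a' => Presented.toConjOp d
  | .b' => Presented.toConjOp (-P.q⁻¹ • c)
  | .c' => Presented.toConjOp (-P.q • b)
  | .d' => Presented.toConjOp a

theorem starGen_rel (hP : P.IsLorentz) ⦃x y : FreeAlgebra ℂ QFAGen⦄ (h : QFARel P x y) :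
    FreeAlgebra.lift ℂ (starGen (P := P)) x = FreeAlgebra.lift ℂ starGen y := by
  have hq := P.q_ne
  have hq' := P.q'_ne
  have hl := P.l_ne
  cases h <;>
    simp only [map_mul, map_smul, map_sub, map_one, FreeAlgebra.lift_ι_apply, starGen,
      Presented.toConjOp_mul, Presented.toConjOp_smul, Presented.toConjOp_sub,
      Presented.toConjOp_one, smul_mul_assoc, mul_smul_comm, map_inv₀, hP.conj_q_eq,
      hP.conj_q'_eq, hP.conj_l_eq,
      ba, ca, db, dc, cb, ad, da, ba', ca', db', dc', cb', ad', da', link_ba, link_ab, link_dc, link_cd, link_ac, link_bd, link_ca, link_db, link_aa, link_ad, link_bb, link_bc, link_cb, link_cc, link_da, link_dd] <;>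
    congr 1 <;> match_scalars <;> field_simp <;> ring

/-- The comultiplication. -/
def comulHom : QFA P →ₐ[ℂ] QFA P ⊗[ℂ] QFA P := lift comulGen comulGen_rel

/-- The counit. -/
def counitHom : QFA P →ₐ[ℂ] ℂ := lift counitGen counitGen_rel

/-- The antipode, as an algebra map to the opposite algebra. -/
def antipodeHom : QFA P →ₐ[ℂ] (QFA P)ᵐᵒᵖ := lift antipodeGen antipodeGen_rel

theorem comulHom_gen (x : QFAGen) : comulHom (gen x : QFA P) = comulGen x := lift_gen _ _ x
theorem counitHom_gen (x : QFAGen) : counitHom (gen x : QFA P) = counitGen x := lift_gen _ _ x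
theorem antipodeHom_gen (x : QFAGen) : antipodeHom (gen x : QFA P) = antipodeGen x :=
  lift_gen _ _ x

theorem coassoc_gen (x : QFAGen) :
    (Algebra.TensorProduct.assoc ℂ ℂ ℂ (QFA P) (QFA P) (QFA P))
      (Algebra.TensorProduct.map comulHom (.id ℂ (QFA P)) (comulGen x)) =
    Algebra.TensorProduct.map (.id ℂ (QFA P)) comulHom (comulGen x) := by
  cases x <;>
    simp [comulGen, a, b, c, d, a', b', c', d', comulHom_gen, TensorProduct.add_tmul,
      TensorProduct.tmul_add, add_add_add_comm]

theorem counit_left_gen (x : QFAGen) :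
    Algebra.TensorProduct.map counitHom (.id ℂ (QFA P)) (comulGen x) = 1 ⊗ₜ gen x := by
  cases x <;> simp [comulGen, a, b, c, d, a', b', c', d', counitHom_gen, counitGen]

theorem counit_right_gen (x : QFAGen) :
    Algebra.TensorProduct.map (.id ℂ (QFA P)) counitHom (comulGen x) = gen x ⊗ₜ 1 := by
  cases x <;> simp [comulGen, a, b, c, d, a', b', c', d', counitHom_gen, counitGen]

instance : Bialgebra ℂ (QFA P) := Bialgebra.ofAlgHom comulHom counitHom
  (hom_ext fun x => by simpa [comulHom_gen] using coassoc_gen x)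
  (hom_ext fun x => by simpa [comulHom_gen] using counit_left_gen x)
  (hom_ext fun x => by simpa [comulHom_gen] using counit_right_gen x)

theorem comul_gen (x : QFAGen) : Coalgebra.comul (R := ℂ) (gen x : QFA P) = comulGen x :=
  comulHom_gen x

theorem counit_gen (x : QFAGen) : Coalgebra.counit (R := ℂ) (gen x : QFA P) = counitGen x :=
  counitHom_gen x

theorem antipode_gen (x : QFAGen) :
    Presented.unopLin antipodeHom (gen x : QFA P) = (antipodeGen x).unop :=
  congrArg MulOpposite.unop (antipodeHom_gen x)

theorem antipode_a : Presented.unopLin antipodeHom (a : QFA P) = d := antipode_gen _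
theorem antipode_b : Presented.unopLin antipodeHom (b : QFA P) = -P.q • b := antipode_gen _
theorem antipode_c : Presented.unopLin antipodeHom (c : QFA P) = -P.q⁻¹ • c := antipode_gen _
theorem antipode_d : Presented.unopLin antipodeHom (d : QFA P) = a := antipode_gen _
theorem antipode_a' : Presented.unopLin antipodeHom (a' : QFA P) = d' := antipode_gen _
theorem antipode_b' : Presented.unopLin antipodeHom (b' : QFA P) = -P.q'⁻¹ • b' := antipode_gen _
theorem antipode_c' : Presented.unopLin antipodeHom (c' : QFA P) = -P.q' • c' := antipode_gen _
theorem antipode_d' : Presented.unopLin antipodeHom (d' : QFA P) = a' := antipode_gen _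

theorem antipode_left_gen (x : QFAGen) :
    LinearMap.mul' ℂ (QFA P) ((Presented.unopLin antipodeHom).rTensor (QFA P) (comulGen x)) =
      algebraMap ℂ _ (counitGen x) := by
  have hq := P.q_ne
  have hq' := P.q'_ne
  cases x <;>
    simp only [comulGen, map_add, LinearMap.rTensor_tmul, LinearMap.mul'_apply, counitGen,
      antipode_a, antipode_b, antipode_c, antipode_d, antipode_a', antipode_b', antipode_c', antipode_d',
      smul_mul_assoc, map_one, map_zero, da, db, ca, cb, ad, da', db', ca', cb', ad'] <;>
    match_scalars <;> field_simp <;> ring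

theorem antipode_right_gen (x : QFAGen) :
    LinearMap.mul' ℂ (QFA P) ((Presented.unopLin antipodeHom).lTensor (QFA P) (comulGen x)) =
      algebraMap ℂ _ (counitGen x) := by
  have hq := P.q_ne
  have hq' := P.q'_ne
  cases x <;>
    simp only [comulGen, map_add, LinearMap.lTensor_tmul, LinearMap.mul'_apply, counitGen,
      antipode_a, antipode_b, antipode_c, antipode_d, antipode_a', antipode_b', antipode_c', antipode_d',
      mul_smul_comm, map_one, map_zero, ad, ba, dc, cb, da, ad', ba', dc', cb', da'] <;>
    match_scalars <;> field_simp <;> ring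

instance : HopfAlgebra ℂ (QFA P) where
  antipode := Presented.unopLin antipodeHom
  mul_antipode_rTensor_comul := by
    ext x
    induction x using induction with
    | h0 z => exact Presented.left_algebraMap _ z
    | hm a b ha hb => exact Presented.left_mul _ ha hb
    | ha a b ha hb => rw [map_add, ha, hb, map_add]
    | h1 x =>
      simp only [LinearMap.comp_apply, comul_gen, counit_gen]
      exact antipode_left_gen x
  mul_antipode_lTensor_comul := by
    ext x
    induction x using induction with
    | h0 z => exact Presented.right_algebraMap _ z
    | hm a b ha hb => exact Presented.right_mul _ ha hb
    | ha a b ha hb => rw [map_add, ha, hb, map_add]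
    | h1 x =>
      simp only [LinearMap.comp_apply, comul_gen, counit_gen]
      exact antipode_right_gen x

/-- The Lorentzian star structure on the function algebra. -/
def lorentzStar (hP : P.IsLorentz) : QFA P →ₛₗ[starRingEnd ℂ] QFA P :=
  Presented.conjLin (lift starGen (starGen_rel hP))

theorem lorentzStar_gen (hP : P.IsLorentz) (x : QFAGen) :
    lorentzStar hP (gen x : QFA P) = Presented.ofConjOp (starGen x) :=
  congrArg Presented.ofConjOp (lift_gen _ _ x)

end QFA

/-! ### The pairing on generators -/

/-- The matrix `⟨x, (a b; c d)⟩`. -/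
def chiralMatrix {P : LinkParams} (B : QUEA P →ₗ[ℂ] QFA P →ₗ[ℂ] ℂ) (x : QUEA P) :
    Matrix (Fin 2) (Fin 2) ℂ :=
  !![B x QFA.a, B x QFA.b; B x QFA.c, B x QFA.d]

/-- The matrix `⟨x, (a' b'; c' d')⟩`. -/
def antichiralMatrix {P : LinkParams} (B : QUEA P →ₗ[ℂ] QFA P →ₗ[ℂ] ℂ) (x : QUEA P) :
    Matrix (Fin 2) (Fin 2) ℂ :=
  Matrix.of ![![B x QFA.a', B x QFA.b'], ![B x QFA.c', B x QFA.d']]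

/-- The values of the pairing on generators; those of the antichiral `e_±` carry the sign `σ`. -/
structure HasPairingTable {P : LinkParams} (σ : ℤˣ) (B : QUEA P →ₗ[ℂ] QFA P →ₗ[ℂ] ℂ) :
    Prop where
  qh : chiralMatrix B QUEA.qh = !![(P.rq : ℂ), 0; 0, (P.rq : ℂ)⁻¹]
  lh : chiralMatrix B QUEA.lh = !![(P.rl : ℂ), 0; 0, (P.rl : ℂ)⁻¹]
  ep : chiralMatrix B QUEA.ep = !![0, 1; 0, 0]
  em : chiralMatrix B QUEA.em = !![0, 0; 1, 0]
  qh' : antichiralMatrix B QUEA.qh' = !![(P.rq' : ℂ)⁻¹, 0; 0, (P.rq' : ℂ)]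
  lh' : antichiralMatrix B QUEA.lh' = !![(P.rl : ℂ)⁻¹, 0; 0, (P.rl : ℂ)]
  ep' : antichiralMatrix B QUEA.ep' = !![0, 0; ((σ : ℤ) : ℂ), 0]
  em' : antichiralMatrix B QUEA.em' = !![0, ((σ : ℤ) : ℂ); 0, 0]
  mixed_qh : antichiralMatrix B QUEA.qh = 1
  mixed_lh : antichiralMatrix B QUEA.lh = 1
  mixed_ep : antichiralMatrix B QUEA.ep = 0
  mixed_em : antichiralMatrix B QUEA.em = 0
  mixed_qh' : chiralMatrix B QUEA.qh' = 1
  mixed_lh' : chiralMatrix B QUEA.lh' = 1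
  mixed_ep' : chiralMatrix B QUEA.ep' = 0
  mixed_em' : chiralMatrix B QUEA.em' = 0

end

noncomputable section

/-! A Hopf pairing is determined by its values on generators, and the same holds for every identity
it should satisfy. The product rules let one pass from generators to products in either argument,
and the generators of the function algebra span a subcoalgebra, so an induction on `x` with the
function-algebra generator left free never leaves the table of values. This gives the Hopf star
axioms (`IsHopfStar.of_generators`), uniqueness (`HasPairingTable.unique`) and compatibility with
the stars (`HasPairingTable.star`). The last holds because `f ↦ S(f)^⋆` exchanges the two sectors
and transposes the matrices.

For existence, the functionals on the enveloping algebra form an algebra under convolution. The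
enveloping algebra has two representations on `ℂ²`, one for each sector, with the other sector
acting through the counit. Sending the generators of the function algebra to the matrix coefficients
of these representations respects the defining relations (`QUEA.coeffGen_rel`): the Manin and
determinant relations say that a q-determinant vector is invariant under the tensor square of a
representation, both as a column and as a row, and the link relations say that a diagonal matrix
intertwines the two orders of the mixed tensor product. The resulting algebra map
`LinkParams.pairingHom` is the pairing.

For nondegeneracy, `e_±` and `e'_±` act on the function algebra from the left and from the right as
skew derivations. On suitably ordered monomials each acts as a lowering operator: it replaces one
off-diagonal generator by a diagonal one, up to a q-integer that is nonzero because `q` is not a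
root of unity. Hence the pairing of ordered monomials is a Kronecker delta in the off-diagonal
exponents, times a nonzero constant, times a character in the Cartan variables (`pairing_mono`). The
ordered monomials span both algebras (`QUEA.span_mono`, `QFA.span_signedMono`), and Dedekind's
independence of characters (`coeff_eq_zero_of_characters`) separates the remaining labels: the
Cartan elements on one side, the signed exponents of the diagonal generators on the other. No linear
independence of the monomials is assumed; an element in one of the two kernels has all its
coefficients zero in any expression through them. -/

theorem Presented.conjLin_one {A : Type} [Ring A] [Algebra ℂ A] (f : A →ₐ[ℂ] Presented.ConjOp A) :
    Presented.conjLin f 1 = 1 :=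
  congrArg Presented.ofConjOp (map_one f)

theorem Presented.conjLin_mul {A : Type} [Ring A] [Algebra ℂ A] (f : A →ₐ[ℂ] Presented.ConjOp A)
    (x y : A) : Presented.conjLin f (x * y) = Presented.conjLin f y * Presented.conjLin f x :=
  congrArg Presented.ofConjOp (map_mul f x y)

/-! ### Star structures, checked on generators -/

section HopfStar

variable {H : Type} [Ring H] [HopfAlgebra ℂ H] {σ : H →ₛₗ[starRingEnd ℂ] H}

theorem antilinear_algebraMap (h1 : σ 1 = 1) (z : ℂ) :
    σ (algebraMap ℂ H z) = algebraMap ℂ H (starRingEnd ℂ z) := by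
  rw [Algebra.algebraMap_eq_smul_one, Algebra.algebraMap_eq_smul_one, map_smulₛₗ, h1]

theorem map_antimul (hm : ∀ x y, σ (x * y) = σ y * σ x) (s t : H ⊗[ℂ] H) :
    TensorProduct.map σ σ (s * t) = TensorProduct.map σ σ t * TensorProduct.map σ σ s := by
  induction s using TensorProduct.induction_on with
  | zero => simp
  | add a b ha hb => simp only [add_mul, map_add, ha, hb, mul_add]
  | tmul a b =>
    induction t using TensorProduct.induction_on with
    | zero => simp
    | add c d hc hd => simp only [add_mul, map_add, hc, hd, mul_add]
    | tmul c d => simp [hm]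

/-- A unital antimultiplicative antilinear map is a Hopf star structure as soon as its axioms hold
on a generating set. -/
theorem IsHopfStar.of_generators (G : Set H) (hG : Algebra.adjoin ℂ G = ⊤) (h1 : σ 1 = 1)
    (hm : ∀ x y, σ (x * y) = σ y * σ x) (hinv : ∀ x ∈ G, σ (σ x) = x)
    (hcomul : ∀ x ∈ G, Coalgebra.comul (R := ℂ) (σ x) =
      TensorProduct.map σ σ (Coalgebra.comul (R := ℂ) x))
    (hcounit : ∀ x ∈ G, Coalgebra.counit (R := ℂ) (σ x) =
      starRingEnd ℂ (Coalgebra.counit (R := ℂ) x))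
    (hanti : ∀ x ∈ G, HopfAlgebra.antipode ℂ (σ (HopfAlgebra.antipode ℂ (σ x))) = x) :
    IsHopfStar σ where
  map_one := h1
  map_mul := hm
  involutive x := by
    induction (hG ▸ Algebra.mem_top : x ∈ Algebra.adjoin ℂ G) using Algebra.adjoin_induction with
    | mem x hx => exact hinv x hx
    | algebraMap z => rw [antilinear_algebraMap h1, antilinear_algebraMap h1, Complex.conj_conj]
    | add x y _ _ hx hy => rw [map_add, map_add, hx, hy]
    | mul x y _ _ hx hy => rw [hm, hm, hx, hy]
  comul x := by
    induction (hG ▸ Algebra.mem_top : x ∈ Algebra.adjoin ℂ G) using Algebra.adjoin_induction with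
    | mem x hx => exact hcomul x hx
    | algebraMap z =>
      rw [antilinear_algebraMap h1, Bialgebra.comul_algebraMap, Bialgebra.comul_algebraMap,
        Algebra.algebraMap_eq_smul_one, Algebra.algebraMap_eq_smul_one, map_smulₛₗ,
        Algebra.TensorProduct.one_def, TensorProduct.map_tmul, h1]
    | add x y _ _ hx hy => rw [map_add, map_add, map_add, map_add, hx, hy]
    | mul x y _ _ hx hy => rw [hm, Bialgebra.comul_mul, Bialgebra.comul_mul, hx, hy, map_antimul hm]
  counit x := by
    induction (hG ▸ Algebra.mem_top : x ∈ Algebra.adjoin ℂ G) using Algebra.adjoin_induction with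
    | mem x hx => exact hcounit x hx
    | algebraMap z => rw [antilinear_algebraMap h1]; simp
    | add x y _ _ hx hy => rw [map_add, map_add, map_add, map_add, hx, hy]
    | mul x y _ _ hx hy =>
      rw [hm, Bialgebra.counit_mul, Bialgebra.counit_mul, hx, hy, _root_.map_mul, mul_comm]
  antipode x := by
    have hS : ∀ z : ℂ, HopfAlgebra.antipode ℂ (algebraMap ℂ H z) = algebraMap ℂ H z := fun z => by
      rw [Algebra.algebraMap_eq_smul_one, map_smul, HopfAlgebra.antipode_one]
    induction (hG ▸ Algebra.mem_top : x ∈ Algebra.adjoin ℂ G) using Algebra.adjoin_induction with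
    | mem x hx => exact hanti x hx
    | algebraMap z =>
      rw [antilinear_algebraMap h1, hS, antilinear_algebraMap h1, Complex.conj_conj, hS]
    | add x y _ _ hx hy => simp only [map_add, hx, hy]
    | mul x y _ _ hx hy =>
      -- The star and the antipode each reverse products and each occurs twice, so the order is
      -- restored.
      rw [hm, HopfAlgebra.antipode_mul_antidistrib, hm, HopfAlgebra.antipode_mul_antidistrib,
        hx, hy]

end HopfStar

theorem QUEA.adjoin_gen (P : LinkParams) : Algebra.adjoin ℂ (Set.range (QUEA.gen (P := P))) = ⊤ := by
  rw [eq_top_iff]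
  rintro x -
  induction x using QUEA.induction with
  | h0 z => exact Subalgebra.algebraMap_mem _ z
  | h1 x => exact Algebra.subset_adjoin ⟨x, rfl⟩
  | hm a b ha hb => exact mul_mem ha hb
  | ha a b ha hb => exact add_mem ha hb

theorem QFA.adjoin_gen (P : LinkParams) : Algebra.adjoin ℂ (Set.range (QFA.gen (P := P))) = ⊤ := by
  rw [eq_top_iff]
  rintro x -
  induction x using QFA.induction with
  | h0 z => exact Subalgebra.algebraMap_mem _ z
  | h1 x => exact Algebra.subset_adjoin ⟨x, rfl⟩
  | hm a b ha hb => exact mul_mem ha hb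
  | ha a b ha hb => exact add_mem ha hb

namespace LinkParams.IsLorentz

variable {P : LinkParams}

theorem conjΓ'_conjΓ (hP : P.IsLorentz) (u : P.Γ) : hP.conjΓ' (hP.conjΓ u) = u :=
  Subtype.ext (conjInv_conjInv _)

theorem conjΓ_conjΓ' (hP : P.IsLorentz) (u : P.Γ') : hP.conjΓ (hP.conjΓ' u) = u :=
  Subtype.ext (conjInv_conjInv _)

theorem conjΓ_gl (hP : P.IsLorentz) : hP.conjΓ P.gl = P.gl'⁻¹ := Subtype.ext hP.conjInv_rl

theorem conjΓ'_gl' (hP : P.IsLorentz) : hP.conjΓ' P.gl' = P.gl⁻¹ := Subtype.ext hP.conjInv_rl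

end LinkParams.IsLorentz

namespace QUEA

variable {P : LinkParams}

theorem comul_kk (u : P.Γ) (v : P.Γ') :
    Coalgebra.comul (R := ℂ) (kk u v) = kk u v ⊗ₜ[ℂ] kk u v := by
  rw [kk, Bialgebra.comul_mul, k, k', comul_gen, comul_gen]
  simp [comulGen, k, k']

theorem comul_ep : Coalgebra.comul (R := ℂ) (ep : QUEA P) =
    ep ⊗ₜ[ℂ] kk P.gq P.gl' + kk P.gq⁻¹ P.gl'⁻¹ ⊗ₜ ep := comul_gen _
theorem comul_em : Coalgebra.comul (R := ℂ) (em : QUEA P) =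
    em ⊗ₜ[ℂ] kk P.gq P.gl'⁻¹ + kk P.gq⁻¹ P.gl' ⊗ₜ em := comul_gen _
theorem comul_ep' : Coalgebra.comul (R := ℂ) (ep' : QUEA P) =
    ep' ⊗ₜ[ℂ] kk P.gl⁻¹ P.gq' + kk P.gl P.gq'⁻¹ ⊗ₜ ep' := comul_gen _
theorem comul_em' : Coalgebra.comul (R := ℂ) (em' : QUEA P) =
    em' ⊗ₜ[ℂ] kk P.gl P.gq' + kk P.gl⁻¹ P.gq'⁻¹ ⊗ₜ em' := comul_gen _

theorem counit_kk (u : P.Γ) (v : P.Γ') : Coalgebra.counit (R := ℂ) (kk u v) = (1 : ℂ) := by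
  rw [kk, Bialgebra.counit_mul, k, k', counit_gen, counit_gen]
  simp [counitGen]

theorem counit_ep : Coalgebra.counit (R := ℂ) (ep : QUEA P) = (0 : ℂ) := counit_gen _
theorem counit_em : Coalgebra.counit (R := ℂ) (em : QUEA P) = (0 : ℂ) := counit_gen _
theorem counit_ep' : Coalgebra.counit (R := ℂ) (ep' : QUEA P) = (0 : ℂ) := counit_gen _
theorem counit_em' : Coalgebra.counit (R := ℂ) (em' : QUEA P) = (0 : ℂ) := counit_gen _

theorem hopfAntipode_kk (u : P.Γ) (v : P.Γ') :
    HopfAlgebra.antipode ℂ (kk u v) = kk u⁻¹ v⁻¹ := antipode_kk u v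
theorem hopfAntipode_ep : HopfAlgebra.antipode ℂ (ep : QUEA P) = -P.q • ep := antipode_ep
theorem hopfAntipode_em : HopfAlgebra.antipode ℂ (em : QUEA P) = -P.q⁻¹ • em := antipode_em
theorem hopfAntipode_ep' : HopfAlgebra.antipode ℂ (ep' : QUEA P) = -P.q' • ep' := antipode_ep'
theorem hopfAntipode_em' : HopfAlgebra.antipode ℂ (em' : QUEA P) = -P.q'⁻¹ • em' := antipode_em'

/-- The generators, with all Cartan elements written as `kk u v`. -/
theorem forall_gen {C : QUEA P → Prop} (hep : C ep) (hem : C em) (hep' : C ep') (hem' : C em')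
    (hkk : ∀ u v, C (kk u v)) : ∀ x ∈ Set.range (gen (P := P)), C x := by
  rintro _ ⟨x, rfl⟩
  cases x with
  | ep => exact hep
  | em => exact hem
  | ep' => exact hep'
  | em' => exact hem'
  | k u => exact Eq.mpr (congrArg C (k_eq_kk u)) (hkk u 1)
  | k' u => exact Eq.mpr (congrArg C (k'_eq_kk u)) (hkk 1 u)

section Star

variable (hP : P.IsLorentz) (σ : ℤˣ)

theorem lorentzStar_mul (x y : QUEA P) :
    lorentzStar hP σ (x * y) = lorentzStar hP σ y * lorentzStar hP σ x :=
  Presented.conjLin_mul _ x y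

theorem lorentzStar_ep : lorentzStar hP σ ep = ((σ : ℤ) : ℂ) • ep' := lorentzStar_gen hP σ _
theorem lorentzStar_em : lorentzStar hP σ em = ((σ : ℤ) : ℂ) • em' := lorentzStar_gen hP σ _
theorem lorentzStar_ep' : lorentzStar hP σ ep' = ((σ : ℤ) : ℂ) • ep := lorentzStar_gen hP σ _
theorem lorentzStar_em' : lorentzStar hP σ em' = ((σ : ℤ) : ℂ) • em := lorentzStar_gen hP σ _

theorem lorentzStar_kk (u : P.Γ) (v : P.Γ') :
    lorentzStar hP σ (kk u v) = kk (hP.conjΓ' v) (hP.conjΓ u) := by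
  have h1 : lorentzStar hP σ (k u) = k' (hP.conjΓ u) := lorentzStar_gen hP σ _
  have h2 : lorentzStar hP σ (k' v) = k (hP.conjΓ' v) := lorentzStar_gen hP σ _
  rw [kk, lorentzStar_mul, h1, h2, kk]

/-- The map `u ↦ 1 / conj u` sends `q^(1/2)` to `q'^(1/2)` and `ℓ^(1/2)` to its inverse, so the
Cartan legs in the comultiplication of `e_±` go exactly to those of `e'_±`. In `S(S(x^*)^*)` the two
antipodes contribute reciprocal scalars, because `conj q = 1 / q'`. -/
theorem isHopfStar_lorentzStar : IsHopfStar (lorentzStar hP σ) := by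
  have hq := P.q_ne
  have hq' := P.q'_ne
  refine .of_generators _ (adjoin_gen P) (Presented.conjLin_one _) (lorentzStar_mul hP σ)
    (forall_gen ?_ ?_ ?_ ?_ ?_) (forall_gen ?_ ?_ ?_ ?_ ?_) (forall_gen ?_ ?_ ?_ ?_ ?_)
    (forall_gen ?_ ?_ ?_ ?_ ?_)
  all_goals try intro u v
  all_goals simp [lorentzStar_ep, lorentzStar_em, lorentzStar_ep', lorentzStar_em', lorentzStar_kk,
    smul_smul, sign_sq, comul_ep, comul_em, comul_ep', comul_em', comul_kk, counit_ep, counit_em,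
    counit_ep', counit_em', counit_kk, hopfAntipode_ep, hopfAntipode_em, hopfAntipode_ep',
    hopfAntipode_em', hopfAntipode_kk, hP.conjΓ'_conjΓ, hP.conjΓ_conjΓ', hP.conjΓ_gl, hP.conjΓ'_gl',
    hP.conjΓ_gq, hP.conjΓ'_gq', hP.conj_q_eq, hP.conj_q'_eq,
    TensorProduct.tmul_smul, ← TensorProduct.smul_tmul']
  -- The remaining identities of scalars hold because the sign squares to `1`.
  all_goals
    match_scalars
    field_simp
    linear_combination sign_sq σ

end Star

end QUEA

namespace QFA

variable {P : LinkParams}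

theorem lorentzStar_mul (hP : P.IsLorentz) (x y : QFA P) :
    lorentzStar hP (x * y) = lorentzStar hP y * lorentzStar hP x :=
  Presented.conjLin_mul _ x y

section
variable (hP : P.IsLorentz)
theorem lorentzStar_a : lorentzStar hP a = d' := lorentzStar_gen hP _
theorem lorentzStar_b : lorentzStar hP b = -P.q' • c' := lorentzStar_gen hP _
theorem lorentzStar_c : lorentzStar hP c = -P.q'⁻¹ • b' := lorentzStar_gen hP _
theorem lorentzStar_d : lorentzStar hP d = a' := lorentzStar_gen hP _
theorem lorentzStar_a' : lorentzStar hP a' = d := lorentzStar_gen hP _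
theorem lorentzStar_b' : lorentzStar hP b' = -P.q⁻¹ • c := lorentzStar_gen hP _
theorem lorentzStar_c' : lorentzStar hP c' = -P.q • b := lorentzStar_gen hP _
theorem lorentzStar_d' : lorentzStar hP d' = a := lorentzStar_gen hP _
end

theorem hopfAntipode_a : HopfAlgebra.antipode ℂ (a : QFA P) = d := antipode_a
theorem hopfAntipode_b : HopfAlgebra.antipode ℂ (b : QFA P) = -P.q • b := antipode_b
theorem hopfAntipode_c : HopfAlgebra.antipode ℂ (c : QFA P) = -P.q⁻¹ • c := antipode_c
theorem hopfAntipode_d : HopfAlgebra.antipode ℂ (d : QFA P) = a := antipode_d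
theorem hopfAntipode_a' : HopfAlgebra.antipode ℂ (a' : QFA P) = d' := antipode_a'
theorem hopfAntipode_b' : HopfAlgebra.antipode ℂ (b' : QFA P) = -P.q'⁻¹ • b' := antipode_b'
theorem hopfAntipode_c' : HopfAlgebra.antipode ℂ (c' : QFA P) = -P.q' • c' := antipode_c'
theorem hopfAntipode_d' : HopfAlgebra.antipode ℂ (d' : QFA P) = a' := antipode_d'

theorem comul_a : Coalgebra.comul (R := ℂ) (a : QFA P) = a ⊗ₜ a + b ⊗ₜ c := comul_gen _
theorem comul_b : Coalgebra.comul (R := ℂ) (b : QFA P) = a ⊗ₜ b + b ⊗ₜ d := comul_gen _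
theorem comul_c : Coalgebra.comul (R := ℂ) (c : QFA P) = c ⊗ₜ a + d ⊗ₜ c := comul_gen _
theorem comul_d : Coalgebra.comul (R := ℂ) (d : QFA P) = c ⊗ₜ b + d ⊗ₜ d := comul_gen _
theorem comul_a' : Coalgebra.comul (R := ℂ) (a' : QFA P) = a' ⊗ₜ a' + b' ⊗ₜ c' := comul_gen _
theorem comul_b' : Coalgebra.comul (R := ℂ) (b' : QFA P) = a' ⊗ₜ b' + b' ⊗ₜ d' := comul_gen _
theorem comul_c' : Coalgebra.comul (R := ℂ) (c' : QFA P) = c' ⊗ₜ a' + d' ⊗ₜ c' := comul_gen _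
theorem comul_d' : Coalgebra.comul (R := ℂ) (d' : QFA P) = c' ⊗ₜ b' + d' ⊗ₜ d' := comul_gen _

theorem counit_a : Coalgebra.counit (R := ℂ) (a : QFA P) = (1 : ℂ) := counit_gen _
theorem counit_b : Coalgebra.counit (R := ℂ) (b : QFA P) = (0 : ℂ) := counit_gen _
theorem counit_c : Coalgebra.counit (R := ℂ) (c : QFA P) = (0 : ℂ) := counit_gen _
theorem counit_d : Coalgebra.counit (R := ℂ) (d : QFA P) = (1 : ℂ) := counit_gen _
theorem counit_a' : Coalgebra.counit (R := ℂ) (a' : QFA P) = (1 : ℂ) := counit_gen _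
theorem counit_b' : Coalgebra.counit (R := ℂ) (b' : QFA P) = (0 : ℂ) := counit_gen _
theorem counit_c' : Coalgebra.counit (R := ℂ) (c' : QFA P) = (0 : ℂ) := counit_gen _
theorem counit_d' : Coalgebra.counit (R := ℂ) (d' : QFA P) = (1 : ℂ) := counit_gen _

theorem forall_gen {C : QFA P → Prop} (ha : C a) (hb : C b) (hc : C c) (hd : C d)
    (ha' : C a') (hb' : C b') (hc' : C c') (hd' : C d') :
    ∀ x ∈ Set.range (gen (P := P)), C x := by
  rintro _ ⟨x, rfl⟩
  cases x
  exacts [ha, hb, hc, hd, ha', hb', hc', hd']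

theorem isHopfStar_lorentzStar (hP : P.IsLorentz) : IsHopfStar (lorentzStar hP) := by
  have hq := P.q_ne
  have hq' := P.q'_ne
  refine .of_generators _ (adjoin_gen P) (Presented.conjLin_one _) (lorentzStar_mul hP)
    (forall_gen ?_ ?_ ?_ ?_ ?_ ?_ ?_ ?_) (forall_gen ?_ ?_ ?_ ?_ ?_ ?_ ?_ ?_)
    (forall_gen ?_ ?_ ?_ ?_ ?_ ?_ ?_ ?_) (forall_gen ?_ ?_ ?_ ?_ ?_ ?_ ?_ ?_)
  all_goals simp [lorentzStar_a, lorentzStar_b, lorentzStar_c, lorentzStar_d, lorentzStar_a',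
    lorentzStar_b', lorentzStar_c', lorentzStar_d', hopfAntipode_a, hopfAntipode_b,
    hopfAntipode_c, hopfAntipode_d, hopfAntipode_a', hopfAntipode_b', hopfAntipode_c',
    hopfAntipode_d', comul_a, comul_b, comul_c, comul_d, comul_a', comul_b', comul_c', comul_d',
    counit_a, counit_b, counit_c, counit_d, counit_a', counit_b', counit_c', counit_d',
    smul_smul, hP.conj_q_eq, hP.conj_q'_eq, hq, hq', add_comm]
  all_goals
    simp only [TensorProduct.neg_tmul, TensorProduct.tmul_neg, ← TensorProduct.smul_tmul',
      TensorProduct.tmul_smul] <;>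
    match_scalars <;> field_simp

end QFA

/-! ### Hopf pairings, checked on generators -/

section Pairing

variable {H F : Type} [Ring H] [HopfAlgebra ℂ H] [Ring F] [HopfAlgebra ℂ F]
  {B : H →ₗ[ℂ] F →ₗ[ℂ] ℂ}

@[simp] theorem tensorPairing_tmul (x y : H) (f g : F) :
    tensorPairing B (x ⊗ₜ y) (f ⊗ₜ g) = B x f * B y g := by
  simp [tensorPairing]

/-- Compatibility with products in the first argument passes from two elements of `F` to their
product. -/
theorem pairing_mul_left_mul
    (hr : ∀ x f g, B x (f * g) = tensorPairing B (Coalgebra.comul (R := ℂ) x) (f ⊗ₜ g)) {f g : F}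
    (hf : ∀ x y, B (x * y) f = tensorPairing B (x ⊗ₜ y) (Coalgebra.comul (R := ℂ) f))
    (hg : ∀ x y, B (x * y) g = tensorPairing B (x ⊗ₜ y) (Coalgebra.comul (R := ℂ) g)) (x y : H) :
    B (x * y) (f * g) = tensorPairing B (x ⊗ₜ y) (Coalgebra.comul (R := ℂ) (f * g)) := by
  have hr' : ∀ x f g, B x (f * g) = ∑ i ∈ (Coalgebra.Repr.arbitrary ℂ x).index,
      B ((Coalgebra.Repr.arbitrary ℂ x).left i) f *
        B ((Coalgebra.Repr.arbitrary ℂ x).right i) g := fun x f g => by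
    rw [hr, ← (Coalgebra.Repr.arbitrary ℂ x).eq]
    simp
  have hl : ∀ h : F, (∀ x y, B (x * y) h = tensorPairing B (x ⊗ₜ y)
      (Coalgebra.comul (R := ℂ) h)) → ∀ x y, B (x * y) h =
      ∑ i ∈ (Coalgebra.Repr.arbitrary ℂ h).index,
        B x ((Coalgebra.Repr.arbitrary ℂ h).left i) *
          B y ((Coalgebra.Repr.arbitrary ℂ h).right i) := fun h hh x y => by
    rw [hh, ← (Coalgebra.Repr.arbitrary ℂ h).eq]
    simp
  rw [hr, Bialgebra.comul_mul, Bialgebra.comul_mul, ← (Coalgebra.Repr.arbitrary ℂ x).eq,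
    ← (Coalgebra.Repr.arbitrary ℂ y).eq, ← (Coalgebra.Repr.arbitrary ℂ f).eq,
    ← (Coalgebra.Repr.arbitrary ℂ g).eq]
  simp only [Finset.sum_mul_sum, Algebra.TensorProduct.tmul_mul_tmul, map_sum,
    LinearMap.sum_apply, tensorPairing_tmul, hr' x, hr' y, hl f hf, hl g hg]
  generalize Coalgebra.Repr.arbitrary ℂ x = X
  generalize Coalgebra.Repr.arbitrary ℂ y = Y
  generalize Coalgebra.Repr.arbitrary ℂ f = Z
  generalize Coalgebra.Repr.arbitrary ℂ g = W
  -- Both sides are sums of `⟨x₁, f₁⟩⟨y₁, f₂⟩⟨x₂, g₁⟩⟨y₂, g₂⟩` over the four decompositions. They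
  -- differ in the order of summation and in the order of the two middle factors.
  rw [Finset.sum_comm, Finset.sum_congr rfl fun i _ => Finset.sum_comm, Finset.sum_comm]
  refine Finset.sum_congr rfl fun k _ => ?_
  rw [Finset.sum_congr rfl fun i _ => Finset.sum_comm, Finset.sum_comm]
  refine Finset.sum_congr rfl fun l _ => ?_
  rw [Finset.sum_comm]
  exact Finset.sum_congr rfl fun i _ => Finset.sum_congr rfl fun j _ => mul_mul_mul_comm _ _ _ _

/-- The product rule in the second argument expresses `⟨x, fg⟩` through the values at `f` and at `g`
on the legs of the comultiplication of `x`. The induction on `f` must therefore keep `x` arbitrary.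
-/
theorem IsHopfPairing.eq_of_generators {B' : H →ₗ[ℂ] F →ₗ[ℂ] ℂ} (hB : IsHopfPairing B)
    (hB' : IsHopfPairing B') (G : Set F) (hG : Algebra.adjoin ℂ G = ⊤)
    (h : ∀ x, ∀ f ∈ G, B x f = B' x f) : B = B' := by
  ext x f
  induction (hG ▸ Algebra.mem_top : f ∈ Algebra.adjoin ℂ G) using Algebra.adjoin_induction
    generalizing x with
  | mem f hf => exact h x f hf
  | algebraMap z =>
    rw [Algebra.algebraMap_eq_smul_one, map_smul, map_smul, hB.one_right, hB'.one_right]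
  | add f g _ _ hf hg => rw [map_add, map_add, hf, hg]
  | mul f g _ _ hf hg =>
    rw [hB.mul_right, hB'.mul_right]
    induction Coalgebra.comul (R := ℂ) x using TensorProduct.induction_on with
    | zero => simp
    | add s t hs ht => simp only [map_add, LinearMap.add_apply, hs, ht]
    | tmul y z => simp [hf, hg]

/-- The compatibility of a Hopf pairing with star structures can be checked on generators of the
second algebra. -/
theorem IsHopfPairing.star_of_generators (hB : IsHopfPairing B) {σ : H →ₛₗ[starRingEnd ℂ] H}
    {τ : F →ₛₗ[starRingEnd ℂ] F} (hσ : IsHopfStar σ) (hτ : IsHopfStar τ) (G : Set F)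
    (hG : Algebra.adjoin ℂ G = ⊤)
    (h : ∀ x, ∀ f ∈ G, B (σ x) f = starRingEnd ℂ (B x (τ (HopfAlgebra.antipode ℂ f)))) (x : H)
    (f : F) : B (σ x) f = starRingEnd ℂ (B x (τ (HopfAlgebra.antipode ℂ f))) := by
  induction (hG ▸ Algebra.mem_top : f ∈ Algebra.adjoin ℂ G) using Algebra.adjoin_induction
    generalizing x with
  | mem f hf => exact h x f hf
  | algebraMap z =>
    simp [Algebra.algebraMap_eq_smul_one, hB.one_right, hτ.map_one, hσ.counit]
  | add f g _ _ hf hg => simp [hf, hg]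
  | mul f g _ _ hf hg =>
    rw [hB.mul_right, HopfAlgebra.antipode_mul_antidistrib, hτ.map_mul, hB.mul_right, hσ.comul]
    induction Coalgebra.comul (R := ℂ) x using TensorProduct.induction_on with
    | zero => simp
    | add s t hs ht => simp only [map_add, LinearMap.add_apply, hs, ht]
    | tmul y z => simp [hf, hg]

/-- Both sides are antimultiplicative in `x`. The identity is what makes compatibility of a pairing
with the antipodes pass to products in the second argument. -/
theorem comul_antipode_of_generators (G : Set H) (hG : Algebra.adjoin ℂ G = ⊤)
    (h : ∀ x ∈ G, Coalgebra.comul (R := ℂ) (HopfAlgebra.antipode ℂ x) =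
      TensorProduct.comm ℂ H H (TensorProduct.map (HopfAlgebra.antipode ℂ)
        (HopfAlgebra.antipode ℂ) (Coalgebra.comul (R := ℂ) x))) (x : H) :
    Coalgebra.comul (R := ℂ) (HopfAlgebra.antipode ℂ x) =
      TensorProduct.comm ℂ H H (TensorProduct.map (HopfAlgebra.antipode ℂ)
        (HopfAlgebra.antipode ℂ) (Coalgebra.comul (R := ℂ) x)) := by
  induction (hG ▸ Algebra.mem_top : x ∈ Algebra.adjoin ℂ G) using Algebra.adjoin_induction with
  | mem f hf => exact h f hf
  | algebraMap z =>
    simp [Algebra.algebraMap_eq_smul_one, HopfAlgebra.antipode_one, Algebra.TensorProduct.one_def]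
  | add f g _ _ hf hg => simp only [map_add, hf, hg]
  | mul x y _ _ hx hy =>
    rw [HopfAlgebra.antipode_mul_antidistrib, Bialgebra.comul_mul, hx, hy, Bialgebra.comul_mul]
    generalize Coalgebra.comul (R := ℂ) x = s
    generalize Coalgebra.comul (R := ℂ) y = t
    induction s using TensorProduct.induction_on with
    | zero => simp
    | add a b ha hb => simp only [add_mul, map_add, ha, hb, mul_add]
    | tmul a b =>
      induction t using TensorProduct.induction_on with
      | zero => simp
      | add c d hc hd => simp only [add_mul, map_add, hc, hd, mul_add]
      | tmul c d => simp [HopfAlgebra.antipode_mul_antidistrib]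

end Pairing

namespace QUEA
variable {P : LinkParams}

theorem comul_antipode (x : QUEA P) :
    Coalgebra.comul (R := ℂ) (HopfAlgebra.antipode ℂ x) =
      TensorProduct.comm ℂ _ _ (TensorProduct.map (HopfAlgebra.antipode ℂ)
        (HopfAlgebra.antipode ℂ) (Coalgebra.comul (R := ℂ) x)) := by
  refine comul_antipode_of_generators _ (adjoin_gen P) (forall_gen ?_ ?_ ?_ ?_ ?_) x
  all_goals
    simp [comul_ep, comul_em, comul_ep', comul_em', comul_kk, hopfAntipode_ep, hopfAntipode_em,
      hopfAntipode_ep', hopfAntipode_em', hopfAntipode_kk, TensorProduct.neg_tmul,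
      TensorProduct.tmul_neg, ← TensorProduct.smul_tmul', TensorProduct.tmul_smul, add_comm]

end QUEA

/-! ### The pairing on generators -/

namespace QFAGen

/-- The pairing of generators with `kk u v`, for `u` and `v` of values `x` and `y`. -/
def cartanVal (x y : ℂ) : QFAGen → ℂ
  | a => x | b => 0 | c => 0 | d => x⁻¹
  | a' => y⁻¹ | b' => 0 | c' => 0 | d' => y

/-- The indicator function of the generator `b`. -/
def epVal : QFAGen → ℂ
  | b => 1 | _ => 0

/-- The indicator function of the generator `c`. -/
def emVal : QFAGen → ℂ
  | c => 1 | _ => 0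

/-- The multiple `s` of the indicator function of the generator `c'`. -/
def epVal' (s : ℂ) : QFAGen → ℂ
  | c' => s | _ => 0

/-- The multiple `s` of the indicator function of the generator `b'`. -/
def emVal' (s : ℂ) : QFAGen → ℂ
  | b' => s | _ => 0

end QFAGen

/-! ### Consequences of the table of values: uniqueness and star compatibility -/

section Table

variable {P : LinkParams} {σ : ℤˣ} {B : QUEA P →ₗ[ℂ] QFA P →ₗ[ℂ] ℂ}

/-- With the matrix comultiplication, the product rule in the first argument is matrix
multiplication. Any Hopf pairing thus yields a two-dimensional representation for each sector. -/
theorem chiralMatrix_mul (hB : IsHopfPairing B) (x y : QUEA P) :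
    chiralMatrix B (x * y) = chiralMatrix B x * chiralMatrix B y := by
  simp [chiralMatrix, hB.mul_left, QFA.comul_a, QFA.comul_b, QFA.comul_c, QFA.comul_d]

theorem antichiralMatrix_mul (hB : IsHopfPairing B) (x y : QUEA P) :
    antichiralMatrix B (x * y) = antichiralMatrix B x * antichiralMatrix B y := by
  ext i j
  fin_cases i <;> fin_cases j <;>
    simp [antichiralMatrix, hB.mul_left, QFA.comul_a', QFA.comul_b', QFA.comul_c', QFA.comul_d',
      Matrix.mul_apply, Fin.sum_univ_two]

theorem chiralMatrix_one (hB : IsHopfPairing B) : chiralMatrix B 1 = 1 := by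
  simp [chiralMatrix, hB.one_left, QFA.counit_a, QFA.counit_b, QFA.counit_c, QFA.counit_d,
    Matrix.one_fin_two]

theorem antichiralMatrix_one (hB : IsHopfPairing B) : antichiralMatrix B 1 = 1 := by
  ext i j
  fin_cases i <;> fin_cases j <;>
  simp [antichiralMatrix, hB.one_left, QFA.counit_a', QFA.counit_b', QFA.counit_c', QFA.counit_d']

theorem eq_inv_of_mul_eq_one_fin_two {M : Matrix (Fin 2) (Fin 2) ℂ} {x : ℂ} (hx : x ≠ 0)
    (h : M * !![x, 0; 0, x⁻¹] = 1) : M = !![x⁻¹, 0; 0, x] := by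
  have h2 : !![x, 0; 0, x⁻¹] * !![x⁻¹, 0; 0, x] = 1 := by
    simp [Matrix.one_fin_two, hx]
  calc M = M * (!![x, 0; 0, x⁻¹] * !![x⁻¹, 0; 0, x]) := by rw [h2, mul_one]
    _ = _ := by rw [← mul_assoc, h, one_mul]

namespace HasPairingTable

/-- The table prescribes only `q^h` and `ℓ^h`. Both matrices are multiplicative in `u`, and `Γ` is
generated by the two square roots, so all other values are forced. -/
theorem chiralMatrix_k (hT : HasPairingTable σ B) (hB : IsHopfPairing B) (u : P.Γ) :
    chiralMatrix B (QUEA.k u) = !![((u : ℂˣ) : ℂ), 0; 0, ((u : ℂˣ) : ℂ)⁻¹] ∧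
      antichiralMatrix B (QUEA.k u) = 1 := by
  obtain ⟨u, hu⟩ := u
  induction hu using Subgroup.closure_induction with
  | mem x hx =>
    rcases hx with rfl | rfl
    · exact ⟨hT.qh, hT.mixed_qh⟩
    · exact ⟨hT.lh, hT.mixed_lh⟩
  | one =>
    have : (⟨1, Subgroup.one_mem _⟩ : P.Γ) = 1 := rfl
    rw [this, QUEA.k_one, chiralMatrix_one hB, antichiralMatrix_one hB]
    simp [Matrix.one_fin_two]
  | mul x y hx hy ihx ihy =>
    have : (⟨x * y, Subgroup.mul_mem _ hx hy⟩ : P.Γ) = ⟨x, hx⟩ * ⟨y, hy⟩ := rfl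
    rw [this, QUEA.k_mul, chiralMatrix_mul hB, antichiralMatrix_mul hB, ihx.1, ihx.2, ihy.1, ihy.2]
    simp [mul_comm]
  | inv x hx ih =>
    have : (⟨x⁻¹, Subgroup.inv_mem _ hx⟩ : P.Γ) * ⟨x, hx⟩ = 1 := Subtype.ext (inv_mul_cancel x)
    have h1 := chiralMatrix_mul hB (QUEA.k ⟨x⁻¹, Subgroup.inv_mem _ hx⟩) (QUEA.k ⟨x, hx⟩)
    have h2 := antichiralMatrix_mul hB (QUEA.k ⟨x⁻¹, Subgroup.inv_mem _ hx⟩) (QUEA.k ⟨x, hx⟩)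
    rw [← QUEA.k_mul, this, QUEA.k_one, chiralMatrix_one hB, ih.1] at h1
    rw [← QUEA.k_mul, this, QUEA.k_one, antichiralMatrix_one hB, ih.2, mul_one] at h2
    refine ⟨?_, h2.symm⟩
    rw [eq_inv_of_mul_eq_one_fin_two x.ne_zero h1.symm]
    simp

theorem antichiralMatrix_k' (hT : HasPairingTable σ B) (hB : IsHopfPairing B) (u : P.Γ') :
    antichiralMatrix B (QUEA.k' u) = !![((u : ℂˣ) : ℂ)⁻¹, 0; 0, ((u : ℂˣ) : ℂ)] ∧
      chiralMatrix B (QUEA.k' u) = 1 := by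
  obtain ⟨u, hu⟩ := u
  induction hu using Subgroup.closure_induction with
  | mem x hx =>
    rcases hx with rfl | rfl
    · exact ⟨hT.qh', hT.mixed_qh'⟩
    · exact ⟨hT.lh', hT.mixed_lh'⟩
  | one =>
    have : (⟨1, Subgroup.one_mem _⟩ : P.Γ') = 1 := rfl
    rw [this, QUEA.k_one', chiralMatrix_one hB, antichiralMatrix_one hB]
    simp [Matrix.one_fin_two]
  | mul x y hx hy ihx ihy =>
    have : (⟨x * y, Subgroup.mul_mem _ hx hy⟩ : P.Γ') = ⟨x, hx⟩ * ⟨y, hy⟩ := rfl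
    rw [this, QUEA.k_mul', chiralMatrix_mul hB, antichiralMatrix_mul hB, ihx.1, ihx.2, ihy.1, ihy.2]
    simp [mul_comm]
  | inv x hx ih =>
    have : (⟨x⁻¹, Subgroup.inv_mem _ hx⟩ : P.Γ') * ⟨x, hx⟩ = 1 := Subtype.ext (inv_mul_cancel x)
    have h1 := antichiralMatrix_mul hB (QUEA.k' ⟨x⁻¹, Subgroup.inv_mem _ hx⟩) (QUEA.k' ⟨x, hx⟩)
    have h2 := chiralMatrix_mul hB (QUEA.k' ⟨x⁻¹, Subgroup.inv_mem _ hx⟩) (QUEA.k' ⟨x, hx⟩)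
    rw [← QUEA.k_mul', this, QUEA.k_one', antichiralMatrix_one hB, ih.1] at h1
    rw [← QUEA.k_mul', this, QUEA.k_one', chiralMatrix_one hB, ih.2, mul_one] at h2
    refine ⟨?_, h2.symm⟩
    -- The antichiral diagonal is `(x⁻¹, x)`, so the inversion lemma is applied at `x⁻¹`.
    have := eq_inv_of_mul_eq_one_fin_two (x := (x : ℂ)⁻¹) (inv_ne_zero x.ne_zero)
      (by rw [inv_inv]; exact h1.symm)
    rw [this]
    simp

theorem kk_gen (hT : HasPairingTable σ B) (hB : IsHopfPairing B) (u : P.Γ) (v : P.Γ')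
    (g : QFAGen) : B (QUEA.kk u v) (QFA.gen g) = g.cartanVal ((u : ℂˣ) : ℂ) ((v : ℂˣ) : ℂ) := by
  have h1 := chiralMatrix_mul hB (QUEA.k u) (QUEA.k' v)
  have h2 := antichiralMatrix_mul hB (QUEA.k u) (QUEA.k' v)
  rw [(hT.chiralMatrix_k hB u).1, (hT.antichiralMatrix_k' hB v).2, mul_one] at h1
  rw [(hT.chiralMatrix_k hB u).2, (hT.antichiralMatrix_k' hB v).1, one_mul] at h2
  cases g
  · exact congrFun (congrFun h1 0) 0
  · exact congrFun (congrFun h1 0) 1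
  · exact congrFun (congrFun h1 1) 0
  · exact congrFun (congrFun h1 1) 1
  · exact congrFun (congrFun h2 0) 0
  · exact congrFun (congrFun h2 0) 1
  · exact congrFun (congrFun h2 1) 0
  · exact congrFun (congrFun h2 1) 1

theorem gen_of_matrix {x : QUEA P} {M N : Matrix (Fin 2) (Fin 2) ℂ} (h1 : chiralMatrix B x = M)
    (h2 : antichiralMatrix B x = N) (g : QFAGen) : B x (QFA.gen g) = match g with
      | .a => M 0 0 | .b => M 0 1 | .c => M 1 0 | .d => M 1 1
      | .a' => N 0 0 | .b' => N 0 1 | .c' => N 1 0 | .d' => N 1 1 := by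
  cases g
  · exact congrFun (congrFun h1 0) 0
  · exact congrFun (congrFun h1 0) 1
  · exact congrFun (congrFun h1 1) 0
  · exact congrFun (congrFun h1 1) 1
  · exact congrFun (congrFun h2 0) 0
  · exact congrFun (congrFun h2 0) 1
  · exact congrFun (congrFun h2 1) 0
  · exact congrFun (congrFun h2 1) 1

theorem ep_gen (hT : HasPairingTable σ B) (g : QFAGen) : B QUEA.ep (QFA.gen g) = g.epVal := by
  rw [gen_of_matrix hT.ep hT.mixed_ep]
  cases g <;> rfl

theorem em_gen (hT : HasPairingTable σ B) (g : QFAGen) : B QUEA.em (QFA.gen g) = g.emVal := by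
  rw [gen_of_matrix hT.em hT.mixed_em]
  cases g <;> rfl

theorem ep'_gen (hT : HasPairingTable σ B) (g : QFAGen) :
    B QUEA.ep' (QFA.gen g) = g.epVal' ((σ : ℤ) : ℂ) := by
  rw [gen_of_matrix hT.mixed_ep' hT.ep']
  cases g <;> rfl

theorem em'_gen (hT : HasPairingTable σ B) (g : QFAGen) :
    B QUEA.em' (QFA.gen g) = g.emVal' ((σ : ℤ) : ℂ) := by
  rw [gen_of_matrix hT.mixed_em' hT.em']
  cases g <;> rfl

/-- The table of values on generators determines the pairing. -/
theorem unique (hT : HasPairingTable σ B) (hB : IsHopfPairing B)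
    {B' : QUEA P →ₗ[ℂ] QFA P →ₗ[ℂ] ℂ} (hT' : HasPairingTable σ B') (hB' : IsHopfPairing B') :
    B = B' := by
  refine hB.eq_of_generators hB' _ (QFA.adjoin_gen P) ?_
  rintro x _ ⟨g, rfl⟩
  induction (QUEA.adjoin_gen P ▸ Algebra.mem_top : x ∈ Algebra.adjoin ℂ (Set.range QUEA.gen))
    using Algebra.adjoin_induction generalizing g with
  | mem x hx =>
    revert x
    apply QUEA.forall_gen
    · rw [hT.ep_gen, hT'.ep_gen]
    · rw [hT.em_gen, hT'.em_gen]
    · rw [hT.ep'_gen, hT'.ep'_gen]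
    · rw [hT.em'_gen, hT'.em'_gen]
    · intro u v
      rw [hT.kk_gen hB, hT'.kk_gen hB']
  | algebraMap z =>
    rw [Algebra.algebraMap_eq_smul_one, map_smul, map_smul, LinearMap.smul_apply,
      LinearMap.smul_apply, hB.one_left, hB'.one_left]
  | add x y _ _ hx hy => rw [map_add, map_add, LinearMap.add_apply, LinearMap.add_apply, hx, hy]
  | mul x y _ _ hx hy =>
    -- The comultiplication of a generator involves generators only, so the induction hypotheses,
    -- stated for every `g`, suffice.
    rw [hB.mul_left, hB'.mul_left, QFA.comul_gen]
    cases g <;>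
    simp [QFA.comulGen, QFA.a, QFA.b, QFA.c, QFA.d, QFA.a', QFA.b', QFA.c', QFA.d', hx, hy]

/-- Once `f` is a generator, the map `f ↦ S(f)^⋆` replaces it by the transposed entry of the matrix
of the other sector. What remains is that `x ↦ x^*` corresponds to conjugate transposition between
the two matrix representations, which is read off from the table. -/
theorem star (hT : HasPairingTable σ B) (hB : IsHopfPairing B) (hP : P.IsLorentz)
    (x : QUEA P) (f : QFA P) : B (QUEA.lorentzStar hP σ x) f =
      starRingEnd ℂ (B x (QFA.lorentzStar hP (HopfAlgebra.antipode ℂ f))) := by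
  refine hB.star_of_generators (QUEA.isHopfStar_lorentzStar hP σ) (QFA.isHopfStar_lorentzStar hP)
    _ (QFA.adjoin_gen P) ?_ x f
  clear x f
  have hq := P.q_ne
  have hq' := P.q'_ne
  -- The star was defined as an antipode applied to a transposed matrix. The antipode of `f` cancels
  -- its scalars, leaving the bare transposed generator of the other sector.
  have key : ∀ g : QFAGen, QFA.lorentzStar hP (HopfAlgebra.antipode ℂ (QFA.gen g)) =
      (QFA.gen (match g with
      | .a => .a' | .b => .c' | .c => .b' | .d => .d'
      | .a' => .a | .b' => .c | .c' => .b | .d' => .d) : QFA P) := by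
    refine QFAGen.rec ?_ ?_ ?_ ?_ ?_ ?_ ?_ ?_
    · exact (congrArg _ QFA.hopfAntipode_a).trans (QFA.lorentzStar_d hP)
    · refine (congrArg _ QFA.hopfAntipode_b).trans ?_
      rw [map_smulₛₗ, QFA.lorentzStar_b, smul_smul]
      simp [hP.conj_q_eq, hq']; rfl
    · refine (congrArg _ QFA.hopfAntipode_c).trans ?_
      rw [map_smulₛₗ, QFA.lorentzStar_c, smul_smul]
      simp [hP.conj_q_eq, hq']; rfl
    · exact (congrArg _ QFA.hopfAntipode_d).trans (QFA.lorentzStar_a hP)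
    · exact (congrArg _ QFA.hopfAntipode_a').trans (QFA.lorentzStar_d' hP)
    · refine (congrArg _ QFA.hopfAntipode_b').trans ?_
      rw [map_smulₛₗ, QFA.lorentzStar_b', smul_smul]
      simp [hP.conj_q'_eq, hq]; rfl
    · refine (congrArg _ QFA.hopfAntipode_c').trans ?_
      rw [map_smulₛₗ, QFA.lorentzStar_c', smul_smul]
      simp [hP.conj_q'_eq, hq]; rfl
    · exact (congrArg _ QFA.hopfAntipode_d').trans (QFA.lorentzStar_a' hP)
  rintro x _ ⟨g, rfl⟩
  rw [key]
  induction (QUEA.adjoin_gen P ▸ Algebra.mem_top : x ∈ Algebra.adjoin ℂ (Set.range QUEA.gen))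
    using Algebra.adjoin_induction generalizing g with
  | mem x hx =>
    revert x
    apply QUEA.forall_gen
    · rw [QUEA.lorentzStar_ep, map_smul, LinearMap.smul_apply, hT.ep_gen, hT.ep'_gen]
      cases g <;> simp [QFAGen.epVal, QFAGen.epVal', QUEA.sign_sq]
    · rw [QUEA.lorentzStar_em, map_smul, LinearMap.smul_apply, hT.em_gen, hT.em'_gen]
      cases g <;> simp [QFAGen.emVal, QFAGen.emVal', QUEA.sign_sq]
    · rw [QUEA.lorentzStar_ep', map_smul, LinearMap.smul_apply, hT.ep_gen, hT.ep'_gen]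
      cases g <;> simp [QFAGen.epVal, QFAGen.epVal']
    · rw [QUEA.lorentzStar_em', map_smul, LinearMap.smul_apply, hT.em_gen, hT.em'_gen]
      cases g <;> simp [QFAGen.emVal, QFAGen.emVal']
    · intro u v
      rw [QUEA.lorentzStar_kk, hT.kk_gen hB, hT.kk_gen hB]
      cases g <;> simp [QFAGen.cartanVal, hP.coe_conjΓ, hP.coe_conjΓ']
  | algebraMap z =>
    rw [antilinear_algebraMap (QUEA.isHopfStar_lorentzStar hP σ).map_one]
    simp only [Algebra.algebraMap_eq_smul_one, map_smul, LinearMap.smul_apply, hB.one_left,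
      QFA.counit_gen]
    cases g <;> simp [QFA.counitGen]
  | add x y _ _ hx hy => simp [hx, hy]
  | mul x y _ _ hx hy =>
    -- Transposition reverses matrix products, which matches the antimultiplicativity of the star.
    rw [QUEA.lorentzStar_mul, hB.mul_left, hB.mul_left, QFA.comul_gen, QFA.comul_gen]
    cases g <;>
    simp [QFA.comulGen, QFA.a, QFA.b, QFA.c, QFA.d, QFA.a', QFA.b', QFA.c', QFA.d', hx, hy,
      mul_comm]

end HasPairingTable

end Table

/-! ### Existence: matrix coefficients of two-dimensional representations -/

namespace QUEA

variable {P : LinkParams}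

/-- The two-dimensional representation of the chiral sector on generators. -/
def chiralRepGen : QUEAGen P → Matrix (Fin 2) (Fin 2) ℂ
  | .ep => !![0, 1; 0, 0]
  | .em => !![0, 0; 1, 0]
  | .k u => !![((u : ℂˣ) : ℂ), 0; 0, ((u : ℂˣ) : ℂ)⁻¹]
  | .ep' => 0
  | .em' => 0
  | .k' _ => 1

/-- The two-dimensional representation of the antichiral sector on generators. -/
def antichiralRepGen (s : ℂ) : QUEAGen P → Matrix (Fin 2) (Fin 2) ℂ
  | .ep => 0
  | .em => 0
  | .k _ => 1
  | .ep' => !![0, 0; s, 0]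
  | .em' => !![0, s; 0, 0]
  | .k' v => !![((v : ℂˣ) : ℂ)⁻¹, 0; 0, ((v : ℂˣ) : ℂ)]

theorem sub_inv_ne_zero {z : ℂ} (hz : z ≠ 0) (h : z ^ 2 ≠ 1) : z - z⁻¹ ≠ 0 := by
  intro h0
  apply h
  field_simp at h0
  linear_combination h0

/-- The antichiral generators act through the counit, so the link relations are trivial. The
hypothesis on `q` serves the commutator of `e_+` and `e_-`: for `q² = 1` the scalar `(q - q⁻¹)⁻¹`
would be `0⁻¹ = 0`, while the commutator of the matrices is nonzero. -/
theorem chiralRepGen_rel (h : P.q ^ 2 ≠ 1) ⦃x y : FreeAlgebra ℂ (QUEAGen P)⦄ (hxy : QUEARel P x y) :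
    FreeAlgebra.lift ℂ (chiralRepGen (P := P)) x = FreeAlgebra.lift ℂ chiralRepGen y := by
  have h0 := sub_inv_ne_zero P.q_ne h
  have hq : ((P.gq : ℂˣ) : ℂ) * ((P.gq : ℂˣ) : ℂ) = P.q := (sq _).symm
  have hq1 : ((P.gq : ℂˣ) : ℂ)⁻¹ * ((P.gq : ℂˣ) : ℂ)⁻¹ = P.q⁻¹ := by rw [← mul_inv, hq]
  have hu : ∀ u : ℂˣ, (u : ℂ) ≠ 0 := fun u => u.ne_zero
  cases hxy with
  | link x y hx hy =>
    simp only [map_mul, FreeAlgebra.lift_ι_apply]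
    cases hx <;> cases hy <;> simp [chiralRepGen]
  | k_one' => simp [chiralRepGen]
  | ep_em =>
    simp only [map_mul, map_smul, map_sub, map_pow, FreeAlgebra.lift_ι_apply, chiralRepGen]
    ext i j
    fin_cases i <;> fin_cases j <;> simp [sq, hq, hq1]
    · rw [inv_mul_cancel₀ h0]
    · rw [← neg_sub P.q, mul_neg, inv_mul_cancel₀ h0]
  | _ =>
    simp only [map_mul, map_smul, map_sub, map_pow, map_one, FreeAlgebra.lift_ι_apply, chiralRepGen]
    ext i j
    fin_cases i <;> fin_cases j <;> simp [sq, mul_comm]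

/-- Compared with the chiral case the raising and lowering matrices are exchanged and the Cartan
diagonal is inverted. The normalisation `s * s = 1` enters only in the commutator of `e'_+` and
`e'_-`, which is quadratic in `s`. -/
theorem antichiralRepGen_rel {s : ℂ} (hs : s * s = 1) (h : P.q' ^ 2 ≠ 1)
    ⦃x y : FreeAlgebra ℂ (QUEAGen P)⦄ (hxy : QUEARel P x y) :
    FreeAlgebra.lift ℂ (antichiralRepGen (P := P) s) x =
      FreeAlgebra.lift ℂ (antichiralRepGen s) y := by
  have h0 := sub_inv_ne_zero P.q'_ne h
  have hq : ((P.gq' : ℂˣ) : ℂ) * ((P.gq' : ℂˣ) : ℂ) = P.q' := (sq _).symm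
  have hq1 : ((P.gq' : ℂˣ) : ℂ)⁻¹ * ((P.gq' : ℂˣ) : ℂ)⁻¹ = P.q'⁻¹ := by rw [← mul_inv, hq]
  have hu : ∀ u : ℂˣ, (u : ℂ) ≠ 0 := fun u => u.ne_zero
  cases hxy with
  | link x y hx hy =>
    simp only [map_mul, FreeAlgebra.lift_ι_apply]
    cases hx <;> cases hy <;> simp [antichiralRepGen]
  | k_one => simp [antichiralRepGen]
  | ep_em' =>
    simp only [map_mul, map_smul, map_sub, map_pow, FreeAlgebra.lift_ι_apply, antichiralRepGen]
    ext i j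
    fin_cases i <;> fin_cases j <;> simp [sq, hq, hq1, hs]
    · rw [← neg_sub P.q', mul_neg, inv_mul_cancel₀ h0]
    · rw [inv_mul_cancel₀ h0]
  | _ =>
    simp only [map_mul, map_smul, map_sub, map_pow, map_one, FreeAlgebra.lift_ι_apply,
      antichiralRepGen]
    ext i j
    fin_cases i <;> fin_cases j <;> simp [sq, mul_comm, mul_assoc, mul_left_comm]

/-- The two-dimensional representation of the chiral sector. -/
def chiralRep (h : P.q ^ 2 ≠ 1) : QUEA P →ₐ[ℂ] Matrix (Fin 2) (Fin 2) ℂ :=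
  lift chiralRepGen (chiralRepGen_rel h)

/-- The two-dimensional representation of the antichiral sector. -/
def antichiralRep {s : ℂ} (hs : s * s = 1) (h : P.q' ^ 2 ≠ 1) :
    QUEA P →ₐ[ℂ] Matrix (Fin 2) (Fin 2) ℂ :=
  lift (antichiralRepGen s) (antichiralRepGen_rel hs h)

section Reps

variable (h : P.q ^ 2 ≠ 1) {s : ℂ} (hs : s * s = 1) (h' : P.q' ^ 2 ≠ 1)

theorem chiralRep_ep : chiralRep h ep = !![0, 1; 0, 0] := lift_gen _ _ _
theorem chiralRep_em : chiralRep h em = !![0, 0; 1, 0] := lift_gen _ _ _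
theorem chiralRep_ep' : chiralRep h ep' = 0 := lift_gen _ _ _
theorem chiralRep_em' : chiralRep h em' = 0 := lift_gen _ _ _
theorem chiralRep_kk (u : P.Γ) (v : P.Γ') :
    chiralRep h (kk u v) = !![((u : ℂˣ) : ℂ), 0; 0, ((u : ℂˣ) : ℂ)⁻¹] := by
  have h1 : chiralRep h (k u) = !![((u : ℂˣ) : ℂ), 0; 0, ((u : ℂˣ) : ℂ)⁻¹] := lift_gen _ _ _
  have h2 : chiralRep h (k' v) = 1 := lift_gen _ _ _
  rw [kk, map_mul, h1, h2, mul_one]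

theorem antichiralRep_ep : antichiralRep hs h' ep = 0 := lift_gen _ _ _
theorem antichiralRep_em : antichiralRep hs h' em = 0 := lift_gen _ _ _
theorem antichiralRep_ep' : antichiralRep hs h' ep' = !![0, 0; s, 0] := lift_gen _ _ _
theorem antichiralRep_em' : antichiralRep hs h' em' = !![0, s; 0, 0] := lift_gen _ _ _
theorem antichiralRep_kk (u : P.Γ) (v : P.Γ') :
    antichiralRep hs h' (kk u v) = !![((v : ℂˣ) : ℂ)⁻¹, 0; 0, ((v : ℂˣ) : ℂ)] := by
  have h1 : antichiralRep hs h' (k u) = 1 := lift_gen _ _ _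
  have h2 : antichiralRep hs h' (k' v) = !![((v : ℂˣ) : ℂ)⁻¹, 0; 0, ((v : ℂˣ) : ℂ)] :=
    lift_gen _ _ _
  rw [kk, map_mul, h1, h2, one_mul]

end Reps

/-- Matrix coefficients of a representation, in the convolution algebra of functionals. -/
def coeff (ρ : QUEA P →ₐ[ℂ] Matrix (Fin 2) (Fin 2) ℂ) (i j : Fin 2) :
    WithConv (QUEA P →ₗ[ℂ] ℂ) :=
  WithConv.toConv (Matrix.entryLinearMap ℂ ℂ i j ∘ₗ ρ.toLinearMap)

@[simp] theorem coeff_apply (ρ : QUEA P →ₐ[ℂ] Matrix (Fin 2) (Fin 2) ℂ) (i j : Fin 2) (x : QUEA P) :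
    (coeff ρ i j).ofConv x = ρ x i j := rfl

variable {ρ₁ ρ₂ : QUEA P →ₐ[ℂ] Matrix (Fin 2) (Fin 2) ℂ}

/-- A convolution product of matrix coefficients is a matrix coefficient of `ρ₁ ⊗ ρ₂`, the
enveloping algebra acting through the comultiplication. This is the multiplicativity of that
representation. -/
theorem coeff_mul_mul (i j k l : Fin 2) (x y : QUEA P) :
    (coeff ρ₁ i j * coeff ρ₂ k l).ofConv (x * y) = ∑ m, ∑ n,
      (coeff ρ₁ i m * coeff ρ₂ k n).ofConv x * (coeff ρ₁ m j * coeff ρ₂ n l).ofConv y := by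
  simp only [LinearMap.convMul_apply, Bialgebra.comul_mul]
  generalize Coalgebra.comul (R := ℂ) x = s
  generalize Coalgebra.comul (R := ℂ) y = t
  induction s using TensorProduct.induction_on with
  | zero => simp
  | add a b ha hb =>
    simp only [add_mul, map_add, ha, hb, ← Finset.sum_add_distrib]
  | tmul a b =>
    induction t using TensorProduct.induction_on with
    | zero => simp
    | add c d hc hd => simp only [mul_add, map_add, hc, hd, ← Finset.sum_add_distrib]
    | tmul c d =>
      simp [Matrix.mul_apply, Fin.sum_univ_two]
      ring

theorem coeff_mul_algebraMap (i j k l : Fin 2) (z : ℂ) :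
    (coeff ρ₁ i j * coeff ρ₂ k l).ofConv (algebraMap ℂ _ z) =
      z * (1 : Matrix (Fin 2) (Fin 2) ℂ) i j * (1 : Matrix (Fin 2) (Fin 2) ℂ) k l := by
  simp [LinearMap.convMul_apply, Algebra.TensorProduct.one_def, Algebra.algebraMap_eq_smul_one,
    mul_assoc]

/-- If a vector of the tensor product of two representations is invariant under generators, it is
invariant. -/
theorem coeff_mul_vec (v : Fin 2 → Fin 2 → ℂ)
    (h : ∀ x ∈ Set.range (gen (P := P)), ∀ i k,
      ∑ j, ∑ l, (coeff ρ₁ i j * coeff ρ₂ k l).ofConv x * v j l = counitHom x * v i k)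
    (x : QUEA P) (i k : Fin 2) :
    ∑ j, ∑ l, (coeff ρ₁ i j * coeff ρ₂ k l).ofConv x * v j l = counitHom x * v i k := by
  induction (adjoin_gen P ▸ Algebra.mem_top : x ∈ Algebra.adjoin ℂ (Set.range gen))
    using Algebra.adjoin_induction generalizing i k with
  | mem x hx => exact h x hx i k
  | algebraMap z =>
    simp only [coeff_mul_algebraMap, AlgHom.commutes]
    revert i k
    simp [Fin.forall_fin_two, Fin.sum_univ_two]
  | add x y _ _ hx hy =>
    simp only [map_add, add_mul, Finset.sum_add_distrib, hx, hy]
  | mul x y _ _ hx hy =>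
    rw [map_mul, mul_right_comm, ← hx, Finset.sum_mul]
    simp only [Finset.sum_mul, mul_right_comm _ (v _ _), mul_assoc, ← hy,
      coeff_mul_mul]
    simp only [Fin.sum_univ_two]
    ring

/-- Dual form of `coeff_mul_vec`: invariant functionals on the tensor product, that is, row vectors
instead of columns. -/
theorem coeff_vec_mul (v : Fin 2 → Fin 2 → ℂ)
    (h : ∀ x ∈ Set.range (gen (P := P)), ∀ j l,
      ∑ i, ∑ k, v i k * (coeff ρ₁ i j * coeff ρ₂ k l).ofConv x = counitHom x * v j l)
    (x : QUEA P) (j l : Fin 2) :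
    ∑ i, ∑ k, v i k * (coeff ρ₁ i j * coeff ρ₂ k l).ofConv x = counitHom x * v j l := by
  induction (adjoin_gen P ▸ Algebra.mem_top : x ∈ Algebra.adjoin ℂ (Set.range gen))
    using Algebra.adjoin_induction generalizing j l with
  | mem x hx => exact h x hx j l
  | algebraMap z =>
    simp only [coeff_mul_algebraMap, AlgHom.commutes]
    revert j l
    simp [Fin.forall_fin_two, Fin.sum_univ_two, mul_comm]
  | add x y _ _ hx hy =>
    simp only [map_add, add_mul, mul_add, Finset.sum_add_distrib, hx, hy]
  | mul x y _ _ hx hy =>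
    rw [map_mul, mul_assoc, ← hy, Finset.mul_sum]
    simp only [Finset.mul_sum, ← mul_assoc, ← hx, coeff_mul_mul]
    simp only [Fin.sum_univ_two]
    ring

/-- The identity says that the diagonal operator with entries `D`, combined with the flip of the
factors, intertwines `ρ₁ ⊗ ρ₂` and `ρ₂ ⊗ ρ₁`. Intertwining passes to sums and products of algebra
elements. -/
theorem coeff_intertwine (D : Fin 2 → Fin 2 → ℂ)
    (h : ∀ x ∈ Set.range (gen (P := P)), ∀ i j k l,
      (coeff ρ₁ i j * coeff ρ₂ k l).ofConv x * D j l =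
        D i k * (coeff ρ₂ k l * coeff ρ₁ i j).ofConv x) (x : QUEA P) (i j k l : Fin 2) :
    (coeff ρ₁ i j * coeff ρ₂ k l).ofConv x * D j l =
      D i k * (coeff ρ₂ k l * coeff ρ₁ i j).ofConv x := by
  induction (adjoin_gen P ▸ Algebra.mem_top : x ∈ Algebra.adjoin ℂ (Set.range gen))
    using Algebra.adjoin_induction generalizing i j k l with
  | mem x hx => exact h x hx i j k l
  | algebraMap z =>
    simp only [coeff_mul_algebraMap]
    revert i j k l
    simp [Fin.forall_fin_two, mul_comm]
  | add x y _ _ hx hy => simp only [map_add, add_mul, mul_add, hx, hy]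
  | mul x y _ _ hx hy =>
    simp only [coeff_mul_mul, Finset.sum_mul, Finset.mul_sum]
    rw [Finset.sum_comm]
    refine Finset.sum_congr rfl fun n _ => Finset.sum_congr rfl fun m _ => ?_
    rw [mul_assoc, hy, ← mul_assoc, hx, mul_assoc]


section Relations

variable (h : P.q ^ 2 ≠ 1) {s : ℂ} (hs : s * s = 1) (h' : P.q' ^ 2 ≠ 1)

theorem coeff_mul_ep (i j k l : Fin 2) : (coeff ρ₁ i j * coeff ρ₂ k l).ofConv ep =
    ρ₁ ep i j * ρ₂ (kk P.gq P.gl') k l + ρ₁ (kk P.gq⁻¹ P.gl'⁻¹) i j * ρ₂ ep k l := by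
  rw [LinearMap.convMul_apply, comul_ep]; simp
theorem coeff_mul_em (i j k l : Fin 2) : (coeff ρ₁ i j * coeff ρ₂ k l).ofConv em =
    ρ₁ em i j * ρ₂ (kk P.gq P.gl'⁻¹) k l + ρ₁ (kk P.gq⁻¹ P.gl') i j * ρ₂ em k l := by
  rw [LinearMap.convMul_apply, comul_em]; simp
theorem coeff_mul_ep' (i j k l : Fin 2) : (coeff ρ₁ i j * coeff ρ₂ k l).ofConv ep' =
    ρ₁ ep' i j * ρ₂ (kk P.gl⁻¹ P.gq') k l + ρ₁ (kk P.gl P.gq'⁻¹) i j * ρ₂ ep' k l := by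
  rw [LinearMap.convMul_apply, comul_ep']; simp
theorem coeff_mul_em' (i j k l : Fin 2) : (coeff ρ₁ i j * coeff ρ₂ k l).ofConv em' =
    ρ₁ em' i j * ρ₂ (kk P.gl P.gq') k l + ρ₁ (kk P.gl⁻¹ P.gq'⁻¹) i j * ρ₂ em' k l := by
  rw [LinearMap.convMul_apply, comul_em']; simp
theorem coeff_mul_kk (i j k l : Fin 2) (u : P.Γ) (v : P.Γ') :
    (coeff ρ₁ i j * coeff ρ₂ k l).ofConv (kk u v) = ρ₁ (kk u v) i j * ρ₂ (kk u v) k l := by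
  rw [LinearMap.convMul_apply, comul_kk]; simp

theorem counitHom_kk (u : P.Γ) (v : P.Γ') : counitHom (kk u v) = 1 := counit_kk u v

theorem coe_gq_sq : ((P.gq : ℂˣ) : ℂ) ^ 2 = P.q := rfl

/-- The vector `e₁ ⊗ e₂ - z e₂ ⊗ e₁`. -/
def detVec (z : ℂ) : Fin 2 → Fin 2 → ℂ := ![![0, 1], ![-z, 0]]

/-- Invariance of the q-determinant vector under the tensor square. Its four entries are `ab = q⁻¹
ba`, `cd = q⁻¹ dc`, `ad - q⁻¹ bc = 1` and `cb - q⁻¹ da = -q⁻¹` for the matrix coefficients. -/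
theorem chiral_mul_vec (x : QUEA P) (i k : Fin 2) :
    ∑ j, ∑ l, (coeff (chiralRep h) i j * coeff (chiralRep h) k l).ofConv x * detVec P.q⁻¹ j l =
      counitHom x * detVec P.q⁻¹ i k := by
  refine coeff_mul_vec _ (forall_gen ?_ ?_ ?_ ?_ ?_) x i k
  all_goals
    try intro (u : P.Γ) (v : P.Γ')
    simp [-LinearMap.convMul_apply, Fin.sum_univ_two, Fin.forall_fin_two, coeff_mul_ep,
      coeff_mul_em, coeff_mul_ep', coeff_mul_em', coeff_mul_kk, chiralRep_ep, chiralRep_em, chiralRep_ep', chiralRep_em',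
      chiralRep_kk, counitHom_ep, counitHom_em, counitHom_ep', counitHom_em', counitHom_kk, detVec,
      ← coe_gq_sq]
  all_goals
    have := (P.gq : ℂˣ).ne_zero
    field_simp
    ring

/-- The same vector read as a row. It gives the relations between different rows of the matrix, `ac
= q⁻¹ ca` and `bd = q⁻¹ db`, and also `bc - q⁻¹ da = -q⁻¹`, whose comparison with the column version
yields `bc = cb`. -/
theorem chiral_vec_mul (x : QUEA P) (j l : Fin 2) :
    ∑ i, ∑ k, detVec P.q⁻¹ i k * (coeff (chiralRep h) i j * coeff (chiralRep h) k l).ofConv x =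
      counitHom x * detVec P.q⁻¹ j l := by
  refine coeff_vec_mul _ (forall_gen ?_ ?_ ?_ ?_ ?_) x j l
  all_goals
    try intro (u : P.Γ) (v : P.Γ')
    simp [-LinearMap.convMul_apply, Fin.sum_univ_two, Fin.forall_fin_two, coeff_mul_ep,
      coeff_mul_em, coeff_mul_ep', coeff_mul_em', coeff_mul_kk, chiralRep_ep, chiralRep_em, chiralRep_ep', chiralRep_em',
      chiralRep_kk, counitHom_ep, counitHom_em, counitHom_ep', counitHom_em', counitHom_kk, detVec,
      ← coe_gq_sq]
  all_goals
    have := (P.gq : ℂˣ).ne_zero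
    field_simp
    ring

theorem antichiral_mul_vec (x : QUEA P) (i k : Fin 2) :
    ∑ j, ∑ l, (coeff (antichiralRep hs h') i j * coeff (antichiralRep hs h') k l).ofConv x *
      detVec P.q' j l = counitHom x * detVec P.q' i k := by
  refine coeff_mul_vec _ (forall_gen ?_ ?_ ?_ ?_ ?_) x i k
  all_goals
    try intro (u : P.Γ) (v : P.Γ')
    simp [-LinearMap.convMul_apply, Fin.sum_univ_two, Fin.forall_fin_two, coeff_mul_ep,
      coeff_mul_em, coeff_mul_ep', coeff_mul_em', coeff_mul_kk, antichiralRep_ep, antichiralRep_em, antichiralRep_ep',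
      antichiralRep_em', antichiralRep_kk, counitHom_ep, counitHom_em, counitHom_ep',
      counitHom_em', counitHom_kk, detVec, ← coe_gq']
  all_goals
    have := (P.gq' : ℂˣ).ne_zero
    field_simp
    ring

theorem antichiral_vec_mul (x : QUEA P) (j l : Fin 2) :
    ∑ i, ∑ k, detVec P.q' i k *
      (coeff (antichiralRep hs h') i j * coeff (antichiralRep hs h') k l).ofConv x =
      counitHom x * detVec P.q' j l := by
  refine coeff_vec_mul _ (forall_gen ?_ ?_ ?_ ?_ ?_) x j l
  all_goals
    try intro (u : P.Γ) (v : P.Γ')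
    simp [-LinearMap.convMul_apply, Fin.sum_univ_two, Fin.forall_fin_two, coeff_mul_ep,
      coeff_mul_em, coeff_mul_ep', coeff_mul_em', coeff_mul_kk, antichiralRep_ep, antichiralRep_em, antichiralRep_ep',
      antichiralRep_em', antichiralRep_kk, counitHom_ep, counitHom_em, counitHom_ep',
      counitHom_em', counitHom_kk, detVec, ← coe_gq']
  all_goals
    have := (P.gq' : ℂˣ).ne_zero
    field_simp
    ring

/-- The diagonal matrix intertwining the two orders of the tensor product of the representations
of the two sectors. -/
def linkDiag (z : ℂ) : Fin 2 → Fin 2 → ℂ := ![![1, z], ![z, 1]]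

theorem coe_gl : ((P.gl : ℂˣ) : ℂ) ^ 2 = P.l := rfl

theorem coe_gl' : ((P.gl' : ℂˣ) : ℂ) = ((P.gl : ℂˣ) : ℂ) := rfl

/-- The legs `ℓ^{±h'}` and `ℓ^{∓h}` in the comultiplication act diagonally on the representation of
the opposite sector. Exchanging the two tensor factors therefore costs only a diagonal matrix, and
each choice of indices gives one link relation. -/
theorem link_intertwine (x : QUEA P) (i j k l : Fin 2) :
    (coeff (chiralRep h) i j * coeff (antichiralRep hs h') k l).ofConv x * linkDiag P.l j l =
      linkDiag P.l i k * (coeff (antichiralRep hs h') k l * coeff (chiralRep h) i j).ofConv x := by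
  refine coeff_intertwine _ (forall_gen ?_ ?_ ?_ ?_ ?_) x i j k l
  all_goals
    try intro (u : P.Γ) (v : P.Γ')
    simp [-LinearMap.convMul_apply, Fin.forall_fin_two, coeff_mul_ep, coeff_mul_em, coeff_mul_ep',
      coeff_mul_em', coeff_mul_kk, chiralRep_ep, chiralRep_em, chiralRep_ep', chiralRep_em',
      chiralRep_kk, antichiralRep_ep, antichiralRep_em, antichiralRep_ep',
      antichiralRep_em', antichiralRep_kk, linkDiag, ← coe_gl, coe_gl']
  all_goals
    have := (P.gl : ℂˣ).ne_zero
    (repeat' apply And.intro) <;> field_simp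

/-- Matrix coefficients of the two representations, indexed by the generators of the function
algebra. -/
def coeffGen : QFAGen → WithConv (QUEA P →ₗ[ℂ] ℂ)
  | .a => coeff (chiralRep h) 0 0
  | .b => coeff (chiralRep h) 0 1
  | .c => coeff (chiralRep h) 1 0
  | .d => coeff (chiralRep h) 1 1
  | .a' => coeff (antichiralRep hs h') 0 0
  | .b' => coeff (antichiralRep hs h') 0 1
  | .c' => coeff (antichiralRep hs h') 1 0
  | .d' => coeff (antichiralRep hs h') 1 1

/-- Every defining relation of the function algebra is an entry of one of the invariance or
intertwining identities, or a combination of two of them. -/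
theorem coeffGen_rel ⦃f g : FreeAlgebra ℂ QFAGen⦄ (hfg : QFARel P f g) :
    FreeAlgebra.lift ℂ (coeffGen h hs h') f = FreeAlgebra.lift ℂ (coeffGen h hs h') g := by
  have hq := mul_inv_cancel₀ P.q_ne
  have hq' := mul_inv_cancel₀ P.q'_ne
  have r00 := fun x => chiral_mul_vec h x 0 0
  have r01 := fun x => chiral_mul_vec h x 0 1
  have r11 := fun x => chiral_mul_vec h x 1 1
  have r10 := fun x => chiral_mul_vec h x 1 0
  have c00 := fun x => chiral_vec_mul h x 0 0
  have c11 := fun x => chiral_vec_mul h x 1 1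
  have c10 := fun x => chiral_vec_mul h x 1 0
  have r00' := fun x => antichiral_mul_vec hs h' x 0 0
  have r01' := fun x => antichiral_mul_vec hs h' x 0 1
  have r11' := fun x => antichiral_mul_vec hs h' x 1 1
  have r10' := fun x => antichiral_mul_vec hs h' x 1 0
  have c00' := fun x => antichiral_vec_mul hs h' x 0 0
  have c11' := fun x => antichiral_vec_mul hs h' x 1 1
  have c10' := fun x => antichiral_vec_mul hs h' x 1 0
  have hl := link_intertwine h hs h'
  have one : ∀ x : QUEA P, (1 : WithConv (QUEA P →ₗ[ℂ] ℂ)).ofConv x = counitHom x := fun x => rfl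
  simp [-LinearMap.convMul_apply, Fin.sum_univ_two, detVec] at r00 r01 r11 r10 c00 c11 c10
  simp [-LinearMap.convMul_apply, Fin.sum_univ_two, detVec] at r00' r01' r11' r10' c00' c11' c10'
  cases hfg <;>
    simp only [map_mul, map_smul, map_sub, map_one, FreeAlgebra.lift_ι_apply, coeffGen] <;>
    refine WithConv.ext (LinearMap.ext fun x => ?_) <;>
    try simp [-LinearMap.convMul_apply, one, -LinearMap.convOne_apply]
  case ab => linear_combination r00 x
  case ac => linear_combination c00 x
  case bd => linear_combination c11 x
  case cd => linear_combination r11 x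
  -- The sum of `ad - q⁻¹ bc = 1` and `q` times `bc - q⁻¹ da = -q⁻¹`. The last term clears `q q⁻¹`.
  case ad => linear_combination r01 x + P.q * c10 x +
    ((coeff (chiralRep h) 1 1 * coeff (chiralRep h) 0 0).ofConv x - counitHom x) * hq
  case bc => linear_combination c10 x - r10 x
  case det => linear_combination r01 x
  case ab' => linear_combination r00' x
  case ac' => linear_combination c00' x
  case bd' => linear_combination c11' x
  case cd' => linear_combination r11' x
  case ad' => linear_combination r01' x + P.q'⁻¹ * c10' x +
    ((coeff (antichiralRep hs h') 1 1 * coeff (antichiralRep hs h') 0 0).ofConv x -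
      counitHom x) * hq'
  case bc' => linear_combination c10' x - r10' x
  case det' => linear_combination r01' x
  case link_ba =>
    have := hl x 0 0 0 1
    simp [-LinearMap.convMul_apply, linkDiag] at this
    linear_combination -this
  case link_ac =>
    have := hl x 0 0 1 0
    simp [-LinearMap.convMul_apply, linkDiag] at this
    linear_combination this
  case link_ab =>
    have := hl x 0 1 0 0
    simp [-LinearMap.convMul_apply, linkDiag] at this
    linear_combination -this
  case link_bd =>
    have := hl x 0 1 1 1
    simp [-LinearMap.convMul_apply, linkDiag] at this
    linear_combination this
  case link_ca =>
    have := hl x 1 0 0 0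
    simp [-LinearMap.convMul_apply, linkDiag] at this
    linear_combination this
  case link_dc =>
    have := hl x 1 0 1 1
    simp [-LinearMap.convMul_apply, linkDiag] at this
    linear_combination -this
  case link_db =>
    have := hl x 1 1 0 1
    simp [-LinearMap.convMul_apply, linkDiag] at this
    linear_combination this
  case link_cd =>
    have := hl x 1 1 1 0
    simp [-LinearMap.convMul_apply, linkDiag] at this
    linear_combination -this
  -- The remaining relations carry no scalar, but four of them come from entries where `linkDiag`
  -- equals `ℓ` on both sides. Multiplying by `ℓ` treats all of them alike.
  all_goals refine mul_left_cancel₀ P.l_ne ?_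
  case link_aa =>
    have := hl x 0 0 0 0
    simp [-LinearMap.convMul_apply, linkDiag] at this
    linear_combination P.l * this
  case link_ad =>
    have := hl x 0 0 1 1
    simp [-LinearMap.convMul_apply, linkDiag] at this
    linear_combination this
  case link_bb =>
    have := hl x 0 1 0 1
    simp [-LinearMap.convMul_apply, linkDiag] at this
    linear_combination P.l * this
  case link_bc =>
    have := hl x 0 1 1 0
    simp [-LinearMap.convMul_apply, linkDiag] at this
    linear_combination this
  case link_cb =>
    have := hl x 1 0 0 1
    simp [-LinearMap.convMul_apply, linkDiag] at this
    linear_combination this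
  case link_cc =>
    have := hl x 1 0 1 0
    simp [-LinearMap.convMul_apply, linkDiag] at this
    linear_combination P.l * this
  case link_da =>
    have := hl x 1 1 0 0
    simp [-LinearMap.convMul_apply, linkDiag] at this
    linear_combination this
  case link_dd =>
    have := hl x 1 1 1 1
    simp [-LinearMap.convMul_apply, linkDiag] at this
    linear_combination P.l * this

end Relations

end QUEA

/-! ### The pairing as an algebra map into the convolution algebra -/

namespace LinkParams

variable {P : LinkParams} (h : P.q ^ 2 ≠ 1) {s : ℂ} (hs : s * s = 1) (h' : P.q' ^ 2 ≠ 1)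

/-- The functionals defined by elements of the function algebra, as an algebra map to the
convolution algebra. -/
def pairingHom : QFA P →ₐ[ℂ] WithConv (QUEA P →ₗ[ℂ] ℂ) :=
  QFA.lift (QUEA.coeffGen h hs h') (QUEA.coeffGen_rel h hs h')

/-- The pairing between the enveloping algebra and the function algebra. -/
def pairing : QUEA P →ₗ[ℂ] QFA P →ₗ[ℂ] ℂ :=
  ((WithConv.linearEquiv ℂ (QUEA P →ₗ[ℂ] ℂ)).toLinearMap ∘ₗ (pairingHom h hs h').toLinearMap).flip

theorem pairing_apply (x : QUEA P) (f : QFA P) :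
    pairing h hs h' x f = (pairingHom h hs h' f).ofConv x := rfl

theorem pairing_gen (x : QUEA P) (g : QFAGen) :
    pairing h hs h' x (QFA.gen g) = (QUEA.coeffGen h hs h' g).ofConv x := by
  rw [pairing_apply, pairingHom, QFA.lift_gen]

theorem pairing_one_right (x : QUEA P) :
    pairing h hs h' x 1 = Coalgebra.counit (R := ℂ) x := by
  rw [pairing_apply, map_one]
  rfl

/-- The definition of the convolution product, since `pairingHom` is multiplicative. -/
theorem pairing_mul_right (x : QUEA P) (f g : QFA P) : pairing h hs h' x (f * g) =
    tensorPairing (pairing h hs h') (Coalgebra.comul (R := ℂ) x) (f ⊗ₜ g) := by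
  rw [pairing_apply, map_mul, LinearMap.convMul_apply]
  induction Coalgebra.comul (R := ℂ) x using TensorProduct.induction_on with
  | zero => simp
  | add s t hs ht => simp only [map_add, LinearMap.add_apply, hs, ht]
  | tmul y z => simp [pairing_apply]

/-- On a generator this is multiplicativity of the two representations. `pairing_mul_left_mul`
carries it to products. -/
theorem pairing_mul_left (x y : QUEA P) (f : QFA P) : pairing h hs h' (x * y) f =
    tensorPairing (pairing h hs h') (x ⊗ₜ y) (Coalgebra.comul (R := ℂ) f) := by
  induction f using QFA.induction generalizing x y with
  | h0 z =>
    simp [Algebra.algebraMap_eq_smul_one, pairing_one_right, Algebra.TensorProduct.one_def]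
  | h1 g =>
    rw [QFA.comul_gen]
    cases g <;>
      simp [QFA.comulGen, QFA.a, QFA.b, QFA.c, QFA.d, QFA.a', QFA.b', QFA.c', QFA.d',
        pairing_gen, QUEA.coeffGen, Matrix.mul_apply, Fin.sum_univ_two]
  | hm f g hf hg => exact pairing_mul_left_mul (pairing_mul_right h hs h') hf hg x y
  | ha f g hf hg => rw [map_add, map_add, map_add, hf, hg]

theorem pairing_one_left (f : QFA P) : pairing h hs h' 1 f = Coalgebra.counit (R := ℂ) f := by
  induction f using QFA.induction with
  | h0 z => simp [Algebra.algebraMap_eq_smul_one, pairing_one_right]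
  | h1 g =>
    rw [QFA.counit_gen]
    cases g <;> simp [pairing_gen, QUEA.coeffGen, QFA.counitGen]
  | hm f g hf hg =>
    rw [pairing_mul_right, Bialgebra.comul_one, Algebra.TensorProduct.one_def, tensorPairing_tmul,
      hf, hg, Bialgebra.counit_mul]
  | ha f g hf hg => rw [map_add, map_add, hf, hg]

theorem pairing_antipode_gen (x : QUEA P) (g : QFAGen) :
    pairing h hs h' (HopfAlgebra.antipode ℂ x) (QFA.gen g) =
      pairing h hs h' x (HopfAlgebra.antipode ℂ (QFA.gen g)) := by
  have hqq : ((P.gq : ℂˣ) : ℂ) ^ 2 = P.q := rfl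
  have hq := P.q_ne
  have hq' := P.q'_ne
  have e : (HopfAlgebra.antipode ℂ (QFA.gen g : QFA P)) = (QFA.antipodeGen g).unop :=
    QFA.antipode_gen g
  induction (QUEA.adjoin_gen P ▸ Algebra.mem_top : x ∈ Algebra.adjoin ℂ (Set.range QUEA.gen))
    using Algebra.adjoin_induction generalizing g with
  | mem x hx =>
    rw [e]
    clear e
    revert x
    refine QUEA.forall_gen ?_ ?_ ?_ ?_ ?_
    all_goals
      try intro (u : P.Γ) (v : P.Γ')
      cases g <;>
      simp [QFA.antipodeGen, QFA.a, QFA.b, QFA.c, QFA.d, QFA.a', QFA.b', QFA.c', QFA.d',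
        pairing_gen, QUEA.coeffGen, QUEA.hopfAntipode_ep, QUEA.hopfAntipode_em,
        QUEA.hopfAntipode_ep', QUEA.hopfAntipode_em', QUEA.hopfAntipode_kk, QUEA.chiralRep_ep,
        QUEA.chiralRep_em, QUEA.chiralRep_ep', QUEA.chiralRep_em', QUEA.chiralRep_kk,
        QUEA.antichiralRep_ep, QUEA.antichiralRep_em, QUEA.antichiralRep_ep',
        QUEA.antichiralRep_em', QUEA.antichiralRep_kk]
  | algebraMap z =>
    rw [Algebra.algebraMap_eq_smul_one, map_smul, HopfAlgebra.antipode_one, map_smul,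
      LinearMap.smul_apply, LinearMap.smul_apply, pairing_one_left, pairing_one_left,
      HopfAlgebra.counit_antipode]
  | add x y _ _ hx hy =>
    rw [map_add, map_add, map_add, LinearMap.add_apply, LinearMap.add_apply, hx _ e, hy _ e]
  | mul x y _ _ hx hy =>
    have e1 := fun g => hx g (QFA.antipode_gen g)
    have e2 := fun g => hy g (QFA.antipode_gen g)
    have key : ∀ g : QFAGen, HopfAlgebra.antipode ℂ (QFA.gen g : QFA P) =
      (QFA.antipodeGen g).unop := fun g => QFA.antipode_gen g
    -- The antipode of the function algebra reverses the matrix comultiplication as that of the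
    -- enveloping algebra reverses products. The agreement is verified on each matrix entry.
    rw [HopfAlgebra.antipode_mul_antidistrib, pairing_mul_left, QFA.comul_gen]
    rw [e]
    cases g <;>
    simp [QFA.comulGen, QFA.a, QFA.b, QFA.c, QFA.d, QFA.a', QFA.b', QFA.c', QFA.d',
      QFA.antipodeGen, e1, e2, key, pairing_mul_left, QFA.comul_gen] <;>
    field_simp <;> ring

theorem isHopfPairing_pairing : IsHopfPairing (pairing h hs h') where
  mul_left := pairing_mul_left h hs h'
  mul_right := pairing_mul_right h hs h'
  one_left := pairing_one_left h hs h'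
  one_right := pairing_one_right h hs h'
  antipode x f := by
    induction f using QFA.induction generalizing x with
    | h0 z =>
      simp [Algebra.algebraMap_eq_smul_one, pairing_one_right]
    | h1 g => exact pairing_antipode_gen h hs h' x g
    | hm f g hf hg =>
      -- Reversal of products on one side is matched by reversal of the comultiplication on the
      -- other.
      rw [pairing_mul_right, HopfAlgebra.antipode_mul_antidistrib, pairing_mul_right,
        QUEA.comul_antipode]
      induction Coalgebra.comul (R := ℂ) x using TensorProduct.induction_on with
      | zero => simp
      | add s t hs ht => simp only [map_add, LinearMap.add_apply, hs, ht]
      | tmul y z => simp [hf, hg, mul_comm]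
    | ha f g hf hg => simp only [map_add, hf, hg]

theorem hasPairingTable_pairing {σ : ℤˣ} (hσ : ((σ : ℤ) : ℂ) * ((σ : ℤ) : ℂ) = 1) :
    HasPairingTable σ (pairing h hσ h') := by
  have hc : ∀ x, chiralMatrix (pairing h hσ h') x = QUEA.chiralRep h x := fun x => by
    ext i j
    fin_cases i <;> fin_cases j <;>
      simp [chiralMatrix, QFA.a, QFA.b, QFA.c, QFA.d, pairing_gen, QUEA.coeffGen]
  have ha : ∀ x, antichiralMatrix (pairing h hσ h') x = QUEA.antichiralRep hσ h' x := fun x => by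
    ext i j
    fin_cases i <;> fin_cases j <;>
      simp [antichiralMatrix, QFA.a', QFA.b', QFA.c', QFA.d', pairing_gen, QUEA.coeffGen]
  constructor
  all_goals
    simp only [hc, ha, QUEA.qh, QUEA.lh, QUEA.qh', QUEA.lh', QUEA.k_eq_kk, QUEA.k'_eq_kk,
      QUEA.chiralRep_ep, QUEA.chiralRep_em, QUEA.chiralRep_ep', QUEA.chiralRep_em',
      QUEA.chiralRep_kk, QUEA.antichiralRep_ep, QUEA.antichiralRep_em, QUEA.antichiralRep_ep',
      QUEA.antichiralRep_em', QUEA.antichiralRep_kk]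
    first | done | rfl | simp [Matrix.one_fin_two]

end LinkParams

/-! ### Skew derivations -/

/-- A skew derivation `D` with respect to the multiplicative maps `α` and `β`. -/
structure IsSkewDerivation {F : Type} [Ring F] [Algebra ℂ F] (D α β : F →ₗ[ℂ] F) : Prop where
  left_one : α 1 = 1
  left_mul : ∀ f g, α (f * g) = α f * α g
  right_one : β 1 = 1
  right_mul : ∀ f g, β (f * g) = β f * β g
  leibniz : ∀ f g, D (f * g) = D f * α g + β f * D g

/-- An eigenvector of `α` and `β` with nonzero eigenvalues that is annihilated by `D`. -/
structure IsNullEigenvector {F : Type} [Ring F] [Algebra ℂ F] (D α β : F →ₗ[ℂ] F) (f : F) :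
    Prop where
  null : D f = 0
  left : ∃ z : ℂ, z ≠ 0 ∧ α f = z • f
  right : ∃ z : ℂ, z ≠ 0 ∧ β f = z • f

namespace IsSkewDerivation

variable {F : Type} [Ring F] [Algebra ℂ F] {D α β : F →ₗ[ℂ] F}

theorem map_one (hD : IsSkewDerivation D α β) : D 1 = 0 := by
  simpa [hD.left_one, hD.right_one] using hD.leibniz 1 1

theorem null_one (hD : IsSkewDerivation D α β) : IsNullEigenvector D α β 1 where
  null := hD.map_one
  left := ⟨1, one_ne_zero, by rw [hD.left_one, one_smul]⟩
  right := ⟨1, one_ne_zero, by rw [hD.right_one, one_smul]⟩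

theorem null_mul (hD : IsSkewDerivation D α β) {f g : F} (hf : IsNullEigenvector D α β f)
    (hg : IsNullEigenvector D α β g) : IsNullEigenvector D α β (f * g) where
  null := by rw [hD.leibniz, hf.null, hg.null, zero_mul, mul_zero, add_zero]
  left := by
    obtain ⟨x, hx, ex⟩ := hf.left
    obtain ⟨y, hy, ey⟩ := hg.left
    exact ⟨x * y, mul_ne_zero hx hy, by rw [hD.left_mul, ex, ey, smul_mul_smul_comm]⟩
  right := by
    obtain ⟨x, hx, ex⟩ := hf.right
    obtain ⟨y, hy, ey⟩ := hg.right
    exact ⟨x * y, mul_ne_zero hx hy, by rw [hD.right_mul, ex, ey, smul_mul_smul_comm]⟩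

/-- By the Leibniz rule, the term in which `D` hits a factor `p` with `k` factors to its right
acquires `g^k` from the right, `g⁻¹^(J-k)` from the left and `l^k` from moving `t` to the end, in
total `g⁻¹^J (g² l)^k`. The sum is a q-integer up to a power of `g`. -/
theorem map_pow_succ (hD : IsSkewDerivation D α β) {p t : F} {τ g l : ℂ} (hg : g ≠ 0)
    (hp : D p = τ • t) (hα : α p = g • p) (hβ : β p = g⁻¹ • p) (htp : t * p = l • (p * t)) (J : ℕ) :
    D (p ^ (J + 1)) =
      (τ * (g⁻¹) ^ J * ∑ k ∈ Finset.range (J + 1), (g ^ 2 * l) ^ k) • (p ^ J * t) := by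
  have hβJ : ∀ n : ℕ, β (p ^ n) = (g⁻¹) ^ n • p ^ n := fun n => by
    induction n with
    | zero => simp [hD.right_one]
    | succ n ih => rw [pow_succ, hD.right_mul, ih, hβ, smul_mul_smul_comm, ← pow_succ, ← pow_succ]
  induction J with
  | zero => simp [hp]
  | succ J ih =>
    rw [pow_succ p (J + 1), hD.leibniz, ih, hα, hp, hβJ, smul_mul_smul_comm, mul_assoc (p ^ J), htp,
      mul_smul_comm, ← mul_assoc, ← pow_succ, smul_smul, smul_mul_smul_comm, ← add_smul,
      Finset.sum_range_succ' _ (J + 1)]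
    congr 1
    simp only [pow_succ (g ^ 2 * l), ← Finset.sum_mul, pow_succ (g⁻¹), pow_zero]
    linear_combination (-τ * g⁻¹ ^ J * (∑ k ∈ Finset.range (J + 1), (g ^ 2 * l) ^ k) * l * g) *
      inv_mul_cancel₀ hg

/-- The lowering property of a skew derivation: up to a nonzero factor it replaces one factor `p`
by a factor `t`. -/
theorem exists_lowering (hD : IsSkewDerivation D α β) {p t : F} {τ g l : ℂ} (hτ : τ ≠ 0)
    (hg : g ≠ 0) (hp : D p = τ • t) (hα : α p = g • p) (hβ : β p = g⁻¹ • p)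
    (htp : t * p = l • (p * t)) (hl : ∀ n : ℕ, 0 < n → (g ^ 2 * l) ^ n ≠ 1) {A C : F}
    (hA : IsNullEigenvector D α β A) (hC : IsNullEigenvector D α β C) (J : ℕ) :
    ∃ z : ℂ, z ≠ 0 ∧ D (A * p ^ (J + 1) * C) = z • (A * p ^ J * t * C) := by
  obtain ⟨x, hx, ex⟩ := hA.right
  obtain ⟨y, hy, ey⟩ := hC.left
  -- A vanishing geometric sum would make `g² l` a root of unity of order dividing `J + 1`.
  have hs : ∑ k ∈ Finset.range (J + 1), (g ^ 2 * l) ^ k ≠ 0 := fun h0 => by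
    have := geom_sum_mul (g ^ 2 * l) (J + 1)
    rw [h0, zero_mul] at this
    exact hl _ J.succ_pos (sub_eq_zero.mp this.symm)
  refine ⟨x * (τ * (g⁻¹) ^ J * ∑ k ∈ Finset.range (J + 1), (g ^ 2 * l) ^ k) * y,
    mul_ne_zero (mul_ne_zero hx (mul_ne_zero (mul_ne_zero hτ (pow_ne_zero _ (inv_ne_zero hg))) hs))
      hy, ?_⟩
  rw [hD.leibniz, hC.null, mul_zero, add_zero, hD.leibniz, hA.null, zero_mul, zero_add, ex, ey,
    hD.map_pow_succ hg hp hα hβ htp, smul_mul_smul_comm, smul_mul_smul_comm]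
  simp only [mul_assoc]

end IsSkewDerivation

/-- Iterating a lowering operator on a family. -/
theorem iterate_lowering {F : Type} [AddCommGroup F] [Module ℂ F] {D : F →ₗ[ℂ] F}
    {m : ℕ → ℕ → F} (h0 : ∀ N, D (m 0 N) = 0)
    (h1 : ∀ J N, ∃ z : ℂ, z ≠ 0 ∧ D (m (J + 1) N) = z • m J (N + 1)) (n J N : ℕ) :
    ∃ z : ℂ, z ≠ 0 ∧ (D ^ n) (m J N) = if n ≤ J then z • m (J - n) (N + n) else 0 := by
  induction n generalizing J N with
  | zero => exact ⟨1, one_ne_zero, by simp⟩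
  | succ n ih =>
    cases J with
    -- Nothing is left to lower: the result is zero and the constant is irrelevant.
    | zero => exact ⟨1, one_ne_zero, by simp [pow_succ, h0]⟩
    | succ J =>
      obtain ⟨z, hz, ez⟩ := h1 J N
      obtain ⟨w, hw, ew⟩ := ih J (N + 1)
      refine ⟨z * w, mul_ne_zero hz hw, ?_⟩
      rw [pow_succ, Module.End.mul_apply, ez, map_smul, ew]
      simp only [add_le_add_iff_right, Nat.add_sub_add_right, smul_ite, smul_smul, smul_zero,
        add_assoc, add_comm 1 n]

/-! ### The actions of one algebra on the other -/

section Actions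

variable {H F : Type} [Ring H] [HopfAlgebra ℂ H] [Ring F] [HopfAlgebra ℂ F]
  (B : H →ₗ[ℂ] F →ₗ[ℂ] ℂ)

/-- The left action `f ↦ f₁ ⟨x, f₂⟩`. -/
def leftAct (x : H) : F →ₗ[ℂ] F :=
  (TensorProduct.rid ℂ F).toLinearMap ∘ₗ (B x).lTensor F ∘ₗ Coalgebra.comul

/-- The right action `f ↦ ⟨x, f₁⟩ f₂`. -/
def rightAct (x : H) : F →ₗ[ℂ] F :=
  (TensorProduct.lid ℂ F).toLinearMap ∘ₗ (B x).rTensor F ∘ₗ Coalgebra.comul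

variable {B}

/-- The action is the transpose of right multiplication. Powers of `e_±` can thus be moved out of
the first argument of the pairing and turned into operators on the second. -/
theorem pairing_leftAct (hB : IsHopfPairing B) (x y : H) (f : F) :
    B y (leftAct B x f) = B (y * x) f := by
  rw [hB.mul_left, leftAct, LinearMap.comp_apply, LinearMap.comp_apply]
  induction Coalgebra.comul (R := ℂ) f using TensorProduct.induction_on with
  | zero => simp
  | add s t hs ht => simp only [map_add, hs, ht]
  | tmul f g => simp [mul_comm]

theorem pairing_rightAct (hB : IsHopfPairing B) (x y : H) (f : F) :
    B y (rightAct B x f) = B (x * y) f := by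
  rw [hB.mul_left, rightAct, LinearMap.comp_apply, LinearMap.comp_apply]
  induction Coalgebra.comul (R := ℂ) f using TensorProduct.induction_on with
  | zero => simp
  | add s t hs ht => simp only [map_add, hs, ht]
  | tmul f g => simp

theorem pairing_leftAct_pow (hB : IsHopfPairing B) (x y : H) (f : F) (n : ℕ) :
    B y ((leftAct B x ^ n) f) = B (y * x ^ n) f := by
  induction n generalizing f with
  | zero => simp
  | succ n ih => rw [pow_succ, Module.End.mul_apply, ih, pairing_leftAct hB, pow_succ x, mul_assoc]

theorem pairing_rightAct_pow (hB : IsHopfPairing B) (x y : H) (f : F) (n : ℕ) :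
    B y ((rightAct B x ^ n) f) = B (x ^ n * y) f := by
  induction n generalizing f with
  | zero => simp
  | succ n ih => rw [pow_succ, Module.End.mul_apply, ih, pairing_rightAct hB, pow_succ', mul_assoc]

theorem leftAct_one (hB : IsHopfPairing B) (x : H) :
    leftAct B x 1 = Coalgebra.counit (R := ℂ) x • (1 : F) := by
  simp [leftAct, Algebra.TensorProduct.one_def, hB.one_right]

theorem rightAct_one (hB : IsHopfPairing B) (x : H) :
    rightAct B x 1 = Coalgebra.counit (R := ℂ) x • (1 : F) := by
  simp [rightAct, Algebra.TensorProduct.one_def, hB.one_right]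

theorem leftAct_mul_of_groupLike (hB : IsHopfPairing B) {G : H}
    (hG : Coalgebra.comul (R := ℂ) G = G ⊗ₜ G) (f g : F) :
    leftAct B G (f * g) = leftAct B G f * leftAct B G g := by
  simp only [leftAct, LinearMap.comp_apply, Bialgebra.comul_mul]
  generalize Coalgebra.comul (R := ℂ) f = s
  generalize Coalgebra.comul (R := ℂ) g = t
  induction s using TensorProduct.induction_on with
  | zero => simp
  | add a b ha hb => simp only [add_mul, map_add, ha, hb]
  | tmul a b =>
    induction t using TensorProduct.induction_on with
    | zero => simp
    | add c d hc hd => simp only [mul_add, map_add, hc, hd]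
    | tmul c d => simp [hB.mul_right, hG, smul_smul, mul_comm]

theorem rightAct_mul_of_groupLike (hB : IsHopfPairing B) {G : H}
    (hG : Coalgebra.comul (R := ℂ) G = G ⊗ₜ G) (f g : F) :
    rightAct B G (f * g) = rightAct B G f * rightAct B G g := by
  simp only [rightAct, LinearMap.comp_apply, Bialgebra.comul_mul]
  generalize Coalgebra.comul (R := ℂ) f = s
  generalize Coalgebra.comul (R := ℂ) g = t
  induction s using TensorProduct.induction_on with
  | zero => simp
  | add a b ha hb => simp only [add_mul, map_add, ha, hb]
  | tmul a b =>
    induction t using TensorProduct.induction_on with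
    | zero => simp
    | add c d hc hd => simp only [mul_add, map_add, hc, hd]
    | tmul c d => simp [hB.mul_right, hG, smul_smul, mul_comm]

theorem leftAct_mul_of_skewPrimitive (hB : IsHopfPairing B) {X G G' : H}
    (hX : Coalgebra.comul (R := ℂ) X = X ⊗ₜ G + G' ⊗ₜ X) (f g : F) :
    leftAct B X (f * g) = leftAct B X f * leftAct B G g + leftAct B G' f * leftAct B X g := by
  simp only [leftAct, LinearMap.comp_apply, Bialgebra.comul_mul]
  generalize Coalgebra.comul (R := ℂ) f = s
  generalize Coalgebra.comul (R := ℂ) g = t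
  induction s using TensorProduct.induction_on with
  | zero => simp
  | add a b ha hb => simp only [add_mul, map_add, ha, hb]; abel
  | tmul a b =>
    induction t using TensorProduct.induction_on with
    | zero => simp
    | add c d hc hd => simp only [mul_add, map_add, hc, hd]; abel
    | tmul c d => simp [hB.mul_right, hX, smul_smul, mul_comm, add_smul]

theorem rightAct_mul_of_skewPrimitive (hB : IsHopfPairing B) {X G G' : H}
    (hX : Coalgebra.comul (R := ℂ) X = X ⊗ₜ G + G' ⊗ₜ X) (f g : F) :
    rightAct B X (f * g) = rightAct B X f * rightAct B G g + rightAct B G' f * rightAct B X g := by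
  simp only [rightAct, LinearMap.comp_apply, Bialgebra.comul_mul]
  generalize Coalgebra.comul (R := ℂ) f = s
  generalize Coalgebra.comul (R := ℂ) g = t
  induction s using TensorProduct.induction_on with
  | zero => simp
  | add a b ha hb => simp only [add_mul, map_add, ha, hb]; abel
  | tmul a b =>
    induction t using TensorProduct.induction_on with
    | zero => simp
    | add c d hc hd => simp only [mul_add, map_add, hc, hd]; abel
    | tmul c d => simp [hB.mul_right, hX, smul_smul, mul_comm, add_smul]

theorem isSkewDerivation_leftAct (hB : IsHopfPairing B) {X G G' : H}
    (hG : Coalgebra.comul (R := ℂ) G = G ⊗ₜ G) (hG1 : Coalgebra.counit (R := ℂ) G = (1 : ℂ))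
    (hG' : Coalgebra.comul (R := ℂ) G' = G' ⊗ₜ G') (hG1' : Coalgebra.counit (R := ℂ) G' = (1 : ℂ))
    (hX : Coalgebra.comul (R := ℂ) X = X ⊗ₜ G + G' ⊗ₜ X) :
    IsSkewDerivation (leftAct B X) (leftAct B G) (leftAct B G') where
  left_one := by rw [leftAct_one hB, hG1, one_smul]
  left_mul := leftAct_mul_of_groupLike hB hG
  right_one := by rw [leftAct_one hB, hG1', one_smul]
  right_mul := leftAct_mul_of_groupLike hB hG'
  leibniz := leftAct_mul_of_skewPrimitive hB hX

theorem isSkewDerivation_rightAct (hB : IsHopfPairing B) {X G G' : H}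
    (hG : Coalgebra.comul (R := ℂ) G = G ⊗ₜ G) (hG1 : Coalgebra.counit (R := ℂ) G = (1 : ℂ))
    (hG' : Coalgebra.comul (R := ℂ) G' = G' ⊗ₜ G') (hG1' : Coalgebra.counit (R := ℂ) G' = (1 : ℂ))
    (hX : Coalgebra.comul (R := ℂ) X = X ⊗ₜ G + G' ⊗ₜ X) :
    IsSkewDerivation (rightAct B X) (rightAct B G) (rightAct B G') where
  left_one := by rw [rightAct_one hB, hG1, one_smul]
  left_mul := rightAct_mul_of_groupLike hB hG
  right_one := by rw [rightAct_one hB, hG1', one_smul]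
  right_mul := rightAct_mul_of_groupLike hB hG'
  leibniz := rightAct_mul_of_skewPrimitive hB hX

end Actions

theorem mul_pow_of_qcomm {A : Type} [Ring A] [Algebra ℂ A] {x y : A} {z : ℂ}
    (h : x * y = z • (y * x)) (n : ℕ) : x * y ^ n = z ^ n • (y ^ n * x) := by
  induction n with
  | zero => simp
  | succ n ih =>
    rw [pow_succ, ← mul_assoc, ih, smul_mul_assoc, mul_assoc, h, mul_smul_comm, smul_smul,
      ← mul_assoc, ← pow_succ, pow_succ]

/-! ### Cartan weights and lowering operators on generators -/

namespace QFAGen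

/-- The weights of the left action of the Cartan elements on generators. -/
def leftWeight (x y : ℂ) : QFAGen → ℂ
  | a => x | b => x⁻¹ | c => x | d => x⁻¹
  | a' => y⁻¹ | b' => y | c' => y⁻¹ | d' => y

/-- The weights of the right action of the Cartan elements on generators. -/
def rightWeight (x y : ℂ) : QFAGen → ℂ
  | a => x | b => x | c => x⁻¹ | d => x⁻¹
  | a' => y⁻¹ | b' => y⁻¹ | c' => y | d' => y

theorem leftWeight_ne_zero {x y : ℂ} (hx : x ≠ 0) (hy : y ≠ 0) (g : QFAGen) :
    g.leftWeight x y ≠ 0 := by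
  cases g <;> simp [leftWeight, hx, hy]

theorem rightWeight_ne_zero {x y : ℂ} (hx : x ≠ 0) (hy : y ≠ 0) (g : QFAGen) :
    g.rightWeight x y ≠ 0 := by
  cases g <;> simp [rightWeight, hx, hy]

theorem leftWeight_inv (x y : ℂ) (g : QFAGen) :
    g.leftWeight x⁻¹ y⁻¹ = (g.leftWeight x y)⁻¹ := by
  cases g <;> simp [leftWeight]

theorem rightWeight_inv (x y : ℂ) (g : QFAGen) :
    g.rightWeight x⁻¹ y⁻¹ = (g.rightWeight x y)⁻¹ := by
  cases g <;> simp [rightWeight]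

/-- The diagonal generator `a` or `d`. -/
def top : Bool → QFAGen
  | true => a | false => d

/-- The generator turned into `top s` by a left lowering operator. -/
def lowL : Bool → QFAGen
  | true => b | false => c

/-- The generator turned into `top s` by a right lowering operator. -/
def lowR : Bool → QFAGen
  | true => c | false => b

/-- The antichiral analogue of `top`. -/
def top' : Bool → QFAGen
  | true => a' | false => d'

/-- The antichiral analogue of `lowL`. -/
def lowL' : Bool → QFAGen
  | true => b' | false => c'

/-- The antichiral analogue of `lowR`. -/
def lowR' : Bool → QFAGen
  | true => c' | false => b'

end QFAGen

namespace QUEA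

variable {P : LinkParams}

/-- The element whose left action turns `lowL s` into `top s`. -/
def opL : Bool → QUEA P
  | true => ep | false => em

/-- The element whose right action turns `lowR s` into `top s`. -/
def opR : Bool → QUEA P
  | true => em | false => ep

/-- The antichiral analogue of `opL`. -/
def opL' : Bool → QUEA P
  | true => em' | false => ep'

/-- The antichiral analogue of `opR`. -/
def opR' : Bool → QUEA P
  | true => ep' | false => em'

end QUEA

open QFAGen in
/-- The ordered monomials of the function algebra. -/
def QFA.mono {P : LinkParams} (s s' : Bool) (J K N J' K' N' : ℕ) : QFA P :=
  QFA.gen (lowL s) ^ J * QFA.gen (lowR s) ^ K * QFA.gen (top s) ^ N *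
    (QFA.gen (lowL' s') ^ J' * QFA.gen (lowR' s') ^ K' * QFA.gen (top' s') ^ N')

section Ladder

variable {P : LinkParams} {σ : ℤˣ} {B : QUEA P →ₗ[ℂ] QFA P →ₗ[ℂ] ℂ}

theorem leftAct_gen (x : QUEA P) (g : QFAGen) : leftAct B x (QFA.gen g) = match g with
    | .a => B x QFA.a • QFA.a + B x QFA.c • QFA.b
    | .b => B x QFA.b • QFA.a + B x QFA.d • QFA.b
    | .c => B x QFA.a • QFA.c + B x QFA.c • QFA.d
    | .d => B x QFA.b • QFA.c + B x QFA.d • QFA.d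
    | .a' => B x QFA.a' • QFA.a' + B x QFA.c' • QFA.b'
    | .b' => B x QFA.b' • QFA.a' + B x QFA.d' • QFA.b'
    | .c' => B x QFA.a' • QFA.c' + B x QFA.c' • QFA.d'
    | .d' => B x QFA.b' • QFA.c' + B x QFA.d' • QFA.d' := by
  rw [leftAct, LinearMap.comp_apply, LinearMap.comp_apply, QFA.comul_gen]
  cases g <;> simp [QFA.comulGen]

theorem rightAct_gen (x : QUEA P) (g : QFAGen) : rightAct B x (QFA.gen g) = match g with
    | .a => B x QFA.a • QFA.a + B x QFA.b • QFA.c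
    | .b => B x QFA.a • QFA.b + B x QFA.b • QFA.d
    | .c => B x QFA.c • QFA.a + B x QFA.d • QFA.c
    | .d => B x QFA.c • QFA.b + B x QFA.d • QFA.d
    | .a' => B x QFA.a' • QFA.a' + B x QFA.b' • QFA.c'
    | .b' => B x QFA.a' • QFA.b' + B x QFA.b' • QFA.d'
    | .c' => B x QFA.c' • QFA.a' + B x QFA.d' • QFA.c'
    | .d' => B x QFA.c' • QFA.b' + B x QFA.d' • QFA.d' := by
  rw [rightAct, LinearMap.comp_apply, LinearMap.comp_apply, QFA.comul_gen]
  cases g <;> simp [QFA.comulGen]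

open QFAGen

theorem leftAct_ep_gen (hT : HasPairingTable σ B) (g : QFAGen) :
    leftAct B QUEA.ep (QFA.gen g) = match g with
      | .b => QFA.a | .d => QFA.c | _ => 0 := by
  rw [leftAct_gen]
  cases g <;> simp [QFA.a, QFA.b, QFA.c, QFA.d, QFA.a', QFA.b', QFA.c', QFA.d', hT.ep_gen, epVal]

theorem leftAct_em_gen (hT : HasPairingTable σ B) (g : QFAGen) :
    leftAct B QUEA.em (QFA.gen g) = match g with
      | .a => QFA.b | .c => QFA.d | _ => 0 := by
  rw [leftAct_gen]
  cases g <;> simp [QFA.a, QFA.b, QFA.c, QFA.d, QFA.a', QFA.b', QFA.c', QFA.d', hT.em_gen, emVal]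

theorem leftAct_ep'_gen (hT : HasPairingTable σ B) (g : QFAGen) :
    leftAct B QUEA.ep' (QFA.gen g) = match g with
      | .a' => ((σ : ℤ) : ℂ) • QFA.b' | .c' => ((σ : ℤ) : ℂ) • QFA.d' | _ => 0 := by
  rw [leftAct_gen]
  cases g <;> simp [QFA.a, QFA.b, QFA.c, QFA.d, QFA.a', QFA.b', QFA.c', QFA.d', hT.ep'_gen, epVal']

theorem leftAct_em'_gen (hT : HasPairingTable σ B) (g : QFAGen) :
    leftAct B QUEA.em' (QFA.gen g) = match g with
      | .b' => ((σ : ℤ) : ℂ) • QFA.a' | .d' => ((σ : ℤ) : ℂ) • QFA.c' | _ => 0 := by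
  rw [leftAct_gen]
  cases g <;> simp [QFA.a, QFA.b, QFA.c, QFA.d, QFA.a', QFA.b', QFA.c', QFA.d', hT.em'_gen, emVal']

theorem leftAct_kk_gen (hT : HasPairingTable σ B) (hB : IsHopfPairing B) (u : P.Γ) (v : P.Γ')
    (g : QFAGen) : leftAct B (QUEA.kk u v) (QFA.gen g) =
      g.leftWeight ((u : ℂˣ) : ℂ) ((v : ℂˣ) : ℂ) • QFA.gen g := by
  rw [leftAct_gen]
  cases g <;> simp [QFA.a, QFA.b, QFA.c, QFA.d, QFA.a', QFA.b', QFA.c', QFA.d', hT.kk_gen hB,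
    cartanVal, leftWeight]

theorem rightAct_ep_gen (hT : HasPairingTable σ B) (g : QFAGen) :
    rightAct B QUEA.ep (QFA.gen g) = match g with
      | .a => QFA.c | .b => QFA.d | _ => 0 := by
  rw [rightAct_gen]
  cases g <;> simp [QFA.a, QFA.b, QFA.c, QFA.d, QFA.a', QFA.b', QFA.c', QFA.d', hT.ep_gen, epVal]

theorem rightAct_em_gen (hT : HasPairingTable σ B) (g : QFAGen) :
    rightAct B QUEA.em (QFA.gen g) = match g with
      | .c => QFA.a | .d => QFA.b | _ => 0 := by
  rw [rightAct_gen]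
  cases g <;> simp [QFA.a, QFA.b, QFA.c, QFA.d, QFA.a', QFA.b', QFA.c', QFA.d', hT.em_gen, emVal]

theorem rightAct_ep'_gen (hT : HasPairingTable σ B) (g : QFAGen) :
    rightAct B QUEA.ep' (QFA.gen g) = match g with
      | .c' => ((σ : ℤ) : ℂ) • QFA.a' | .d' => ((σ : ℤ) : ℂ) • QFA.b' | _ => 0 := by
  rw [rightAct_gen]
  cases g <;> simp [QFA.a, QFA.b, QFA.c, QFA.d, QFA.a', QFA.b', QFA.c', QFA.d', hT.ep'_gen, epVal']

theorem rightAct_em'_gen (hT : HasPairingTable σ B) (g : QFAGen) :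
    rightAct B QUEA.em' (QFA.gen g) = match g with
      | .a' => ((σ : ℤ) : ℂ) • QFA.c' | .b' => ((σ : ℤ) : ℂ) • QFA.d' | _ => 0 := by
  rw [rightAct_gen]
  cases g <;> simp [QFA.a, QFA.b, QFA.c, QFA.d, QFA.a', QFA.b', QFA.c', QFA.d', hT.em'_gen, emVal']

theorem rightAct_kk_gen (hT : HasPairingTable σ B) (hB : IsHopfPairing B) (u : P.Γ) (v : P.Γ')
    (g : QFAGen) : rightAct B (QUEA.kk u v) (QFA.gen g) =
      g.rightWeight ((u : ℂˣ) : ℂ) ((v : ℂˣ) : ℂ) • QFA.gen g := by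
  rw [rightAct_gen]
  cases g <;> simp [QFA.a, QFA.b, QFA.c, QFA.d, QFA.a', QFA.b', QFA.c', QFA.d', hT.kk_gen hB,
    cartanVal, rightWeight]

/-- The monoid generated by the generators that `D` annihilates. -/
def nullMonoid (D : QFA P →ₗ[ℂ] QFA P) : Submonoid (QFA P) :=
  Submonoid.closure {f | ∃ g, f = QFA.gen g ∧ D f = 0}

theorem gen_mem_nullMonoid {D : QFA P →ₗ[ℂ] QFA P} {g : QFAGen} (h : D (QFA.gen g) = 0) :
    QFA.gen g ∈ nullMonoid D :=
  Submonoid.subset_closure ⟨g, rfl, h⟩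

/-- Every generator is a weight vector for the Cartan elements with nonzero weight, so on generators
only annihilation has to be assumed. Both properties pass to products. -/
theorem isNullEigenvector_left (hT : HasPairingTable σ B) (hB : IsHopfPairing B) {X : QUEA P}
    {u : P.Γ} {v : P.Γ'} (hX : Coalgebra.comul (R := ℂ) X =
      X ⊗ₜ QUEA.kk u v + QUEA.kk u⁻¹ v⁻¹ ⊗ₜ X) {A : QFA P} (hA : A ∈ nullMonoid (leftAct B X)) :
    IsNullEigenvector (leftAct B X) (leftAct B (QUEA.kk u v)) (leftAct B (QUEA.kk u⁻¹ v⁻¹)) A := by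
  have hD := isSkewDerivation_leftAct hB (QUEA.comul_kk u v) (QUEA.counit_kk u v)
    (QUEA.comul_kk u⁻¹ v⁻¹) (QUEA.counit_kk u⁻¹ v⁻¹) hX
  induction hA using Submonoid.closure_induction with
  | mem f hf =>
    obtain ⟨g, rfl, hg⟩ := hf
    exact ⟨hg, ⟨_, leftWeight_ne_zero (by simp) (by simp) g, leftAct_kk_gen hT hB _ _ g⟩,
      ⟨_, leftWeight_ne_zero (by simp) (by simp) g, leftAct_kk_gen hT hB _ _ g⟩⟩
  | one => exact hD.null_one
  | mul f g _ _ hf hg => exact hD.null_mul hf hg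

theorem isNullEigenvector_right (hT : HasPairingTable σ B) (hB : IsHopfPairing B) {X : QUEA P}
    {u : P.Γ} {v : P.Γ'} (hX : Coalgebra.comul (R := ℂ) X =
      X ⊗ₜ QUEA.kk u v + QUEA.kk u⁻¹ v⁻¹ ⊗ₜ X) {A : QFA P} (hA : A ∈ nullMonoid (rightAct B X)) :
    IsNullEigenvector (rightAct B X) (rightAct B (QUEA.kk u v))
      (rightAct B (QUEA.kk u⁻¹ v⁻¹)) A := by
  have hD := isSkewDerivation_rightAct hB (QUEA.comul_kk u v) (QUEA.counit_kk u v)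
    (QUEA.comul_kk u⁻¹ v⁻¹) (QUEA.counit_kk u⁻¹ v⁻¹) hX
  induction hA using Submonoid.closure_induction with
  | mem f hf =>
    obtain ⟨g, rfl, hg⟩ := hf
    exact ⟨hg, ⟨_, rightWeight_ne_zero (by simp) (by simp) g, rightAct_kk_gen hT hB _ _ g⟩,
      ⟨_, rightWeight_ne_zero (by simp) (by simp) g, rightAct_kk_gen hT hB _ _ g⟩⟩
  | one => exact hD.null_one
  | mul f g _ _ hf hg => exact hD.null_mul hf hg

/-- A skew primitive element that turns `p` into a multiple of `t` lowers the power of `p`. -/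
theorem leftAct_lowering (hT : HasPairingTable σ B) (hB : IsHopfPairing B) {X : QUEA P}
    {u : P.Γ} {v : P.Γ'} (hX : Coalgebra.comul (R := ℂ) X =
      X ⊗ₜ QUEA.kk u v + QUEA.kk u⁻¹ v⁻¹ ⊗ₜ X) {p t : QFAGen} {τ l : ℂ} (hτ : τ ≠ 0)
    (hp : leftAct B X (QFA.gen p) = τ • QFA.gen t)
    (htp : (QFA.gen t * QFA.gen p : QFA P) = l • (QFA.gen p * QFA.gen t))
    (hl : ∀ n : ℕ, 0 < n → ((p.leftWeight ((u : ℂˣ) : ℂ) ((v : ℂˣ) : ℂ)) ^ 2 * l) ^ n ≠ 1)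
    {A C : QFA P} (hA : A ∈ nullMonoid (leftAct B X)) (hC : C ∈ nullMonoid (leftAct B X)) (J : ℕ) :
    ∃ z : ℂ, z ≠ 0 ∧ leftAct B X (A * QFA.gen p ^ (J + 1) * C) =
      z • (A * QFA.gen p ^ J * QFA.gen t * C) := by
  refine (isSkewDerivation_leftAct hB (QUEA.comul_kk u v) (QUEA.counit_kk u v)
    (QUEA.comul_kk u⁻¹ v⁻¹) (QUEA.counit_kk u⁻¹ v⁻¹) hX).exists_lowering hτ
    (leftWeight_ne_zero (by simp) (by simp) p) hp (leftAct_kk_gen hT hB _ _ p) ?_ htp hl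
    (isNullEigenvector_left hT hB hX hA) (isNullEigenvector_left hT hB hX hC) J
  rw [leftAct_kk_gen hT hB, ← leftWeight_inv]
  simp

/-- A skew primitive element that turns `p` into a multiple of `t` lowers the power of `p`. -/
theorem rightAct_lowering (hT : HasPairingTable σ B) (hB : IsHopfPairing B) {X : QUEA P}
    {u : P.Γ} {v : P.Γ'} (hX : Coalgebra.comul (R := ℂ) X =
      X ⊗ₜ QUEA.kk u v + QUEA.kk u⁻¹ v⁻¹ ⊗ₜ X) {p t : QFAGen} {τ l : ℂ} (hτ : τ ≠ 0)
    (hp : rightAct B X (QFA.gen p) = τ • QFA.gen t)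
    (htp : (QFA.gen t * QFA.gen p : QFA P) = l • (QFA.gen p * QFA.gen t))
    (hl : ∀ n : ℕ, 0 < n → ((p.rightWeight ((u : ℂˣ) : ℂ) ((v : ℂˣ) : ℂ)) ^ 2 * l) ^ n ≠ 1)
    {A C : QFA P} (hA : A ∈ nullMonoid (rightAct B X)) (hC : C ∈ nullMonoid (rightAct B X))
    (J : ℕ) :
    ∃ z : ℂ, z ≠ 0 ∧ rightAct B X (A * QFA.gen p ^ (J + 1) * C) =
      z • (A * QFA.gen p ^ J * QFA.gen t * C) := by
  refine (isSkewDerivation_rightAct hB (QUEA.comul_kk u v) (QUEA.counit_kk u v)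
    (QUEA.comul_kk u⁻¹ v⁻¹) (QUEA.counit_kk u⁻¹ v⁻¹) hX).exists_lowering hτ
    (rightWeight_ne_zero (by simp) (by simp) p) hp (rightAct_kk_gen hT hB _ _ p) ?_ htp hl
    (isNullEigenvector_right hT hB hX hA) (isNullEigenvector_right hT hB hX hC) J
  rw [rightAct_kk_gen hT hB, ← rightWeight_inv]
  simp

end Ladder

namespace QFA

variable {P : LinkParams}

open QFAGen

/-- The factor in the commutation relations of `top s` with `lowL s` and `lowR s`. -/
def topFactor (P : LinkParams) : Bool → ℂ
  | true => P.q⁻¹ | false => P.q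

/-- The antichiral analogue of `topFactor`. -/
def topFactor' (P : LinkParams) : Bool → ℂ
  | true => P.q' | false => P.q'⁻¹

theorem ab : a * b = P.q⁻¹ • (b * a : QFA P) := by
  rw [ba, smul_smul, inv_mul_cancel₀ P.q_ne, one_smul]

theorem ac : a * c = P.q⁻¹ • (c * a : QFA P) := by
  rw [ca, smul_smul, inv_mul_cancel₀ P.q_ne, one_smul]

theorem ab' : a' * b' = P.q' • (b' * a' : QFA P) := by
  rw [ba', smul_smul, mul_inv_cancel₀ P.q'_ne, one_smul]

theorem ac' : a' * c' = P.q' • (c' * a' : QFA P) := by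
  rw [ca', smul_smul, mul_inv_cancel₀ P.q'_ne, one_smul]

theorem top_mul_lowL (s : Bool) : (gen (top s) * gen (lowL s) : QFA P) =
    topFactor P s • (gen (lowL s) * gen (top s)) := by
  cases s
  exacts [dc, ab]

theorem top_mul_lowR (s : Bool) : (gen (top s) * gen (lowR s) : QFA P) =
    topFactor P s • (gen (lowR s) * gen (top s)) := by
  cases s
  exacts [db, ac]

theorem top_mul_lowL' (s : Bool) : (gen (top' s) * gen (lowL' s) : QFA P) =
    topFactor' P s • (gen (lowL' s) * gen (top' s)) := by
  cases s
  exacts [dc', ab']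

theorem top_mul_lowR' (s : Bool) : (gen (top' s) * gen (lowR' s) : QFA P) =
    topFactor' P s • (gen (lowR' s) * gen (top' s)) := by
  cases s
  exacts [db', ac']

theorem topFactor_ne_zero (s : Bool) : topFactor P s ≠ 0 := by
  cases s
  exacts [P.q_ne, inv_ne_zero P.q_ne]

theorem topFactor'_ne_zero (s : Bool) : topFactor' P s ≠ 0 := by
  cases s
  exacts [inv_ne_zero P.q'_ne, P.q'_ne]

end QFA

/-! ### Lowering operators on ordered monomials -/

section Lowering

variable {P : LinkParams} {σ : ℤˣ} {B : QUEA P →ₗ[ℂ] QFA P →ₗ[ℂ] ℂ}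

open QFAGen

/-- The ratio of the geometric sum in every lowering step below is `q^{±2}` or `q'^{±2}`. This is
where the q-integers are kept from vanishing. -/
theorem pow_ne_one_of_sq {z w : ℂ} (h : ∀ n : ℕ, 0 < n → z ^ n ≠ 1) (hw : w = z ^ 2 ∨ w = (z ^ 2)⁻¹)
    (n : ℕ) (hn : 0 < n) : w ^ n ≠ 1 := by
  have := h (2 * n) (by omega)
  rw [pow_mul] at this
  rcases hw with rfl | rfl
  · exact this
  · rwa [inv_pow, ne_eq, inv_eq_one]

theorem QUEA.sign_coe_ne_zero (σ : ℤˣ) : ((σ : ℤ) : ℂ) ≠ 0 := by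
  rcases Int.units_eq_one_or σ with rfl | rfl <;> simp

/-- Since `conj q' = 1 / q`, a root of unity `q'` would make `q` one as well. -/
theorem LinkParams.IsLorentz.q'_pow_ne_one (hP : P.IsLorentz)
    (hq : ∀ n : ℕ, 0 < n → P.q ^ n ≠ 1) (n : ℕ) (hn : 0 < n) : P.q' ^ n ≠ 1 := fun h => by
  apply hq n hn
  have := congrArg (starRingEnd ℂ) h
  rwa [map_pow, hP.conj_q'_eq, map_one, inv_pow, inv_eq_one] at this

/-- The Cartan legs `u`, `v` are read off from the comultiplication. The link leg `v` does not
affect the ratio, since weights of chiral generators depend on `u` alone. -/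
theorem leftAct_opL_lowL (hT : HasPairingTable σ B) (hq : ∀ n : ℕ, 0 < n → P.q ^ n ≠ 1) (s : Bool) :
    ∃ (u : P.Γ) (v : P.Γ'), Coalgebra.comul (R := ℂ) (QUEA.opL s : QUEA P) =
        QUEA.opL s ⊗ₜ QUEA.kk u v + QUEA.kk u⁻¹ v⁻¹ ⊗ₜ QUEA.opL s ∧
      leftAct B (QUEA.opL s) (QFA.gen (lowL s)) = (1 : ℂ) • QFA.gen (top s) ∧
      ∀ n : ℕ, 0 < n → (((lowL s).leftWeight ((u : ℂˣ) : ℂ) ((v : ℂˣ) : ℂ)) ^ 2 *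
        QFA.topFactor P s) ^ n ≠ 1 := by
  have hqg : ((P.gq : ℂˣ) : ℂ) ^ 2 = P.q := rfl
  cases s
  · refine ⟨P.gq, P.gl'⁻¹, by rw [inv_inv]; exact QUEA.comul_em, ?_, pow_ne_one_of_sq hq ?_⟩
    · rw [one_smul]; exact leftAct_em_gen hT _
    · left; simp only [leftWeight, lowL, hqg, QFA.topFactor]; ring
  · refine ⟨P.gq, P.gl', QUEA.comul_ep, ?_, pow_ne_one_of_sq hq ?_⟩
    · rw [one_smul]; exact leftAct_ep_gen hT _
    · right; simp only [leftWeight, lowL, inv_pow, hqg, QFA.topFactor]; ring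

theorem rightAct_opR_lowR (hT : HasPairingTable σ B) (hq : ∀ n : ℕ, 0 < n → P.q ^ n ≠ 1)
    (s : Bool) :
    ∃ (u : P.Γ) (v : P.Γ'), Coalgebra.comul (R := ℂ) (QUEA.opR s : QUEA P) =
        QUEA.opR s ⊗ₜ QUEA.kk u v + QUEA.kk u⁻¹ v⁻¹ ⊗ₜ QUEA.opR s ∧
      rightAct B (QUEA.opR s) (QFA.gen (lowR s)) = (1 : ℂ) • QFA.gen (top s) ∧
      ∀ n : ℕ, 0 < n → (((lowR s).rightWeight ((u : ℂˣ) : ℂ) ((v : ℂˣ) : ℂ)) ^ 2 *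
        QFA.topFactor P s) ^ n ≠ 1 := by
  have hqg : ((P.gq : ℂˣ) : ℂ) ^ 2 = P.q := rfl
  cases s
  · refine ⟨P.gq, P.gl', QUEA.comul_ep, ?_, pow_ne_one_of_sq hq ?_⟩
    · rw [one_smul]; exact rightAct_ep_gen hT _
    · left; simp only [rightWeight, lowR, hqg, QFA.topFactor]; ring
  · refine ⟨P.gq, P.gl'⁻¹, by rw [inv_inv]; exact QUEA.comul_em, ?_, pow_ne_one_of_sq hq ?_⟩
    · rw [one_smul]; exact rightAct_em_gen hT _
    · right; simp only [rightWeight, lowR, inv_pow, hqg, QFA.topFactor]; ring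

theorem leftAct_opL'_lowL' (hT : HasPairingTable σ B) (hq : ∀ n : ℕ, 0 < n → P.q' ^ n ≠ 1)
    (s : Bool) :
    ∃ (u : P.Γ) (v : P.Γ'), Coalgebra.comul (R := ℂ) (QUEA.opL' s : QUEA P) =
        QUEA.opL' s ⊗ₜ QUEA.kk u v + QUEA.kk u⁻¹ v⁻¹ ⊗ₜ QUEA.opL' s ∧
      leftAct B (QUEA.opL' s) (QFA.gen (lowL' s)) = ((σ : ℤ) : ℂ) • QFA.gen (top' s) ∧
      ∀ n : ℕ, 0 < n → (((lowL' s).leftWeight ((u : ℂˣ) : ℂ) ((v : ℂˣ) : ℂ)) ^ 2 *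
        QFA.topFactor' P s) ^ n ≠ 1 := by
  have hqg : ((P.gq' : ℂˣ) : ℂ) ^ 2 = P.q' := rfl
  cases s
  · refine ⟨P.gl⁻¹, P.gq', by rw [inv_inv]; exact QUEA.comul_ep', ?_, pow_ne_one_of_sq hq ?_⟩
    · exact leftAct_ep'_gen hT _
    · right; simp only [leftWeight, lowL', inv_pow, hqg, QFA.topFactor']; ring
  · refine ⟨P.gl, P.gq', QUEA.comul_em', ?_, pow_ne_one_of_sq hq ?_⟩
    · exact leftAct_em'_gen hT _
    · left; simp only [leftWeight, lowL', hqg, QFA.topFactor']; ring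

theorem rightAct_opR'_lowR' (hT : HasPairingTable σ B) (hq : ∀ n : ℕ, 0 < n → P.q' ^ n ≠ 1)
    (s : Bool) :
    ∃ (u : P.Γ) (v : P.Γ'), Coalgebra.comul (R := ℂ) (QUEA.opR' s : QUEA P) =
        QUEA.opR' s ⊗ₜ QUEA.kk u v + QUEA.kk u⁻¹ v⁻¹ ⊗ₜ QUEA.opR' s ∧
      rightAct B (QUEA.opR' s) (QFA.gen (lowR' s)) = ((σ : ℤ) : ℂ) • QFA.gen (top' s) ∧
      ∀ n : ℕ, 0 < n → (((lowR' s).rightWeight ((u : ℂˣ) : ℂ) ((v : ℂˣ) : ℂ)) ^ 2 *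
        QFA.topFactor' P s) ^ n ≠ 1 := by
  have hqg : ((P.gq' : ℂˣ) : ℂ) ^ 2 = P.q' := rfl
  cases s
  · refine ⟨P.gl, P.gq', QUEA.comul_em', ?_, pow_ne_one_of_sq hq ?_⟩
    · exact rightAct_em'_gen hT _
    · right; simp only [rightWeight, lowR', inv_pow, hqg, QFA.topFactor']; ring
  · refine ⟨P.gl⁻¹, P.gq', by rw [inv_inv]; exact QUEA.comul_ep', ?_, pow_ne_one_of_sq hq ?_⟩
    · exact rightAct_ep'_gen hT _
    · left; simp only [rightWeight, lowR', hqg, QFA.topFactor']; ring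

/-- The left action of `e_+` kills `a` and `c` and sends `b` to `a`; that of `e_-` kills `b` and `d`
and sends `c` to `d`. The operator that lowers a monomial therefore depends on which diagonal
generator occurs, which is why everything is indexed by a Boolean. All factors outside the lowered
power are null. -/
theorem leftAct_opL_mono (hT : HasPairingTable σ B) (hB : IsHopfPairing B)
    (hq : ∀ n : ℕ, 0 < n → P.q ^ n ≠ 1) (s s' : Bool) (K J' K' N' : ℕ) :
    (∀ N, leftAct B (QUEA.opL s) (QFA.mono s s' 0 K N J' K' N') = 0) ∧
    ∀ J N, ∃ z : ℂ, z ≠ 0 ∧ leftAct B (QUEA.opL s) (QFA.mono s s' (J + 1) K N J' K' N') =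
      z • QFA.mono s s' J K (N + 1) J' K' N' := by
  obtain ⟨u, v, hX, hp, hl⟩ := leftAct_opL_lowL hT hq s
  have null : ∀ g, g = lowR s ∨ g = top s ∨ g = lowL' s' ∨ g = lowR' s' ∨ g = top' s' →
      (QFA.gen g : QFA P) ∈ nullMonoid (leftAct B (QUEA.opL s)) := fun g hg => by
    apply gen_mem_nullMonoid
    rcases hg with rfl | rfl | rfl | rfl | rfl <;> cases s <;> cases s' <;>
      simp only [QUEA.opL, lowR, top, lowL', lowR', top', leftAct_ep_gen hT, leftAct_em_gen hT]
  have hC : ∀ N, (QFA.gen (lowR s) ^ K * QFA.gen (top s) ^ N *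
      (QFA.gen (lowL' s') ^ J' * QFA.gen (lowR' s') ^ K' * QFA.gen (top' s') ^ N') : QFA P) ∈
      nullMonoid (leftAct B (QUEA.opL s)) := fun N =>
    mul_mem (mul_mem (pow_mem (null _ (by simp)) _) (pow_mem (null _ (by simp)) _))
      (mul_mem (mul_mem (pow_mem (null _ (by simp)) _) (pow_mem (null _ (by simp)) _))
        (pow_mem (null _ (by simp)) _))
  refine ⟨fun N => ?_, fun J N => ?_⟩
  · rw [QFA.mono, pow_zero, one_mul]
    exact (isNullEigenvector_left hT hB hX (hC N)).null
  · obtain ⟨z, hz, e⟩ := leftAct_lowering hT hB hX one_ne_zero hp (QFA.top_mul_lowL s) hl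
      (one_mem _) (hC N) J
    -- The new diagonal generator appears to the left of `lowR s ^ K`. Moving it past these factors
    -- to its place costs `topFactor P s ^ K`.
    refine ⟨z * QFA.topFactor P s ^ K, mul_ne_zero hz (pow_ne_zero _ (QFA.topFactor_ne_zero s)), ?_⟩
    have h := mul_pow_of_qcomm (QFA.top_mul_lowR (P := P) s) K
    simp only [QFA.mono, one_mul, mul_assoc, pow_succ' _ N] at e ⊢
    rw [e, ← mul_assoc (QFA.gen (top s)), h]
    simp only [mul_smul_comm, smul_mul_assoc, mul_assoc, smul_smul]

theorem rightAct_opR_mono (hT : HasPairingTable σ B) (hB : IsHopfPairing B)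
    (hq : ∀ n : ℕ, 0 < n → P.q ^ n ≠ 1) (s s' : Bool) (J J' K' N' : ℕ) :
    (∀ N, rightAct B (QUEA.opR s) (QFA.mono s s' J 0 N J' K' N') = 0) ∧
    ∀ K N, ∃ z : ℂ, z ≠ 0 ∧ rightAct B (QUEA.opR s) (QFA.mono s s' J (K + 1) N J' K' N') =
      z • QFA.mono s s' J K (N + 1) J' K' N' := by
  obtain ⟨u, v, hX, hp, hl⟩ := rightAct_opR_lowR hT hq s
  have null : ∀ g, g = lowL s ∨ g = top s ∨ g = lowL' s' ∨ g = lowR' s' ∨ g = top' s' →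
      (QFA.gen g : QFA P) ∈ nullMonoid (rightAct B (QUEA.opR s)) := fun g hg => by
    apply gen_mem_nullMonoid
    rcases hg with rfl | rfl | rfl | rfl | rfl <;> cases s <;> cases s' <;>
      simp only [QUEA.opR, lowL, top, lowL', lowR', top', rightAct_ep_gen hT, rightAct_em_gen hT]
  have hA : (QFA.gen (lowL s) ^ J : QFA P) ∈ nullMonoid (rightAct B (QUEA.opR s)) :=
    pow_mem (null _ (by simp)) _
  have hC : ∀ N, (QFA.gen (top s) ^ N *
      (QFA.gen (lowL' s') ^ J' * QFA.gen (lowR' s') ^ K' * QFA.gen (top' s') ^ N') : QFA P) ∈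
      nullMonoid (rightAct B (QUEA.opR s)) := fun N =>
    mul_mem (pow_mem (null _ (by simp)) _)
      (mul_mem (mul_mem (pow_mem (null _ (by simp)) _) (pow_mem (null _ (by simp)) _))
        (pow_mem (null _ (by simp)) _))
  refine ⟨fun N => ?_, fun K N => ?_⟩
  · rw [QFA.mono, pow_zero, mul_one, mul_assoc]
    exact (isNullEigenvector_right hT hB hX (mul_mem hA (hC N))).null
  · obtain ⟨z, hz, e⟩ := rightAct_lowering hT hB hX one_ne_zero hp (QFA.top_mul_lowR s) hl
      hA (hC N) K
    refine ⟨z, hz, ?_⟩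
    simp only [QFA.mono, mul_assoc, pow_succ' _ N] at e ⊢
    exact e

theorem leftAct_opL'_mono (hT : HasPairingTable σ B) (hB : IsHopfPairing B)
    (hq : ∀ n : ℕ, 0 < n → P.q' ^ n ≠ 1) (s s' : Bool) (J K N K' : ℕ) :
    (∀ N', leftAct B (QUEA.opL' s') (QFA.mono s s' J K N 0 K' N') = 0) ∧
    ∀ J' N', ∃ z : ℂ, z ≠ 0 ∧ leftAct B (QUEA.opL' s') (QFA.mono s s' J K N (J' + 1) K' N') =
      z • QFA.mono s s' J K N J' K' (N' + 1) := by
  obtain ⟨u, v, hX, hp, hl⟩ := leftAct_opL'_lowL' hT hq s'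
  have null : ∀ g, g = lowL s ∨ g = lowR s ∨ g = top s ∨ g = lowR' s' ∨ g = top' s' →
      (QFA.gen g : QFA P) ∈ nullMonoid (leftAct B (QUEA.opL' s')) := fun g hg => by
    apply gen_mem_nullMonoid
    rcases hg with rfl | rfl | rfl | rfl | rfl <;> cases s <;> cases s' <;>
      simp only [QUEA.opL', lowL, lowR, top, lowR', top', leftAct_ep'_gen hT, leftAct_em'_gen hT]
  have hA : (QFA.gen (lowL s) ^ J * QFA.gen (lowR s) ^ K * QFA.gen (top s) ^ N : QFA P) ∈
      nullMonoid (leftAct B (QUEA.opL' s')) :=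
    mul_mem (mul_mem (pow_mem (null _ (by simp)) _) (pow_mem (null _ (by simp)) _))
      (pow_mem (null _ (by simp)) _)
  have hC : ∀ N', (QFA.gen (lowR' s') ^ K' * QFA.gen (top' s') ^ N' : QFA P) ∈
      nullMonoid (leftAct B (QUEA.opL' s')) := fun N' =>
    mul_mem (pow_mem (null _ (by simp)) _) (pow_mem (null _ (by simp)) _)
  refine ⟨fun N' => ?_, fun J' N' => ?_⟩
  · rw [QFA.mono, pow_zero, one_mul]
    exact (isNullEigenvector_left hT hB hX (mul_mem hA (hC N'))).null
  · obtain ⟨z, hz, e⟩ := leftAct_lowering hT hB hX (QUEA.sign_coe_ne_zero σ) hp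
      (QFA.top_mul_lowL' s') hl hA (hC N') J'
    refine ⟨z * QFA.topFactor' P s' ^ K',
      mul_ne_zero hz (pow_ne_zero _ (QFA.topFactor'_ne_zero s')), ?_⟩
    have h := mul_pow_of_qcomm (QFA.top_mul_lowR' (P := P) s') K'
    simp only [QFA.mono, mul_assoc, pow_succ' _ N'] at e ⊢
    rw [e, ← mul_assoc (QFA.gen (top' s')), h]
    simp only [mul_smul_comm, smul_mul_assoc, mul_assoc, smul_smul]

theorem rightAct_opR'_mono (hT : HasPairingTable σ B) (hB : IsHopfPairing B)
    (hq : ∀ n : ℕ, 0 < n → P.q' ^ n ≠ 1) (s s' : Bool) (J K N J' : ℕ) :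
    (∀ N', rightAct B (QUEA.opR' s') (QFA.mono s s' J K N J' 0 N') = 0) ∧
    ∀ K' N', ∃ z : ℂ, z ≠ 0 ∧ rightAct B (QUEA.opR' s') (QFA.mono s s' J K N J' (K' + 1) N') =
      z • QFA.mono s s' J K N J' K' (N' + 1) := by
  obtain ⟨u, v, hX, hp, hl⟩ := rightAct_opR'_lowR' hT hq s'
  have null : ∀ g, g = lowL s ∨ g = lowR s ∨ g = top s ∨ g = lowL' s' ∨ g = top' s' →
      (QFA.gen g : QFA P) ∈ nullMonoid (rightAct B (QUEA.opR' s')) := fun g hg => by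
    apply gen_mem_nullMonoid
    rcases hg with rfl | rfl | rfl | rfl | rfl <;> cases s <;> cases s' <;>
      simp only [QUEA.opR', lowL, lowR, top, lowL', top', rightAct_ep'_gen hT, rightAct_em'_gen hT]
  have hA : (QFA.gen (lowL s) ^ J * QFA.gen (lowR s) ^ K * QFA.gen (top s) ^ N *
      QFA.gen (lowL' s') ^ J' : QFA P) ∈ nullMonoid (rightAct B (QUEA.opR' s')) :=
    mul_mem (mul_mem (mul_mem (pow_mem (null _ (by simp)) _) (pow_mem (null _ (by simp)) _))
      (pow_mem (null _ (by simp)) _)) (pow_mem (null _ (by simp)) _)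
  have hC : ∀ N', (QFA.gen (top' s') ^ N' : QFA P) ∈
      nullMonoid (rightAct B (QUEA.opR' s')) := fun N' => pow_mem (null _ (by simp)) _
  refine ⟨fun N' => ?_, fun K' N' => ?_⟩
  · rw [QFA.mono, pow_zero, mul_one, ← mul_assoc]
    exact (isNullEigenvector_right hT hB hX (mul_mem hA (hC N'))).null
  · obtain ⟨z, hz, e⟩ := rightAct_lowering hT hB hX (QUEA.sign_coe_ne_zero σ) hp
      (QFA.top_mul_lowR' s') hl hA (hC N') K'
    refine ⟨z, hz, ?_⟩
    simp only [QFA.mono, mul_assoc, pow_succ' _ N'] at e ⊢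
    exact e

end Lowering

/-- The ordered monomials of the enveloping algebra. -/
def QUEA.mono {P : LinkParams} (s s' : Bool) (J K J' K' : ℕ) (u : P.Γ) (v : P.Γ') : QUEA P :=
  QUEA.opR s ^ K * (QUEA.opR' s' ^ K' * (QUEA.kk u v * QUEA.opL s ^ J * QUEA.opL' s' ^ J'))

/-! ### Pairing of ordered monomials -/

section Evaluation

variable {P : LinkParams} {σ : ℤˣ} {B : QUEA P →ₗ[ℂ] QFA P →ₗ[ℂ] ℂ}

open QFAGen

theorem pairing_kk_mul (hB : IsHopfPairing B) (u : P.Γ) (v : P.Γ') (f g : QFA P) :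
    B (QUEA.kk u v) (f * g) = B (QUEA.kk u v) f * B (QUEA.kk u v) g := by
  rw [hB.mul_right, QUEA.comul_kk, tensorPairing_tmul]

theorem pairing_kk_pow (hB : IsHopfPairing B) (u : P.Γ) (v : P.Γ') (f : QFA P) (n : ℕ) :
    B (QUEA.kk u v) (f ^ n) = B (QUEA.kk u v) f ^ n := by
  induction n with
  | zero => rw [pow_zero, pow_zero, hB.one_right, QUEA.counit_kk]
  | succ n ih => rw [pow_succ, pow_succ, pairing_kk_mul hB, ih]

/-- A group-like element is a character of the function algebra, and the Cartan ones vanish on the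
off-diagonal generators. -/
theorem pairing_kk_mono (hT : HasPairingTable σ B) (hB : IsHopfPairing B) (u : P.Γ) (v : P.Γ')
    (s s' : Bool) (J K N J' K' N' : ℕ) :
    B (QUEA.kk u v) (QFA.mono s s' J K N J' K' N') =
      if J = 0 ∧ K = 0 ∧ J' = 0 ∧ K' = 0 then
        (top s).cartanVal ((u : ℂˣ) : ℂ) ((v : ℂˣ) : ℂ) ^ N *
          (top' s').cartanVal ((u : ℂˣ) : ℂ) ((v : ℂˣ) : ℂ) ^ N'
      else 0 := by
  have h1 : (lowL s).cartanVal ((u : ℂˣ) : ℂ) ((v : ℂˣ) : ℂ) = 0 := by cases s <;> rfl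
  have h2 : (lowR s).cartanVal ((u : ℂˣ) : ℂ) ((v : ℂˣ) : ℂ) = 0 := by cases s <;> rfl
  have h3 : (lowL' s').cartanVal ((u : ℂˣ) : ℂ) ((v : ℂˣ) : ℂ) = 0 := by cases s' <;> rfl
  have h4 : (lowR' s').cartanVal ((u : ℂˣ) : ℂ) ((v : ℂˣ) : ℂ) = 0 := by cases s' <;> rfl
  simp only [QFA.mono, pairing_kk_mul hB, pairing_kk_pow hB, hT.kk_gen hB, h1, h2, h3, h4,
    zero_pow_eq]
  split_ifs <;> simp_all

/-- The powers of `opR` and `opR'` are stripped off the left end and those of `opL'` and `opL` off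
the right end, each becoming a lowering operator on the function side. Too many lowerings give zero;
too few leave an off-diagonal generator, on which the Cartan element vanishes. The constant does not
depend on `u` and `v`, so for fixed exponents the value is a multiple of a character in the Cartan
variables. -/
theorem pairing_mono (hT : HasPairingTable σ B) (hB : IsHopfPairing B)
    (hq : ∀ n : ℕ, 0 < n → P.q ^ n ≠ 1) (hq' : ∀ n : ℕ, 0 < n → P.q' ^ n ≠ 1) (s s' : Bool)
    (J K J' K' j k n j' k' n' : ℕ) :
    ∃ z : ℂ, z ≠ 0 ∧ ∀ (u : P.Γ) (v : P.Γ'),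
      B (QUEA.mono s s' J K J' K' u v) (QFA.mono s s' j k n j' k' n') =
        if J = j ∧ K = k ∧ J' = j' ∧ K' = k' then
          z * ((top s).cartanVal ((u : ℂˣ) : ℂ) ((v : ℂˣ) : ℂ) ^ (n + K + J) *
            (top' s').cartanVal ((u : ℂˣ) : ℂ) ((v : ℂˣ) : ℂ) ^ (n' + K' + J'))
        else 0 := by
  have h1 := rightAct_opR_mono hT hB hq s s' j j' k' n'
  obtain ⟨z₁, hz₁, e₁⟩ := iterate_lowering (m := fun k n => QFA.mono s s' j k n j' k' n')
    h1.1 h1.2 K k n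
  -- The truncated difference `k - K` matters only when `K ≤ k`; otherwise the previous lowering has
  -- already given zero. The same applies to the differences below.
  have h2 := rightAct_opR'_mono hT hB hq' s s' j (k - K) (n + K) j'
  obtain ⟨z₂, hz₂, e₂⟩ := iterate_lowering
    (m := fun k' n' => QFA.mono s s' j (k - K) (n + K) j' k' n') h2.1 h2.2 K' k' n'
  have h3 := leftAct_opL'_mono hT hB hq' s s' j (k - K) (n + K) (k' - K')
  obtain ⟨z₃, hz₃, e₃⟩ := iterate_lowering
    (m := fun j' n' => QFA.mono s s' j (k - K) (n + K) j' (k' - K') n') h3.1 h3.2 J' j' (n' + K')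
  have h4 := leftAct_opL_mono hT hB hq s s' (k - K) (j' - J') (k' - K') (n' + K' + J')
  obtain ⟨z₄, hz₄, e₄⟩ := iterate_lowering
    (m := fun j n => QFA.mono s s' j (k - K) n (j' - J') (k' - K') (n' + K' + J'))
    h4.1 h4.2 J j (n + K)
  refine ⟨z₁ * z₂ * z₃ * z₄, by simp [hz₁, hz₂, hz₃, hz₄], fun u v => ?_⟩
  rw [QUEA.mono, ← pairing_rightAct_pow hB, e₁]
  split_ifs with c c' c'
  · rw [map_smul, ← pairing_rightAct_pow hB, e₂, if_pos (by omega), map_smul,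
      ← pairing_leftAct_pow hB, e₃, if_pos (by omega), map_smul, ← pairing_leftAct_pow hB, e₄,
      if_pos (by omega), map_smul, pairing_kk_mono hT hB, if_pos (by omega)]
    simp only [smul_eq_mul]
    ring
  · rw [map_smul, ← pairing_rightAct_pow hB, e₂]
    split_ifs with c₂
    · rw [map_smul, ← pairing_leftAct_pow hB, e₃]
      split_ifs with c₃
      · rw [map_smul, ← pairing_leftAct_pow hB, e₄]
        split_ifs with c₄
        · rw [map_smul, pairing_kk_mono hT hB, if_neg (by omega)]
          simp
        · simp
      · simp
    · simp
  · omega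
  · simp

end Evaluation

/-! ### Ordered monomials span both algebras -/

theorem mul_mem_span_of_forall {A : Type} [Ring A] [Algebra ℂ A] {T : Set A} {V : Submodule ℂ A}
    {x : A} (h : ∀ y ∈ T, x * y ∈ V) {y : A} (hy : y ∈ Submodule.span ℂ T) : x * y ∈ V :=
  (Submodule.span_le (p := V.comap (LinearMap.mulLeft ℂ x))).mpr h hy

namespace QUEA

variable {P : LinkParams}

theorem ep_ep' : (ep * ep' : QUEA P) = ep' * ep := link .ep .ep'
theorem ep_em'_comm : (ep * em' : QUEA P) = em' * ep := link .ep .em'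
theorem em_ep'_comm : (em * ep' : QUEA P) = ep' * em := link .em .ep'
theorem em_em' : (em * em' : QUEA P) = em' * em := link .em .em'

theorem ep_mul_em : (ep * em : QUEA P) = em * ep + (P.q - P.q⁻¹)⁻¹ •
    (kk (P.gq ^ 2) 1 - kk (P.gq⁻¹ ^ 2) 1) := by
  have h := ep_em (P := P)
  rw [k_eq_kk, k_eq_kk, sq, sq, kk_mul, kk_mul, mul_one, ← sq, ← sq] at h
  rw [← h]
  abel

theorem em'_mul_ep' : (em' * ep' : QUEA P) = ep' * em' - (P.q' - P.q'⁻¹)⁻¹ •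
    (kk 1 (P.gq' ^ 2) - kk 1 (P.gq'⁻¹ ^ 2)) := by
  have h := ep_em' (P := P)
  rw [k'_eq_kk, k'_eq_kk, sq, sq, kk_mul, kk_mul, mul_one, ← sq, ← sq] at h
  rw [← h]
  abel

/-- The span of the ordered monomials. -/
def monoSpan (P : LinkParams) : Submodule ℂ (QUEA P) :=
  Submodule.span ℂ {x | ∃ J K J' K' u v, x = mono true true J K J' K' u v}

theorem mono_mem_monoSpan (J K J' K' : ℕ) (u : P.Γ) (v : P.Γ') :
    mono true true J K J' K' u v ∈ monoSpan P :=
  Submodule.subset_span ⟨J, K, J', K', u, v, rfl⟩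

theorem mono_true (J K J' K' : ℕ) (u : P.Γ) (v : P.Γ') : mono true true J K J' K' u v =
    em ^ K * (ep' ^ K' * (kk u v * ep ^ J * em' ^ J')) := rfl

theorem em_mul_mem {x : QUEA P} (hx : x ∈ monoSpan P) : em * x ∈ monoSpan P := by
  refine mul_mem_span_of_forall ?_ hx
  rintro _ ⟨J, K, J', K', u, v, rfl⟩
  rw [mono_true, ← mul_assoc, ← pow_succ']
  exact mono_mem_monoSpan J (K + 1) J' K' u v

theorem ep'_mul_mem {x : QUEA P} (hx : x ∈ monoSpan P) : ep' * x ∈ monoSpan P := by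
  refine mul_mem_span_of_forall ?_ hx
  rintro _ ⟨J, K, J', K', u, v, rfl⟩
  rw [mono_true, ← mul_assoc, ((show Commute ep' em from em_ep'_comm.symm).pow_right K).eq,
    mul_assoc, ← mul_assoc ep', ← pow_succ']
  exact mono_mem_monoSpan J K J' (K' + 1) u v

theorem kk_mul_mem (u : P.Γ) (v : P.Γ') {x : QUEA P} (hx : x ∈ monoSpan P) :
    kk u v * x ∈ monoSpan P := by
  refine mul_mem_span_of_forall ?_ hx
  rintro _ ⟨J, K, J', K', u₁, v₁, rfl⟩
  rw [mono_true, ← mul_assoc, mul_pow_of_qcomm (kk_em u v), smul_mul_assoc, mul_assoc,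
    ← mul_assoc (kk u v), mul_pow_of_qcomm (kk_ep' u v), smul_mul_assoc, mul_smul_comm, mul_assoc,
    ← mul_assoc (kk u v), ← mul_assoc (kk u v), kk_mul]
  exact Submodule.smul_mem _ _ (Submodule.smul_mem _ _ (mono_mem_monoSpan J K J' K' _ _))

/-- Induction on the power of `e_-`. Moving `e_+` past one `e_-` produces Cartan elements, which the
span absorbs by `kk_mul_mem`. With no `e_-` left, `e_+` commutes with `e'_+` and passes the Cartan
factor up to a scalar. -/
theorem ep_mul_mem {x : QUEA P} (hx : x ∈ monoSpan P) : ep * x ∈ monoSpan P := by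
  refine mul_mem_span_of_forall ?_ hx
  rintro _ ⟨J, K, J', K', u, v, rfl⟩
  induction K with
  | zero =>
    have h : ep * kk u v = (((u : ℂˣ) : ℂ) ^ 2)⁻¹ • (kk u v * ep) := by
      rw [kk_ep, smul_smul, inv_mul_cancel₀ (by simp), one_smul]
    rw [mono_true, pow_zero, one_mul, ← mul_assoc,
      ((show Commute ep ep' from ep_ep').pow_right K').eq, mul_assoc, ← mul_assoc ep,
      ← mul_assoc ep, h, smul_mul_assoc, smul_mul_assoc, mul_smul_comm, mul_assoc (kk u v),
      ← pow_succ']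
    have := mono_mem_monoSpan (J + 1) 0 J' K' u v
    rw [mono_true, pow_zero, one_mul] at this
    exact Submodule.smul_mem _ _ this
  | succ K ih =>
    have e : mono true true J (K + 1) J' K' u v = em * mono true true J K J' K' u v := by
      rw [mono_true, mono_true, ← mul_assoc em, ← pow_succ']
    rw [e, ← mul_assoc, ep_mul_em, add_mul, smul_mul_assoc, sub_mul, mul_assoc]
    have := mono_mem_monoSpan J K J' K' u v
    exact add_mem (em_mul_mem ih)
      (Submodule.smul_mem _ _ (sub_mem (kk_mul_mem _ _ this) (kk_mul_mem _ _ this)))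

/-- `e'_-` commutes with the chiral factor `e_-`, so the first induction is harmless. The second, on
the power of `e'_+`, is where the commutator produces Cartan terms. -/
theorem em'_mul_mem {x : QUEA P} (hx : x ∈ monoSpan P) : em' * x ∈ monoSpan P := by
  refine mul_mem_span_of_forall ?_ hx
  rintro _ ⟨J, K, J', K', u, v, rfl⟩
  induction K with
  | zero =>
    induction K' with
    | zero =>
      have h : em' * kk u v = ((v : ℂˣ) : ℂ) ^ 2 • (kk u v * em') := by
        rw [kk_em', smul_smul, mul_inv_cancel₀ (by simp), one_smul]
      have := mono_mem_monoSpan J 0 (J' + 1) 0 u v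
      rw [mono_true, pow_zero, one_mul, pow_zero, one_mul] at this ⊢
      rw [← mul_assoc, ← mul_assoc, h, smul_mul_assoc, smul_mul_assoc, mul_assoc (kk u v),
        ((show Commute em' ep from ep_em'_comm.symm).pow_right J).eq, mul_assoc, mul_assoc,
        ← pow_succ', ← mul_assoc]
      exact Submodule.smul_mem _ _ this
    | succ K' ih =>
      have e : mono true true J 0 J' (K' + 1) u v = ep' * mono true true J 0 J' K' u v := by
        rw [mono_true, mono_true, pow_zero, one_mul, one_mul, ← mul_assoc ep', ← pow_succ']
      rw [e, ← mul_assoc, em'_mul_ep', sub_mul, smul_mul_assoc, sub_mul, mul_assoc]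
      have := mono_mem_monoSpan J 0 J' K' u v
      exact sub_mem (ep'_mul_mem ih)
        (Submodule.smul_mem _ _ (sub_mem (kk_mul_mem _ _ this) (kk_mul_mem _ _ this)))
  | succ K ih =>
    have e : mono true true J (K + 1) J' K' u v = em * mono true true J K J' K' u v := by
      rw [mono_true, mono_true, ← mul_assoc em, ← pow_succ']
    rw [e, ← mul_assoc, ← em_em', mul_assoc]
    exact em_mul_mem ih

/-- The span is stable under left multiplication by every generator, hence a left ideal, and it
contains `1`. -/
theorem monoSpan_eq_top : monoSpan P = ⊤ := by
  have key : ∀ x y : QUEA P, y ∈ monoSpan P → x * y ∈ monoSpan P := fun x => by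
    induction x using QUEA.induction with
    | h0 z => exact fun y hy => by rw [← Algebra.smul_def]; exact Submodule.smul_mem _ _ hy
    | h1 g =>
      intro y hy
      cases g
      · exact ep_mul_mem hy
      · exact em_mul_mem hy
      · exact (congrArg (· * y ∈ monoSpan P) (k_eq_kk (P := P) _)).mpr (kk_mul_mem _ _ hy)
      · exact ep'_mul_mem hy
      · exact em'_mul_mem hy
      · exact (congrArg (· * y ∈ monoSpan P) (k'_eq_kk (P := P) _)).mpr (kk_mul_mem _ _ hy)
    | hm a b ha hb => exact fun y hy => by rw [mul_assoc]; exact ha _ (hb _ hy)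
    | ha a b ha hb => exact fun y hy => by rw [add_mul]; exact add_mem (ha _ hy) (hb _ hy)
  refine eq_top_iff.mpr fun x _ => ?_
  have := key x _ (mono_mem_monoSpan 0 0 0 0 1 1)
  simpa [mono_true, kk_one] using this

end QUEA

/-- The diagonal generator `t` passes `b` and `c` up to scalars. It then lengthens a power of `t` or
cancels one factor of a power of `t'` through the determinant relation, so no monomial mixes `t` and
`t'`. The statement is used with `t`, `t'` in both roles and in both sectors. -/
theorem top_mul_mem {A : Type} [Ring A] [Algebra ℂ A] {V : Submodule ℂ A} {t t' b c : A}
    {α β x : ℂ} (ht : ∀ J K N : ℕ, b ^ J * c ^ K * t ^ N ∈ V)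
    (ht' : ∀ J K N : ℕ, b ^ J * c ^ K * t' ^ N ∈ V) (tb : t * b = α • (b * t))
    (tc : t * c = β • (c * t)) (cb : c * b = b * c) (tt' : t * t' = 1 + x • (b * c)) (J K N : ℕ) :
    t * (b ^ J * c ^ K * t ^ N) ∈ V ∧ t * (b ^ J * c ^ K * t' ^ N) ∈ V := by
  have h : ∀ y : A, t * (b ^ J * c ^ K * y) = (α ^ J * β ^ K) • (b ^ J * c ^ K * (t * y)) :=
    fun y => by
      rw [← mul_assoc, ← mul_assoc, mul_pow_of_qcomm tb, smul_mul_assoc, mul_assoc (b ^ J),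
        mul_pow_of_qcomm tc]
      simp only [smul_mul_assoc, mul_smul_comm, smul_smul, mul_assoc]
  refine ⟨by rw [h, ← pow_succ']; exact Submodule.smul_mem _ _ (ht J K _), ?_⟩
  rw [h]
  refine Submodule.smul_mem _ _ ?_
  cases N with
  -- With no `t'` to cancel, the product falls into the family of powers of `t`.
  | zero => simpa using ht J K 1
  | succ N =>
    have hc : b ^ J * c ^ K * (b * c * t' ^ N) = b ^ (J + 1) * c ^ (K + 1) * t' ^ N := by
      rw [← mul_assoc, ← mul_assoc, mul_assoc (b ^ J), ((show Commute c b from cb).pow_left K).eq,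
        pow_succ, pow_succ]
      simp only [mul_assoc]
    rw [pow_succ', ← mul_assoc t, tt', add_mul, one_mul, mul_add, smul_mul_assoc, mul_smul_comm, hc]
    exact add_mem (ht' J K N) (Submodule.smul_mem _ _ (ht' _ _ N))

namespace QFA

variable {P : LinkParams}

open QFAGen

/-- The span of the ordered monomials of the chiral sector. -/
def chiralSpan (P : LinkParams) : Submodule ℂ (QFA P) :=
  Submodule.span ℂ {f | ∃ J K N : ℕ, f = b ^ J * c ^ K * a ^ N ∨ f = b ^ J * c ^ K * d ^ N}

/-- The span of the ordered monomials of the antichiral sector. -/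
def antichiralSpan (P : LinkParams) : Submodule ℂ (QFA P) :=
  Submodule.span ℂ
    {f | ∃ J K N : ℕ, f = b' ^ J * c' ^ K * a' ^ N ∨ f = b' ^ J * c' ^ K * d' ^ N}

theorem bca_mem (J K N : ℕ) : b ^ J * c ^ K * a ^ N ∈ chiralSpan P :=
  Submodule.subset_span ⟨J, K, N, .inl rfl⟩

theorem bcd_mem (J K N : ℕ) : b ^ J * c ^ K * d ^ N ∈ chiralSpan P :=
  Submodule.subset_span ⟨J, K, N, .inr rfl⟩

theorem bca_mem' (J K N : ℕ) : b' ^ J * c' ^ K * a' ^ N ∈ antichiralSpan P :=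
  Submodule.subset_span ⟨J, K, N, .inl rfl⟩

theorem bcd_mem' (J K N : ℕ) : b' ^ J * c' ^ K * d' ^ N ∈ antichiralSpan P :=
  Submodule.subset_span ⟨J, K, N, .inr rfl⟩

theorem mul_mem_chiralSpan {g f : QFA P} (hg : g = a ∨ g = b ∨ g = c ∨ g = d)
    (hf : f ∈ chiralSpan P) : g * f ∈ chiralSpan P := by
  refine mul_mem_span_of_forall ?_ hf
  rintro _ ⟨J, K, N, h⟩
  have hb : ∀ f : QFA P, b * (b ^ J * c ^ K * f) = b ^ (J + 1) * c ^ K * f := fun f => by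
    simp only [pow_succ', mul_assoc]
  have hc : ∀ f : QFA P, c * (b ^ J * c ^ K * f) = b ^ J * c ^ (K + 1) * f := fun f => by
    rw [← mul_assoc, ← mul_assoc, ((show Commute (c : QFA P) b from cb).pow_right J).eq, pow_succ']
    simp only [mul_assoc]
  rcases hg with rfl | rfl | rfl | rfl
  · have := top_mul_mem (V := chiralSpan P) bca_mem bcd_mem ab ac cb ad J K N
    rcases h with rfl | rfl
    exacts [this.1, this.2]
  · rcases h with rfl | rfl
    exacts [hb _ ▸ bca_mem _ _ _, hb _ ▸ bcd_mem _ _ _]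
  · rcases h with rfl | rfl
    exacts [hc _ ▸ bca_mem _ _ _, hc _ ▸ bcd_mem _ _ _]
  · have := top_mul_mem (V := chiralSpan P) bcd_mem bca_mem db dc cb da J K N
    rcases h with rfl | rfl
    exacts [this.2, this.1]

theorem mul_mem_antichiralSpan {g f : QFA P} (hg : g = a' ∨ g = b' ∨ g = c' ∨ g = d')
    (hf : f ∈ antichiralSpan P) : g * f ∈ antichiralSpan P := by
  refine mul_mem_span_of_forall ?_ hf
  rintro _ ⟨J, K, N, h⟩
  have hb : ∀ f : QFA P, b' * (b' ^ J * c' ^ K * f) = b' ^ (J + 1) * c' ^ K * f := fun f => by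
    simp only [pow_succ', mul_assoc]
  have hc : ∀ f : QFA P, c' * (b' ^ J * c' ^ K * f) = b' ^ J * c' ^ (K + 1) * f := fun f => by
    rw [← mul_assoc, ← mul_assoc, ((show Commute (c' : QFA P) b' from cb').pow_right J).eq,
      pow_succ']
    simp only [mul_assoc]
  rcases hg with rfl | rfl | rfl | rfl
  · have := top_mul_mem (V := antichiralSpan P) bca_mem' bcd_mem' ab' ac' cb' ad' J K N
    rcases h with rfl | rfl
    exacts [this.1, this.2]
  · rcases h with rfl | rfl
    exacts [hb _ ▸ bca_mem' _ _ _, hb _ ▸ bcd_mem' _ _ _]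
  · rcases h with rfl | rfl
    exacts [hc _ ▸ bca_mem' _ _ _, hc _ ▸ bcd_mem' _ _ _]
  · have := top_mul_mem (V := antichiralSpan P) bcd_mem' bca_mem' db' dc' cb' da' J K N
    rcases h with rfl | rfl
    exacts [this.2, this.1]

/-- Generators of different sectors commute up to a scalar, so antichiral factors can be moved to
the right of all chiral ones. -/
theorem exists_link_factor {g : QFA P} (hg : g = a' ∨ g = b' ∨ g = c' ∨ g = d') {f : QFA P}
    (hf : f = a ∨ f = b ∨ f = c ∨ f = d) : ∃ z : ℂ, g * f = z • (f * g) := by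
  rcases hg with rfl | rfl | rfl | rfl <;> rcases hf with rfl | rfl | rfl | rfl
  exacts [⟨1, by rw [one_smul, link_aa]⟩, ⟨_, link_ab⟩, ⟨_, link_ca⟩, ⟨1, by rw [one_smul, link_da]⟩,
    ⟨_, link_ba⟩, ⟨1, by rw [one_smul, link_bb]⟩, ⟨1, by rw [one_smul, link_cb]⟩, ⟨_, link_db⟩,
    ⟨_, link_ac⟩, ⟨1, by rw [one_smul, link_bc]⟩, ⟨1, by rw [one_smul, link_cc]⟩, ⟨_, link_cd⟩,
    ⟨1, by rw [one_smul, link_ad]⟩, ⟨_, link_bd⟩, ⟨_, link_dc⟩, ⟨1, by rw [one_smul, link_dd]⟩]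

theorem exists_link_factor_mono {g : QFA P} (hg : g = a' ∨ g = b' ∨ g = c' ∨ g = d') {t : QFA P}
    (ht : t = a ∨ t = d) (J K N : ℕ) :
    ∃ z : ℂ, g * (b ^ J * c ^ K * t ^ N) = z • (b ^ J * c ^ K * t ^ N * g) := by
  obtain ⟨x, hx⟩ := exists_link_factor hg (f := b) (by simp)
  obtain ⟨y, hy⟩ := exists_link_factor hg (f := c) (by simp)
  obtain ⟨z, hz⟩ := exists_link_factor hg (f := t) (by tauto)
  refine ⟨x ^ J * y ^ K * z ^ N, ?_⟩
  rw [← mul_assoc, ← mul_assoc, mul_pow_of_qcomm hx, smul_mul_assoc, mul_assoc (b ^ J),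
    mul_pow_of_qcomm hy, mul_smul_comm, smul_mul_assoc, smul_mul_assoc, mul_assoc (b ^ J),
    mul_assoc (c ^ K), mul_pow_of_qcomm hz]
  simp only [mul_smul_comm, smul_smul, mul_assoc]

/-- A chiral generator multiplies into the first factor; an antichiral one first moves past the
chiral monomial and then multiplies into the second. The product is thus a left ideal containing
`1`. -/
theorem chiralSpan_mul_antichiralSpan : chiralSpan P * antichiralSpan P = ⊤ := by
  have hl : ∀ g : QFA P, g = a ∨ g = b ∨ g = c ∨ g = d →
      ∀ y ∈ chiralSpan P * antichiralSpan P, g * y ∈ chiralSpan P * antichiralSpan P :=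
    fun g hg y hy => by
      induction hy using Submodule.mul_induction_on' with
      | mem_mul_mem m hm n hn =>
        rw [← mul_assoc]
        exact Submodule.mul_mem_mul (mul_mem_chiralSpan hg hm) hn
      | add x _ y _ hx hy => rw [mul_add]; exact add_mem hx hy
  have hr : ∀ g : QFA P, g = a' ∨ g = b' ∨ g = c' ∨ g = d' →
      ∀ y ∈ chiralSpan P * antichiralSpan P, g * y ∈ chiralSpan P * antichiralSpan P :=
    fun g hg y hy => by
      induction hy using Submodule.mul_induction_on' with
      | mem_mul_mem m hm n hn =>
        induction hm using Submodule.span_induction with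
        | mem m hm =>
          obtain ⟨J, K, N, h⟩ := hm
          have : ∃ z : ℂ, g * m = z • (m * g) := by
            rcases h with rfl | rfl
            exacts [exists_link_factor_mono hg (.inl rfl) J K N,
              exists_link_factor_mono hg (.inr rfl) J K N]
          obtain ⟨z, hz⟩ := this
          rw [← mul_assoc, hz, smul_mul_assoc, mul_assoc]
          exact Submodule.smul_mem _ _ (Submodule.mul_mem_mul
            (Submodule.subset_span ⟨J, K, N, h⟩) (mul_mem_antichiralSpan hg hn))
        | zero => simp
        | add x y _ _ hx hy => rw [add_mul, mul_add]; exact add_mem hx hy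
        | smul z x _ hx => rw [smul_mul_assoc, mul_smul_comm]; exact Submodule.smul_mem _ _ hx
      | add x _ y _ hx hy => rw [mul_add]; exact add_mem hx hy
  have key : ∀ x y : QFA P, y ∈ chiralSpan P * antichiralSpan P →
      x * y ∈ chiralSpan P * antichiralSpan P := fun x => by
    induction x using QFA.induction with
    | h0 z => exact fun y hy => by rw [← Algebra.smul_def]; exact Submodule.smul_mem _ _ hy
    | h1 g =>
      intro y hy
      cases g
      · exact hl a (by simp) y hy
      · exact hl b (by simp) y hy
      · exact hl c (by simp) y hy
      · exact hl d (by simp) y hy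
      · exact hr a' (by simp) y hy
      · exact hr b' (by simp) y hy
      · exact hr c' (by simp) y hy
      · exact hr d' (by simp) y hy
    | hm a b ha hb => exact fun y hy => by rw [mul_assoc]; exact ha _ (hb _ hy)
    | ha a b ha hb => exact fun y hy => by rw [add_mul]; exact add_mem (ha _ hy) (hb _ hy)
  refine eq_top_iff.mpr fun x _ => ?_
  have := key x _ (Submodule.mul_mem_mul (bca_mem 0 0 0) (bca_mem' 0 0 0))
  simpa using this

/-- The ordered monomials, indexed by the signed exponents `i` and `i'` of the diagonal
generators. -/
def signedMono (i i' : ℤ) (J K J' K' : ℕ) : QFA P :=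
  mono (decide (0 ≤ i)) (decide (0 ≤ i')) J K i.natAbs J' K' i'.natAbs

theorem exists_signed {m : QFA P} {J K N : ℕ}
    (hm : m = b ^ J * c ^ K * a ^ N ∨ m = b ^ J * c ^ K * d ^ N) :
    ∃ (i : ℤ) (J K : ℕ), m = gen (lowL (decide (0 ≤ i))) ^ J *
      gen (lowR (decide (0 ≤ i))) ^ K * gen (top (decide (0 ≤ i))) ^ i.natAbs := by
  rcases hm with rfl | rfl
  · exact ⟨N, J, K, by simp [top, lowL, lowR, a, b, c]⟩
  · cases N with
    -- The monomials with `a ^ 0` and `d ^ 0` coincide and both get the signed exponent `0`, which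
    -- counts as nonnegative.
    | zero => exact ⟨0, J, K, by simp [top, lowL, lowR, b, c]⟩
    | succ N =>
      -- For negative exponents `lowL` is `c` and `lowR` is `b`, so the two exponents are exchanged.
      refine ⟨-(N + 1 : ℕ), K, J, ?_⟩
      have h : ¬ (0 : ℤ) ≤ -(N + 1 : ℕ) := by omega
      rw [((show Commute (b : QFA P) c from cb.symm).pow_pow J K).eq, decide_eq_false h,
        Int.natAbs_neg, Int.natAbs_natCast]
      rfl

theorem exists_signed' {m : QFA P} {J K N : ℕ}
    (hm : m = b' ^ J * c' ^ K * a' ^ N ∨ m = b' ^ J * c' ^ K * d' ^ N) :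
    ∃ (i : ℤ) (J K : ℕ), m = gen (lowL' (decide (0 ≤ i))) ^ J *
      gen (lowR' (decide (0 ≤ i))) ^ K * gen (top' (decide (0 ≤ i))) ^ i.natAbs := by
  rcases hm with rfl | rfl
  · exact ⟨N, J, K, by simp [top', lowL', lowR', a', b', c']⟩
  · cases N with
    | zero => exact ⟨0, J, K, by simp [top', lowL', lowR', b', c']⟩
    | succ N =>
      refine ⟨-(N + 1 : ℕ), K, J, ?_⟩
      have h : ¬ (0 : ℤ) ≤ -(N + 1 : ℕ) := by omega
      rw [((show Commute (b' : QFA P) c' from cb'.symm).pow_pow J K).eq, decide_eq_false h,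
        Int.natAbs_neg, Int.natAbs_natCast]
      rfl

theorem span_signedMono : Submodule.span ℂ (Set.range fun p : (ℤ × ℤ) × (ℕ × ℕ × ℕ × ℕ) =>
    (signedMono p.1.1 p.1.2 p.2.1 p.2.2.1 p.2.2.2.1 p.2.2.2.2 : QFA P)) = ⊤ := by
  rw [eq_top_iff, ← chiralSpan_mul_antichiralSpan, chiralSpan, antichiralSpan,
    Submodule.span_mul_span, Submodule.span_le]
  rintro _ ⟨m, ⟨J, K, N, hm⟩, m', ⟨J', K', N', hm'⟩, rfl⟩
  obtain ⟨i, J₁, K₁, e⟩ := exists_signed hm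
  obtain ⟨i', J₁', K₁', e'⟩ := exists_signed' hm'
  refine Submodule.subset_span ⟨⟨⟨i, i'⟩, J₁, K₁, J₁', K₁'⟩, ?_⟩
  simp only [e, e', signedMono, mono]

end QFA

theorem QUEA.span_mono {P : LinkParams} :
    Submodule.span ℂ (Set.range fun p : (P.Γ × P.Γ') × (ℕ × ℕ × ℕ × ℕ) =>
      QUEA.mono true true p.2.1 p.2.2.1 p.2.2.2.1 p.2.2.2.2 p.1.1 p.1.2) = ⊤ := by
  rw [eq_top_iff, ← QUEA.monoSpan_eq_top, QUEA.monoSpan, Submodule.span_le]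
  rintro _ ⟨J, K, J', K', u, v, rfl⟩
  exact Submodule.subset_span ⟨⟨⟨u, v⟩, J, K, J', K'⟩, rfl⟩

/-- Dedekind's independence of distinct characters gives `∑ₖ c (i, k) * w (i, k) = 0` for every `i`.
When `w (i, ·)` is supported at `t`, a single term of this sum survives. -/
theorem coeff_eq_zero_of_characters {ι κ G : Type} [Monoid G] {χ : ι → G →* ℂ}
    (hχ : Function.Injective χ) (c : ι × κ →₀ ℂ) (w : ι × κ → ℂ)
    (h : ∀ g, c.sum (fun p z => z * w p * χ p.1 g) = 0) (i : ι) (t : κ)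
    (hw : ∀ k, k ≠ t → w (i, k) = 0) : c (i, t) * w (i, t) = 0 := by
  classical
  have hli : LinearIndependent ℂ (fun i => (χ i : G → ℂ)) :=
    (linearIndependent_monoidHom G ℂ).comp χ hχ
  have h0 : c.sum (fun p z => Finsupp.single p.1 (z * w p)) = 0 := by
    rw [linearIndependent_iff] at hli
    apply hli
    rw [map_finsuppSum]
    funext g
    simpa only [Finsupp.sum, Finsupp.linearCombination_single, Finset.sum_apply, Pi.smul_apply,
      smul_eq_mul, Pi.zero_apply] using h g
  have h1 := DFunLike.congr_fun h0 i
  rw [Finsupp.sum_apply, Finsupp.zero_apply] at h1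
  rw [← h1, Finsupp.sum_eq_single (i, t)]
  · simp
  · rintro ⟨j, k⟩ _ hne
    rw [Finsupp.single_apply]
    split_ifs with hj
    · subst hj
      rw [hw k (fun e => hne (by rw [e])), mul_zero]
    · rfl
  · simp

/-! ### Nondegeneracy -/

section Nondegenerate

variable {P : LinkParams} {σ : ℤˣ} {B : QUEA P →ₗ[ℂ] QFA P →ₗ[ℂ] ℂ}

open QFAGen

/-- The character `(m, n) ↦ x ^ m * y ^ n`. -/
def powCharacter {M : Type} [Monoid M] (x y : M →* ℂ) : M × M →* ℂ :=
  (x.comp (MonoidHom.fst M M)) * (y.comp (MonoidHom.snd M M))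

theorem powCharacter_apply {M : Type} [Monoid M] (x y : M →* ℂ) (m n : M) :
    powCharacter x y (m, n) = x m * y n := rfl

theorem powCharacter_injective {M : Type} [Monoid M] {x y x₁ y₁ : M →* ℂ}
    (h : powCharacter x y = powCharacter x₁ y₁) : x = x₁ ∧ y = y₁ := by
  constructor <;> ext m
  · simpa [powCharacter_apply] using DFunLike.congr_fun h (m, 1)
  · simpa [powCharacter_apply] using DFunLike.congr_fun h (1, m)

/-- For fixed exponents `J, K, J', K'` the element is tested on monomials with the same off-diagonal
exponents and arbitrary powers `m`, `n` of `a` and `a'`. By `pairing_mono` only terms with these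
exponents survive, each contributing its coefficient times `u^m v^(-n)` up to fixed factors.
Distinct pairs `(u, v)` are distinct characters of `(m, n)`. -/
theorem nondegenerate_left (hT : HasPairingTable σ B) (hB : IsHopfPairing B)
    (hq : ∀ n : ℕ, 0 < n → P.q ^ n ≠ 1) (hq' : ∀ n : ℕ, 0 < n → P.q' ^ n ≠ 1) (x : QUEA P)
    (hx : ∀ f, B x f = 0) : x = 0 := by
  have hmem : x ∈ (⊤ : Submodule ℂ (QUEA P)) := trivial
  rw [← QUEA.span_mono, Finsupp.mem_span_range_iff_exists_finsupp] at hmem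
  obtain ⟨c, rfl⟩ := hmem
  suffices c = 0 by simp [this]
  ext ⟨⟨u₀, v₀⟩, J, K, J', K'⟩
  let χ : P.Γ × P.Γ' → Multiplicative ℕ × Multiplicative ℕ →* ℂ := fun p =>
    powCharacter (powersHom ℂ ((p.1 : ℂˣ) : ℂ)) (powersHom ℂ ((p.2 : ℂˣ) : ℂ)⁻¹)
  have hχ : Function.Injective χ := by
    rintro ⟨u, v⟩ ⟨u₁, v₁⟩ h
    obtain ⟨h1, h2⟩ := powCharacter_injective h
    have h1 := (powersHom ℂ).injective h1
    have h2 := (powersHom ℂ).injective h2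
    exact Prod.ext (Subtype.ext (Units.ext h1)) (Subtype.ext (Units.ext (inv_injective h2)))
  -- Lowering adds `K + J` and `K' + J'` diagonal generators to the powers `m` and `n`. Their Cartan
  -- values form the weight.
  let w : (P.Γ × P.Γ') × (ℕ × ℕ × ℕ × ℕ) → ℂ := fun p =>
    if p.2 = (J, K, J', K') then
      ((p.1.1 : ℂˣ) : ℂ) ^ (K + J) * ((p.1.2 : ℂˣ) : ℂ)⁻¹ ^ (K' + J') else 0
  have key := coeff_eq_zero_of_characters hχ c w ?_ (u₀, v₀) (J, K, J', K')
    (fun k hk => if_neg hk)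
  · have hw : w ((u₀, v₀), J, K, J', K') ≠ 0 := by simp [w]
    simpa [hw] using key
  · rintro ⟨m, n⟩
    obtain ⟨z, hz, ez⟩ := pairing_mono hT hB hq hq' true true J K J' K' J K m.toAdd J' K' n.toAdd
    have h := hx (QFA.mono true true J K m.toAdd J' K' n.toAdd)
    rw [map_finsuppSum, Finsupp.sum, LinearMap.sum_apply] at h
    -- The constant depends on `m` and `n` but not on `(u, v)`, so it factors out of each equation.
    refine (mul_eq_zero.mp (?_ : z * _ = 0)).resolve_left hz
    rw [← h, Finsupp.sum, Finset.mul_sum]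
    refine Finset.sum_congr rfl ?_
    rintro ⟨⟨u, v⟩, j, k, j', k'⟩ -
    rw [map_smul, LinearMap.smul_apply]
    simp only [w, χ, powCharacter_apply]
    by_cases hp : (j, k, j', k') = (J, K, J', K')
    · obtain ⟨rfl, rfl, rfl, rfl⟩ : j = J ∧ k = K ∧ j' = J' ∧ k' = K' := by simpa using hp
      rw [ez u v]
      simp only [and_self, if_true, top, top', cartanVal, powersHom_apply, smul_eq_mul]
      ring
    · obtain ⟨z', -, ez'⟩ := pairing_mono hT hB hq hq' true true j k j' k' J K m.toAdd J' K' n.toAdd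
      rw [ez' u v, if_neg hp, if_neg (by simpa using hp)]
      simp

/-- The left and right Cartan weights of an off-diagonal generator are inverse to each other, while
those of a diagonal generator agree. The combined action thus measures the diagonal exponents only.
-/
theorem leftAct_kk_mono (hT : HasPairingTable σ B) (hB : IsHopfPairing B) (u : P.Γ) (v : P.Γ')
    (s s' : Bool) (J K N J' K' N' : ℕ) :
    leftAct B (QUEA.kk u v) (rightAct B (QUEA.kk u v) (QFA.mono s s' J K N J' K' N')) =
      (((top s).cartanVal ((u : ℂˣ) : ℂ) ((v : ℂˣ) : ℂ) ^ 2) ^ N *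
        ((top' s').cartanVal ((u : ℂˣ) : ℂ) ((v : ℂˣ) : ℂ) ^ 2) ^ N') •
        QFA.mono s s' J K N J' K' N' := by
  let D : QFA P →ₗ[ℂ] QFA P := leftAct B (QUEA.kk u v) ∘ₗ rightAct B (QUEA.kk u v)
  have h1 : D 1 = 1 := by
    simp only [D, LinearMap.comp_apply, rightAct_one hB, QUEA.counit_kk, one_smul, leftAct_one hB]
  have hmul : ∀ f g, D (f * g) = D f * D g := fun f g => by
    simp only [D, LinearMap.comp_apply, rightAct_mul_of_groupLike hB (QUEA.comul_kk u v),
      leftAct_mul_of_groupLike hB (QUEA.comul_kk u v)]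
  have hpow : ∀ (f : QFA P) (z : ℂ), D f = z • f → ∀ n : ℕ, D (f ^ n) = z ^ n • f ^ n :=
    fun f z h n => by
      induction n with
      | zero => simp [h1]
      | succ n ih => rw [pow_succ, hmul, ih, h, smul_mul_smul_comm, ← pow_succ, ← pow_succ]
  have hg : ∀ (g : QFAGen) (z : ℂ), g.rightWeight ((u : ℂˣ) : ℂ) ((v : ℂˣ) : ℂ) *
      g.leftWeight ((u : ℂˣ) : ℂ) ((v : ℂˣ) : ℂ) = z → D (QFA.gen g) = z • QFA.gen g :=
    fun g z h => by
      simp only [D, LinearMap.comp_apply, rightAct_kk_gen hT hB, map_smul, leftAct_kk_gen hT hB,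
        smul_smul, h]
  have e1 := hpow _ _ (hg (lowL s) 1 (by cases s <;> simp [lowL, leftWeight, rightWeight])) J
  have e2 := hpow _ _ (hg (lowR s) 1 (by cases s <;> simp [lowR, leftWeight, rightWeight])) K
  have e3 := hpow _ _ (hg (top s) ((top s).cartanVal ((u : ℂˣ) : ℂ) ((v : ℂˣ) : ℂ) ^ 2)
    (by cases s <;> exact (sq _).symm)) N
  have e1' := hpow _ _ (hg (lowL' s') 1 (by cases s' <;> simp [lowL', leftWeight, rightWeight])) J'
  have e2' := hpow _ _ (hg (lowR' s') 1 (by cases s' <;> simp [lowR', leftWeight, rightWeight])) K'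
  have e3' := hpow _ _ (hg (top' s') ((top' s').cartanVal ((u : ℂˣ) : ℂ) ((v : ℂˣ) : ℂ) ^ 2)
    (by cases s' <;> exact (sq _).symm)) N'
  change D (QFA.mono s s' J K N J' K' N') = _
  rw [QFA.mono, hmul, hmul, hmul, hmul, hmul, e1, e2, e3, e1', e2', e3']
  simp only [one_pow, one_smul, smul_mul_assoc, mul_smul_comm, smul_smul, mul_comm]

theorem zpow_injective_of_pow_ne_one {z : ℂ} (hz : z ≠ 0) (h : ∀ n : ℕ, 0 < n → z ^ n ≠ 1) :
    Function.Injective (fun i : ℤ => z ^ i) := by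
  intro i j hij
  by_contra hne
  have h1 : z ^ (i - j) = 1 := by
    rw [zpow_sub₀ hz, show z ^ i = z ^ j from hij, div_self (zpow_ne_zero _ hz)]
  apply h (i - j).natAbs (Int.natAbs_pos.mpr (sub_ne_zero.mpr hne))
  rcases Int.natAbs_eq (i - j) with e | e <;> rw [e] at h1
  · rwa [zpow_natCast] at h1
  · rwa [zpow_neg, zpow_natCast, inv_eq_one] at h1

/-- Since `a` and `d` have inverse Cartan values, a signed exponent makes both cases one integer
power. -/
theorem cartanVal_top_pow (x y : ℂ) (i : ℤ) (m : ℕ) :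
    ((top (decide (0 ≤ i))).cartanVal (x ^ m) y ^ 2) ^ i.natAbs = ((x ^ 2) ^ i) ^ m := by
  by_cases hi : 0 ≤ i
  · obtain ⟨n, rfl⟩ := Int.eq_ofNat_of_zero_le hi
    simp only [hi, decide_true, top, cartanVal, Int.natAbs_natCast, zpow_natCast]
    simp only [← pow_mul]
    congr 1
    ring
  · obtain ⟨n, rfl⟩ := Int.eq_negSucc_of_lt_zero (not_le.mp hi)
    simp only [hi, decide_false, top, cartanVal, Int.natAbs_negSucc, zpow_negSucc, Nat.succ_eq_add_one]
    simp only [inv_pow, ← pow_mul]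
    congr 2
    ring

theorem cartanVal_top'_pow (x y : ℂ) (i : ℤ) (m : ℕ) :
    ((top' (decide (0 ≤ i))).cartanVal x (y ^ m) ^ 2) ^ i.natAbs = ((y ^ 2) ^ i)⁻¹ ^ m := by
  by_cases hi : 0 ≤ i
  · obtain ⟨n, rfl⟩ := Int.eq_ofNat_of_zero_le hi
    simp only [hi, decide_true, top', cartanVal, Int.natAbs_natCast, zpow_natCast]
    simp only [inv_pow, ← pow_mul]
    congr 2
    ring
  · obtain ⟨n, rfl⟩ := Int.eq_negSucc_of_lt_zero (not_le.mp hi)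
    simp only [hi, decide_false, top', cartanVal, Int.natAbs_negSucc, zpow_negSucc, inv_inv,
      Nat.succ_eq_add_one]
    simp only [← pow_mul]
    congr 1
    ring

/-- The formula of `pairing_mono` requires the same Booleans on both sides, whereas `f` may contain
all sign patterns. Cartan elements are therefore placed on both sides of a test element `y`: they
scale a monomial with signed exponents `(i, i')` by powers of `q^i` and `q'^(-i')`, and since `q`
and `q'` are not roots of unity these characters isolate one pair `(i₀, i₀')`. Within this pair `y`
detects the off-diagonal exponents. -/
theorem nondegenerate_right (hT : HasPairingTable σ B) (hB : IsHopfPairing B)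
    (hq : ∀ n : ℕ, 0 < n → P.q ^ n ≠ 1) (hq' : ∀ n : ℕ, 0 < n → P.q' ^ n ≠ 1) (f : QFA P)
    (hf : ∀ x, B x f = 0) : f = 0 := by
  have hmem : f ∈ (⊤ : Submodule ℂ (QFA P)) := trivial
  rw [← QFA.span_signedMono, Finsupp.mem_span_range_iff_exists_finsupp] at hmem
  obtain ⟨c, rfl⟩ := hmem
  suffices c = 0 by simp [this]
  ext ⟨⟨i₀, i₀'⟩, J, K, J', K'⟩
  let χ : ℤ × ℤ → Multiplicative ℕ × Multiplicative ℕ →* ℂ := fun p =>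
    powCharacter (powersHom ℂ (P.q ^ p.1)) (powersHom ℂ (P.q' ^ p.2)⁻¹)
  have hχ : Function.Injective χ := by
    rintro ⟨i, i'⟩ ⟨j, j'⟩ h
    obtain ⟨h1, h2⟩ := powCharacter_injective h
    have h1 := (powersHom ℂ).injective h1
    have h2 := (powersHom ℂ).injective h2
    exact Prod.ext (zpow_injective_of_pow_ne_one P.q_ne hq h1)
      (zpow_injective_of_pow_ne_one P.q'_ne hq' (inv_injective h2))
  -- The orderings are adapted to the signs of `i₀` and `i₀'`; the values of `y` on monomials with
  -- other signed exponents are never computed.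
  let y : QUEA P := QUEA.mono (decide (0 ≤ i₀)) (decide (0 ≤ i₀')) J K J' K' 1 1
  let m : (ℤ × ℤ) × (ℕ × ℕ × ℕ × ℕ) → QFA P := fun p =>
    QFA.signedMono p.1.1 p.1.2 p.2.1 p.2.2.1 p.2.2.2.1 p.2.2.2.2
  have hm : ∀ k, (k = (J, K, J', K') → B y (m ((i₀, i₀'), k)) ≠ 0) ∧
      (k ≠ (J, K, J', K') → B y (m ((i₀, i₀'), k)) = 0) := by
    rintro ⟨j, k, j', k'⟩
    obtain ⟨z, hz, ez⟩ := pairing_mono hT hB hq hq' (decide (0 ≤ i₀)) (decide (0 ≤ i₀'))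
      J K J' K' j k i₀.natAbs j' k' i₀'.natAbs
    have e := ez 1 1
    constructor
    · intro h
      obtain ⟨rfl, rfl, rfl, rfl⟩ : j = J ∧ k = K ∧ j' = J' ∧ k' = K' := by simpa using h
      rw [if_pos ⟨rfl, rfl, rfl, rfl⟩] at e
      simp only [y, m, QFA.signedMono, e]
      refine mul_ne_zero hz (mul_ne_zero (pow_ne_zero _ ?_) (pow_ne_zero _ ?_))
      · cases decide (0 ≤ i₀) <;> simp [top, cartanVal]
      · cases decide (0 ≤ i₀') <;> simp [top', cartanVal]
    · intro h
      simp only [y, m, QFA.signedMono, e]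
      exact if_neg fun e => h (by simp [e])
  have key := coeff_eq_zero_of_characters hχ c (fun p => B y (m p)) ?_ (i₀, i₀') (J, K, J', K')
    (fun k hk => (hm k).2 hk)
  · exact (mul_eq_zero.mp key).resolve_right ((hm _).1 rfl)
  · rintro ⟨n, n'⟩
    have h := hf (QUEA.kk (P.gq ^ n.toAdd) (P.gq' ^ n'.toAdd) *
      (y * QUEA.kk (P.gq ^ n.toAdd) (P.gq' ^ n'.toAdd)))
    rw [← pairing_rightAct hB, ← pairing_leftAct hB, map_finsuppSum, map_finsuppSum,
      map_finsuppSum] at h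
    rw [← h]
    refine Finset.sum_congr rfl ?_
    rintro ⟨⟨i, i'⟩, j, k, j', k'⟩ -
    simp only [map_smul, QFA.signedMono, leftAct_kk_mono hT hB, Subgroup.coe_pow,
      Units.val_pow_eq_pow_val, cartanVal_top_pow, cartanVal_top'_pow, m, χ, powCharacter_apply,
      powersHom_apply, smul_eq_mul, QUEA.coe_gq, QUEA.coe_gq']
    ring

end Nondegenerate

end

theorem mainTheorem2 (P : LinkParams) (hP : P.IsLorentz)
    (hq : ∀ n : ℕ, 0 < n → P.q ^ n ≠ 1) (σ : ℤˣ) :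
    ∃ B : QUEA P →ₗ[ℂ] QFA P →ₗ[ℂ] ℂ,
      HasPairingTable σ B ∧
      IsPerfectStarDuality (QUEA.lorentzStar hP σ) (QFA.lorentzStar hP) B ∧
      ∀ B' : QUEA P →ₗ[ℂ] QFA P →ₗ[ℂ] ℂ,
        HasPairingTable σ B' → IsHopfPairing B' → B' = B := by
  have hq' := hP.q'_pow_ne_one hq
  -- Existence of the pairing needs only `q² ≠ 1` and `q'² ≠ 1`; the higher powers are used for
  -- nondegeneracy.
  have h2 := hq 2 two_pos
  have h2' := hq' 2 two_pos
  have hT := LinkParams.hasPairingTable_pairing h2 h2' (QUEA.sign_sq σ)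
  have hB := LinkParams.isHopfPairing_pairing h2 (QUEA.sign_sq σ) h2'
  exact ⟨_, hT,
    { star_left := QUEA.isHopfStar_lorentzStar hP σ
      star_right := QFA.isHopfStar_lorentzStar hP
      pairing := hB
      nondegenerate_left := nondegenerate_left hT hB hq hq'
      nondegenerate_right := nondegenerate_right hT hB hq hq'
      star := hT.star hB hP },
    fun _ hT' hB' => hT'.unique hB' hT hB⟩
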